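/- Let $\Gamma$ be a finitely generated torsion-free nilpotent group whose abelianization $\Gamma^{ab}=\Gamma/[\Gamma,\Gamma]$ is torsion-free, let $\Gamma\curvearrowright (X,m)$ be an ergodic probability-measure-preserving action, and let $c:\Gamma\times X\to[0,\infty)$ be a measurable subadditive cocycle, i.e. for all $\gamma_1,\gamma_2\in\Gamma$ and $m$-a.e. $x\in X$ $$c(\gamma_1\gamma_2,x)\le c(\gamma_1,\gamma_2x)+c(\gamma_2,x).$$ Assume that $c(\gamma,\cdot)\in L^1(X,m)$ for every $\gamma\in\Gamma$. Put $\overline c(\gamma)=\int_X c(\gamma,x)\,dm(x)$ for $\gamma\in\Gamma$, write $\overline\gamma$ for the image of $\gamma$ in $\Gamma^{ab}$, and for $a\in\Gamma^{ab}$ put $f(a)=\inf\{\overline c(\gamma) : \gamma\in\Gamma,\ \overline\gamma=a\}$. Then there is a unique function $\phi:\Gamma^{ab}\otimes\mathbb R\to[0,\infty)$ that is subadditive, satisfies $\phi(tv)=t\phi(v)$ for all $t>0$ and all $v$, and represents $f$ in the sense that $f(a)-\phi(a)=o(|a|)$ as $|a|\to\infty$ in $\Gamma^{ab}$, where $|\cdot|$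 is the word length with respect to a finite generating set of $\Gamma^{ab}$ and $a$ is identified with $a\otimes 1$. With this $\phi$ the following hold. (1) Suppose that $c(\gamma,\cdot)\in L^\infty(X,m)$ for every $\gamma\in\Gamma$. Then for all $k$ and all $T_1,\dots,T_k\in\Gamma$ one has, for $m$-a.e. $x$ and in $L^1(X,m)$, $$\lim_{n\to\infty}\frac1n\, c\bigl(T_j^n,\;T_{j-1}^n\cdots T_1^n x\bigr)=\phi(\overline{T_j})\qquad(j=1,\dots,k),$$ and consequently, for $m$-a.e. $x$ and in $L^1(X,m)$, $$\lim_{n\to\infty}\frac1n\sum_{j=1}^k c\bigl(T_j^n,\;T_{j-1}^n\cdots T_1^n x\bigr)=\sum_{j=1}^k\phi(\overline{T_j}).$$ (2) The $L^1(X,m)$-convergence statements in (1) hold without the $L^\infty$ assumption, i.e. assuming only that $c(\gamma,\cdot)\in L^1(X,m)$ for every $\gamma\in\Gamma$. -/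

import Mathlib

open MeasureTheory Filter Topology
open scoped TensorProduct ENNReal

/-- `c : Γ × X → ℝ₊` is a measurable, non-negative, subadditive cocycle over the action of the
(countable, discrete) group `Γ` on `(X, m)`. -/
structure IsSubadditiveCocycle {Γ X : Type*} [Group Γ] [MulAction Γ X] [MeasurableSpace X]
    (m : Measure X) (c : Γ → X → ℝ) : Prop where
  measurable : ∀ γ, Measurable (c γ)
  nonneg : ∀ γ x, 0 ≤ c γ x
  subadditive : ∀ γ₁ γ₂, ∀ᵐ x ∂m, c (γ₁ * γ₂) x ≤ c γ₁ (γ₂ • x) + c γ₂ x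

/-- The average `c̄(γ) = ∫ c(γ, x) dm(x)` of a cocycle. -/
noncomputable def cocycleAverage {Γ X : Type*} [MeasurableSpace X]
    (m : Measure X) (c : Γ → X → ℝ) (γ : Γ) : ℝ :=
  ∫ x, c γ x ∂m

/-- The function on the abelianization obtained by minimizing `F` over the fibers of
`Γ → Γᵃᵇ`. -/
noncomputable def abelianizationInf {Γ : Type*} [Group Γ] (F : Γ → ℝ) (a : Abelianization Γ) : ℝ :=
  sInf {r | ∃ γ : Γ, Abelianization.of γ = a ∧ F γ = r}

/-- The word length `|g|_S`: the length of a shortest word in `S ∪ S⁻¹` that represents `g`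
(meaningful when `S` generates `G`). -/
noncomputable def wordLength {G : Type*} [Group G] (S : Set G) (g : G) : ℕ :=
  sInf {n | ∃ l : List G, (∀ s ∈ l, s ∈ S ∨ s⁻¹ ∈ S) ∧ l.prod = g ∧ l.length = n}

/-- `f` and `f'` are asymptotically equivalent: `f(g) - f'(g) = o(|g|_S)` as `|g|_S → ∞`,
for the word length of any finite generating set `S`. -/
def AsymptoticallyEquivalent {G : Type*} [Group G] (f f' : G → ℝ) : Prop :=
  ∀ S : Finset G, Subgroup.closure (S : Set G) = ⊤ →
    (fun g => f g - f' g) =o[comap (wordLength (S : Set G)) atTop]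
      fun g => (wordLength (S : Set G) g : ℝ)

/-- The real vector space `Γᵃᵇ ⊗ ℝ` (the scalar factor is written on the left). -/
abbrev RealAbelianization (Γ : Type*) [Group Γ] : Type _ :=
  ℝ ⊗[ℤ] Additive (Abelianization Γ)

/-- The canonical map `Γᵃᵇ → Γᵃᵇ ⊗ ℝ`. -/
noncomputable def toRealAbelianization {Γ : Type*} [Group Γ] (a : Abelianization Γ) :
    RealAbelianization Γ :=
  (1 : ℝ) ⊗ₜ[ℤ] Additive.ofMul a

/-- `φ : Γᵃᵇ ⊗ ℝ → ℝ₊` is a homogeneous subadditive function that represents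
`f : Γᵃᵇ → ℝ₊`, i.e. `f` is asymptotically equivalent to the restriction of `φ` to `Γᵃᵇ`. -/
structure IsHomogeneousRepresentative {Γ : Type*} [Group Γ]
    (f : Abelianization Γ → ℝ) (φ : RealAbelianization Γ → ℝ) : Prop where
  nonneg : ∀ v, 0 ≤ φ v
  subadditive : ∀ v w, φ (v + w) ≤ φ v + φ w
  homogeneous : ∀ (t : ℝ) (v), 0 < t → φ (t • v) = t * φ v
  asymptotic : AsymptoticallyEquivalent f fun a => φ (toRealAbelianization a)

/-- For a tuple `T 0, …, T (k-1)` the product `T (j-1) ^ n * ⋯ * T 0 ^ n` of the `n`-th powers of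
its first `j` entries, the later ones being further to the left. -/
def polygonalProd {Γ : Type*} [Group Γ] {k : ℕ} (T : Fin k → Γ) (n j : ℕ) : Γ :=
  (((List.ofFn T).take j).map (· ^ n)).reverse.prod

/-- `h n → a` in `L¹(X, m)`. -/
def TendstoL1 {X : Type*} [MeasurableSpace X] (m : Measure X) (h : ℕ → X → ℝ) (a : ℝ) : Prop :=
  (∀ n, MemLp (h n) 1 m) ∧ Tendsto (fun n => eLpNorm (fun x => h n x - a) 1 m) atTop (𝓝 0)

/-! ### Weighted words in commutators -/

/-! The proof rests on one geometric fact about nilpotent groups. Let a k-fold commutator of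
generators cost t ^ k, and think of t as 1/n. Conjugation and commutators distort costs only by
exponentials of the costs involved. A word of cost O(1) has length O(n), and a word of cost o(1) has
length o(n), for every symmetric subadditive length (`HasCost.length_le`,
`HasCost.length_le_of_small`). Since T ^ n has cost O(1), three facts follow. (a) T ^ n g T ^ (-n)
has length o(n). (b) A ^ n B ^ (-n) has length o(n) if A and B agree in the abelianization. (c)
Changing the exponents in T_k ^ n ⋯ T_1 ^ n by a small proportion of n moves the product by at most
δ n, also after conjugation by T ^ n.

The averages of the cocycle are subadditive on Γ, so their fiberwise infimum f is subadditive on the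
abelianization, a lattice, and φ is its homogenization. By (b) the growth rate of the averages along
T ^ n depends only on the class of T. Comparing T ^ K with all γ in its class identifies that rate
with φ (`tendsto_pow_div_of_abelianizationInf`).

Mean convergence: c(T ^ n, ·)/n is Cauchy in L¹ by comparison with ergodic averages of c(T ^ K,
·)/K. The element T alone need not act ergodically, but (a), with the averages as length, makes the
limit Γ-invariant, hence constant. Moving the base point by a measure-preserving map does not change
the distance to a constant, so the polygonal statement in L¹ is immediate.

Almost everywhere convergence: for bounded cocycles the essential suprema give a length that
controls single points. Fact (a) yields a zero-one law, and covering arguments then give convergence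
along T ^ n from a fixed base point. For the moving base point g_n x, the set F where this
convergence is late has small measure. A maximal inequality, applied once per side of the polygon,
produces z close to g_n with z x outside F, and (c) bounds the resulting error. -/

section Words

open scoped commutatorElement

variable {G : Type*} [Group G]

/-- `IsLetter S k x`: `x` is an iterated commutator of `k` elements of `S`. -/
inductive IsLetter (S : Set G) : ℕ → G → Prop
  | gen {x : G} (hx : x ∈ S) : IsLetter S 1 x
  | comm {i j : ℕ} {a b : G} (ha : IsLetter S i a) (hb : IsLetter S j b) :
      IsLetter S (i + j) ⁅a, b⁆

/-- `HasCost A t r g`: the element `g` is the product of a word in letters from the weighted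
alphabet `A`, in which a letter of weight `k` costs `t ^ k`, of total cost at most `r`. -/
inductive HasCost (A : ℕ → G → Prop) (t : ℝ) : ℝ → G → Prop
  | one {r : ℝ} (hr : 0 ≤ r) : HasCost A t r 1
  | cons {k : ℕ} {x g : G} {r r' : ℝ} (hx : A k x) (hg : HasCost A t r g) (hr : t ^ k + r ≤ r') :
      HasCost A t r' (x * g)

/-- The alphabet of all letters of weight at least `k`. -/
def letters (S : Set G) (k : ℕ) : ℕ → G → Prop := fun j x => k ≤ j ∧ IsLetter S j x

variable {S : Set G} {A B : ℕ → G → Prop} {t r r' ρ : ℝ} {g h : G}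

lemma IsLetter.one_le {k : ℕ} {x : G} (h : IsLetter S k x) : 1 ≤ k := by
  induction h with
  | gen => rfl
  | comm _ _ h1 h2 => omega

lemma IsLetter.inv (hS : ∀ x ∈ S, x⁻¹ ∈ S) {k : ℕ} {x : G} (h : IsLetter S k x) :
    IsLetter S k x⁻¹ := by
  cases h with
  | gen hx => exact .gen (hS _ hx)
  | comm ha hb => rw [commutatorElement_inv, add_comm]; exact .comm hb ha

lemma IsLetter.finite (hS : S.Finite) (k : ℕ) : {x | IsLetter S k x}.Finite := by
  induction k using Nat.strong_induction_on with
  | _ k ih =>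
    have hfin : (S ∪ ⋃ i ∈ Finset.range k, ⋃ j ∈ Finset.range k,
        Set.image2 (fun a b => ⁅a, b⁆) {x | IsLetter S i x} {x | IsLetter S j x}).Finite := by
      refine hS.union ?_
      refine Set.Finite.biUnion (Finset.range k).finite_toSet fun i hi => ?_
      refine Set.Finite.biUnion (Finset.range k).finite_toSet fun j hj => ?_
      exact Set.Finite.image2 _ (ih i (by simpa using hi)) (ih j (by simpa using hj))
    refine hfin.subset fun x hx => ?_
    cases hx with
    | gen hx => exact Or.inl hx
    | @comm i j a b ha hb =>
      refine Or.inr ?_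
      have := ha.one_le
      have := hb.one_le
      simp only [Set.mem_iUnion]
      exact ⟨i, by simp; omega, j, by simp; omega, a, ha, b, hb, rfl⟩

/-- The bracketing is arbitrary, so only the heavier entry of each commutator is followed: it
carries at least half of the weight. This crude bound is enough to make heavy letters trivial in a
nilpotent group. -/
lemma IsLetter.mem_lowerCentralSeries (d : ℕ) {k : ℕ} {x : G} (h : IsLetter S k x)
    (hk : 2 ^ d < k) : x ∈ (⊤ : Subgroup G).lowerCentralSeries (d + 1) := by
  induction d generalizing k x with
  | zero =>
    cases h with
    | gen => simp at hk
    | comm ha hb =>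
      rw [Subgroup.lowerCentralSeries_succ]
      exact Subgroup.commutator_mem_commutator (Subgroup.mem_top _) (Subgroup.mem_top _)
  | succ d ih =>
    cases h with
    | gen =>
      have := Nat.one_le_two_pow (n := d + 1)
      omega
    | @comm i j a b ha hb =>
      rw [Subgroup.lowerCentralSeries_succ]
      have : 2 ^ d < i ∨ 2 ^ d < j := by
        rw [pow_succ] at hk
        omega
      rcases this with hi | hj
      · exact Subgroup.commutator_mem_commutator (ih ha hi) (Subgroup.mem_top _)
      · rw [Subgroup.commutator_comm]
        exact Subgroup.commutator_mem_commutator (Subgroup.mem_top _) (ih hb hj)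

lemma IsLetter.exists_eq_one_of_nilpotent [Group.IsNilpotent G] (S : Set G) :
    ∃ D : ℕ, ∀ k x, D < k → IsLetter S k x → x = 1 := by
  obtain ⟨n, hn⟩ := Subgroup.nilpotent_iff_lowerCentralSeries.mp (inferInstance : Group.IsNilpotent G)
  refine ⟨2 ^ n, fun k x hk hx => ?_⟩
  have h1 := hx.mem_lowerCentralSeries n hk
  have h2 := Subgroup.lowerCentralSeries_antitone (S := (⊤ : Subgroup G)) (Nat.le_succ n) h1
  rw [hn] at h2
  simpa using h2

namespace HasCost

lemma nonneg (ht : 0 ≤ t) (h : HasCost A t r g) : 0 ≤ r := by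
  induction h with
  | one hr => exact hr
  | cons _ _ hr ih => have := pow_nonneg ht; linarith [this ‹_›]

lemma mono (h : HasCost A t r g) (hr : r ≤ r') : HasCost A t r' g := by
  cases h with
  | one h0 => exact .one (h0.trans hr)
  | cons hx hg h1 => exact .cons hx hg (h1.trans hr)

lemma mono_letters (hAB : ∀ k x, A k x → B k x) (h : HasCost A t r g) : HasCost B t r g := by
  induction h with
  | one hr => exact .one hr
  | cons hx _ hr ih => exact .cons (hAB _ _ hx) ih hr

lemma anti {k l : ℕ} (hkl : k ≤ l) (h : HasCost (letters S l) t r g) :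
    HasCost (letters S k) t r g :=
  h.mono_letters fun _ _ hx => ⟨hkl.trans hx.1, hx.2⟩

lemma letter {k : ℕ} {x : G} (hx : A k x) : HasCost A t (t ^ k) x := by
  simpa using HasCost.cons hx (HasCost.one (le_refl (0 : ℝ))) (by simp : t ^ k + 0 ≤ t ^ k)

lemma mul (hg : HasCost A t r g) (hh : HasCost A t r' h) : HasCost A t (r + r') (g * h) := by
  induction hg with
  | one hr => simpa using hh.mono (by linarith)
  | cons hx _ hr ih => rw [mul_assoc]; exact .cons hx ih (by linarith)

lemma pow (hg : HasCost A t r g) (n : ℕ) : HasCost A t (n * r) (g ^ n) := by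
  induction n with
  | zero => simpa using HasCost.one (A := A) (t := t) le_rfl
  | succ n ih =>
    rw [pow_succ]
    exact (ih.mul hg).mono (by push_cast; linarith)

lemma inv (hA : ∀ k x, A k x → A k x⁻¹) (h : HasCost A t r g) : HasCost A t r g⁻¹ := by
  induction h with
  | one hr => simpa using HasCost.one hr
  | cons hx _ hr ih =>
    rw [mul_inv_rev]
    exact (ih.mul (letter (hA _ _ hx))).mono (by linarith)

end HasCost

lemma letters_inv (hS : ∀ x ∈ S, x⁻¹ ∈ S) (i k : ℕ) (x : G) (h : letters S i k x) :
    letters S i k x⁻¹ := ⟨h.1, h.2.inv hS⟩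

lemma one_add_le_exp (x : ℝ) : 1 + x ≤ Real.exp x := by
  linarith [Real.add_one_le_exp x]

namespace HasCost

/-- Conjugation by a replaces each letter x by ⁅a, x⁆ x, which multiplies its cost by 1 + t ^ i and
creates no lighter letter. -/
lemma conj_letter (ht : 0 ≤ t) {i k : ℕ} {a : G} (ha : IsLetter S i a)
    (h : HasCost (letters S k) t r g) :
    HasCost (letters S k) t ((1 + t ^ i) * r) (a * g * a⁻¹) := by
  induction h with
  | one hr => simpa using HasCost.one (by positivity)
  | @cons j x g r r' hx hg hr ih =>
    have h1 : HasCost (letters S k) t (t ^ (i + j)) ⁅a, x⁆ :=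
      letter ⟨hx.1.trans (Nat.le_add_left _ _), ha.comm hx.2⟩
    have h2 := (h1.mul (letter hx)).mul ih
    have h3 : a * (x * g) * a⁻¹ = ⁅a, x⁆ * x * (a * g * a⁻¹) := by
      rw [commutatorElement_def]; group
    rw [h3]
    refine h2.mono ?_
    have := pow_nonneg ht i
    calc t ^ (i + j) + t ^ j + (1 + t ^ i) * r = (1 + t ^ i) * (t ^ j + r) := by ring
      _ ≤ _ := by gcongr

/-- Conjugating by one letter after another gives the product of the factors 1 + t ^ j ≤ exp (t ^
j), which is at most exp ρ. -/
lemma conj (ht : 0 ≤ t) {l k : ℕ} (hh : HasCost (letters S l) t ρ h)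
    (hg : HasCost (letters S k) t r g) :
    HasCost (letters S k) t (Real.exp ρ * r) (h * g * h⁻¹) := by
  have hr0 := hg.nonneg ht
  induction hh with
  | one hr =>
    simpa using hg.mono (le_mul_of_one_le_left hr0 (Real.one_le_exp hr))
  | @cons j x h ρ ρ' hx hh hr ih =>
    have h1 := conj_letter ht hx.2 ih
    have h2 : x * h * g * (x * h)⁻¹ = x * (h * g * h⁻¹) * x⁻¹ := by group
    rw [h2]
    refine h1.mono ?_
    rw [← mul_assoc]
    gcongr
    calc (1 + t ^ j) * Real.exp ρ ≤ Real.exp (t ^ j) * Real.exp ρ := by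
          gcongr; exact one_add_le_exp _
      _ = Real.exp (t ^ j + ρ) := (Real.exp_add _ _).symm
      _ ≤ _ := Real.exp_le_exp.mpr hr

lemma commutator_letter (ht : 0 ≤ t) {i j l : ℕ} {a : G} (ha : letters S i l a)
    (hg : HasCost (letters S j) t r g) :
    HasCost (letters S (i + j)) t (t ^ l * (r * Real.exp r)) ⁅a, g⁆ := by
  induction hg with
  | one hr => simpa using HasCost.one (by positivity)
  | @cons m x g r r' hx hg hr ih =>
    have hr0 := hg.nonneg ht
    have h1 : HasCost (letters S (i + j)) t (t ^ (l + m)) ⁅a, x⁆ :=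
      letter ⟨Nat.add_le_add ha.1 hx.1, ha.2.comm hx.2⟩
    have h2 := h1.mul (conj_letter ht hx.2 ih)
    have h3 : ⁅a, x * g⁆ = ⁅a, x⁆ * (x * ⁅a, g⁆ * x⁻¹) := by
      simp only [commutatorElement_def]; group
    rw [h3]
    refine h2.mono ?_
    have hm := pow_nonneg ht m
    have e1 : (1 + t ^ m) * Real.exp r ≤ Real.exp r' := by
      calc (1 + t ^ m) * Real.exp r ≤ Real.exp (t ^ m) * Real.exp r := by
            gcongr; exact one_add_le_exp _
        _ = Real.exp (t ^ m + r) := (Real.exp_add _ _).symm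
        _ ≤ _ := Real.exp_le_exp.mpr hr
    have e2 : 1 ≤ Real.exp r' := Real.one_le_exp (by linarith)
    calc t ^ (l + m) + (1 + t ^ m) * (t ^ l * (r * Real.exp r))
        = t ^ l * (t ^ m * 1 + r * ((1 + t ^ m) * Real.exp r)) := by ring
      _ ≤ t ^ l * (t ^ m * Real.exp r' + r * Real.exp r') := by gcongr
      _ = t ^ l * ((t ^ m + r) * Real.exp r') := by ring
      _ ≤ _ := by gcongr

/-- Weights add and costs multiply, as for a bilinear bracket. The exponential pays for the
conjugations in the expansion of ⁅x g, h⁆. -/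
lemma commutator (ht : 0 ≤ t) {i j : ℕ} (hg : HasCost (letters S i) t r g)
    (hh : HasCost (letters S j) t ρ h) :
    HasCost (letters S (i + j)) t (r * ρ * Real.exp (r + ρ)) ⁅g, h⁆ := by
  have hρ := hh.nonneg ht
  induction hg with
  | one hr => simpa using HasCost.one (by positivity)
  | @cons m x g r r' hx hg hr ih =>
    have hr0 := hg.nonneg ht
    have h1 := (conj_letter ht hx.2 ih).mul (commutator_letter ht hx hh)
    have h3 : ⁅x * g, h⁆ = x * ⁅g, h⁆ * x⁻¹ * ⁅x, h⁆ := by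
      simp only [commutatorElement_def]; group
    rw [h3]
    refine h1.mono ?_
    have hm := pow_nonneg ht m
    have e1 : (1 + t ^ m) * Real.exp (r + ρ) ≤ Real.exp (r' + ρ) := by
      calc (1 + t ^ m) * Real.exp (r + ρ) ≤ Real.exp (t ^ m) * Real.exp (r + ρ) := by
            gcongr; exact one_add_le_exp _
        _ = Real.exp (t ^ m + (r + ρ)) := (Real.exp_add _ _).symm
        _ ≤ _ := Real.exp_le_exp.mpr (by linarith)
    have e2 : Real.exp ρ ≤ Real.exp (r' + ρ) := Real.exp_le_exp.mpr (by linarith)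
    calc (1 + t ^ m) * (r * ρ * Real.exp (r + ρ)) + t ^ m * (ρ * Real.exp ρ)
        = r * ρ * ((1 + t ^ m) * Real.exp (r + ρ)) + t ^ m * ρ * Real.exp ρ := by ring
      _ ≤ r * ρ * Real.exp (r' + ρ) + t ^ m * ρ * Real.exp (r' + ρ) := by gcongr
      _ = (t ^ m + r) * ρ * Real.exp (r' + ρ) := by ring
      _ ≤ _ := by gcongr

/-- A product of `M` elements close to `e` is close to `e ^ M`. -/
lemma prod_of_near (ht : 0 ≤ t) (hS : ∀ x ∈ S, x⁻¹ ∈ S) {i k : ℕ} {e : G} {τ c : ℝ}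
    (he : HasCost (letters S i) t τ e) (hc : 0 ≤ c) (l : List G)
    (hl : ∀ g ∈ l, HasCost (letters S k) t c (e⁻¹ * g)) :
    HasCost (letters S k) t (l.length * c * Real.exp (l.length * τ))
      ((e ^ l.length)⁻¹ * l.prod) := by
  have hτ := he.nonneg ht
  induction l with
  | nil => simpa using HasCost.one le_rfl
  | cons g l ih =>
    have h1 := ih fun g hg => hl g (by simp [hg])
    have h2 := hl g (by simp)
    have h3 : (e ^ (g :: l).length)⁻¹ * (g :: l).prod =
        ((e ^ l.length)⁻¹ * (e⁻¹ * g) * (e ^ l.length)⁻¹⁻¹) * ((e ^ l.length)⁻¹ * l.prod) := by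
      simp only [List.length_cons, List.prod_cons, pow_succ']; group
    rw [h3]
    have h4 := conj ht ((he.pow l.length).inv (letters_inv hS i)) h2
    refine (h4.mul h1).mono ?_
    have e1 : Real.exp (l.length * τ) ≤ Real.exp ((g :: l).length * τ) := by
      apply Real.exp_le_exp.mpr
      simp only [List.length_cons]; push_cast; nlinarith
    calc Real.exp (l.length * τ) * c + l.length * c * Real.exp (l.length * τ)
        = ((l.length + 1) * c) * Real.exp (l.length * τ) := by ring
      _ ≤ ((l.length + 1) * c) * Real.exp ((g :: l).length * τ) := by gcongr
      _ = _ := by simp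

end HasCost

lemma exists_list_commutator_pow_right (a b : G) (Q : ℕ) :
    ∃ l : List G, l.length = Q ∧ l.prod = ⁅a, b ^ Q⁆ ∧
      ∀ g ∈ l, ∃ q ≤ Q, g = b ^ q * ⁅a, b⁆ * (b ^ q)⁻¹ := by
  induction Q with
  | zero => exact ⟨[], by simp, by simp, by simp⟩
  | succ Q ih =>
    obtain ⟨l, h1, h2, h3⟩ := ih
    refine ⟨l ++ [b ^ Q * ⁅a, b⁆ * (b ^ Q)⁻¹], by simp [h1], ?_, ?_⟩
    · rw [List.prod_append, h2, List.prod_singleton, pow_succ]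
      simp only [commutatorElement_def]; group
    · intro g hg
      rcases List.mem_append.mp hg with hg | hg
      · obtain ⟨q, hq, rfl⟩ := h3 g hg
        exact ⟨q, by omega, rfl⟩
      · exact ⟨Q, by omega, by simpa using hg⟩

/-- Iterates ⁅a y, z⁆ = a ⁅y, z⁆ a⁻¹ ⁅a, z⁆ with y = a ^ P. The conjugators are recorded because
their costs stay bounded while P t ^ i and Q t ^ j do. -/
lemma exists_list_commutator_pow_pow (a b : G) (P Q : ℕ) :
    ∃ l : List G, l.length = P * Q ∧ l.prod = ⁅a ^ P, b ^ Q⁆ ∧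
      ∀ g ∈ l, ∃ p ≤ P, ∃ q ≤ Q, g = (a ^ p * b ^ q) * ⁅a, b⁆ * (a ^ p * b ^ q)⁻¹ := by
  induction P with
  | zero => exact ⟨[], by simp, by simp, by simp⟩
  | succ P ih =>
    obtain ⟨l, h1, h2, h3⟩ := ih
    obtain ⟨l', h1', h2', h3'⟩ := exists_list_commutator_pow_right a b Q
    refine ⟨l.map (MulAut.conj a) ++ l', by simp [h1, h1']; ring, ?_, ?_⟩
    · rw [List.prod_append, h2', ← map_list_prod, h2, MulAut.conj_apply, pow_succ']
      simp only [commutatorElement_def]; group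
    · intro g hg
      rcases List.mem_append.mp hg with hg | hg
      · obtain ⟨g', hg', rfl⟩ := List.mem_map.mp hg
        obtain ⟨p, hp, q, hq, rfl⟩ := h3 g' hg'
        refine ⟨p + 1, by omega, q, hq, ?_⟩
        rw [MulAut.conj_apply, pow_succ']; group
      · obtain ⟨q, hq, rfl⟩ := h3' g hg
        exact ⟨0, by omega, q, hq, by simp⟩

/-- Each of the P Q conjugates of ⁅a, b⁆ differs from ⁅a, b⁆ by heavier letters of cost O(t ^ (i +
j)). Since P Q t ^ (i + j) ≤ R ^ 2, the total error is O(1), uniformly in t. -/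
lemma HasCost.commutator_pow_pow (hS : ∀ x ∈ S, x⁻¹ ∈ S) {i j : ℕ} {a b : G}
    (ha : IsLetter S i a) (hb : IsLetter S j b) (R : ℝ) :
    ∃ C, 0 ≤ C ∧ ∀ t, 0 < t → t ≤ 1 → ∀ P Q : ℕ, P * t ^ i ≤ R → Q * t ^ j ≤ R →
      HasCost (letters S (i + j + 1)) t C ((⁅a, b⁆ ^ (P * Q))⁻¹ * ⁅a ^ P, b ^ Q⁆) := by
  refine ⟨R ^ 2 * (Real.exp 1 * (2 * |R| * 1 * Real.exp (2 * |R| + 1))) * Real.exp (R ^ 2),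
    by positivity, fun t ht ht1 P Q hP hQ => ?_⟩
  have hR : 0 ≤ R := le_trans (by positivity) hP
  rw [abs_of_nonneg hR]
  have hk : t ^ (i + j) ≤ 1 := pow_le_one₀ ht.le ht1
  have he : HasCost (letters S (i + j)) t (t ^ (i + j)) ⁅a, b⁆ := .letter ⟨le_rfl, ha.comm hb⟩
  obtain ⟨l, h1, h2, h3⟩ := exists_list_commutator_pow_pow a b P Q
  have hl : ∀ g ∈ l, HasCost (letters S (i + j + 1)) t
      (Real.exp 1 * (2 * R * t ^ (i + j) * Real.exp (2 * R + 1))) (⁅a, b⁆⁻¹ * g) := by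
    intro g hg
    obtain ⟨p, hp, q, hq, rfl⟩ := h3 g hg
    have ca : HasCost (letters S 1) t (p * t ^ i) (a ^ p) := (HasCost.letter ⟨ha.one_le, ha⟩).pow p
    have cb : HasCost (letters S 1) t (q * t ^ j) (b ^ q) := (HasCost.letter ⟨hb.one_le, hb⟩).pow q
    have hp' : (p : ℝ) * t ^ i ≤ R := le_trans (by gcongr) hP
    have hq' : (q : ℝ) * t ^ j ≤ R := le_trans (by gcongr) hQ
    have cab := (ca.mul cb).mono (show _ ≤ 2 * R by linarith)
    have cc := (cab.commutator ht.le he).anti (show i + j + 1 ≤ 1 + (i + j) by omega)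
    have cd := HasCost.conj ht.le (he.inv (letters_inv hS _)) cc
    -- With e = ⁅a, b⁆ and w = a ^ p b ^ q, the error e⁻¹ (w e w⁻¹) is ⁅w, e⁆ conjugated by e⁻¹.
    -- That conjugation costs a factor of at most exp 1 because t ^ (i + j) ≤ 1.
    have e1 : ⁅a, b⁆⁻¹ * ((a ^ p * b ^ q) * ⁅a, b⁆ * (a ^ p * b ^ q)⁻¹) =
      ⁅a, b⁆⁻¹ * ⁅a ^ p * b ^ q, ⁅a, b⁆⁆ * ⁅a, b⁆⁻¹⁻¹ := by
      rw [commutatorElement_def (a ^ p * b ^ q) ⁅a, b⁆]; group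
    rw [e1]
    refine cd.mono ?_
    gcongr
  have h4 := HasCost.prod_of_near ht.le hS he (by positivity) l hl
  rw [h1, h2] at h4
  refine h4.mono ?_
  have h5 : (P : ℝ) * Q * t ^ (i + j) ≤ R ^ 2 := by
    calc (P : ℝ) * Q * t ^ (i + j) = (P * t ^ i) * (Q * t ^ j) := by ring
      _ ≤ R * R := by gcongr
      _ = _ := by ring
  push_cast
  calc (P : ℝ) * Q * (Real.exp 1 * (2 * R * t ^ (i + j) * Real.exp (2 * R + 1))) *
        Real.exp (P * Q * t ^ (i + j))
      = (P * Q * t ^ (i + j)) * (Real.exp 1 * (2 * R * 1 * Real.exp (2 * R + 1))) *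
        Real.exp (P * Q * t ^ (i + j)) := by ring
    _ ≤ _ := by gcongr

end Words

/-! ### From costs to lengths in nilpotent groups -/

section Lengths

open scoped commutatorElement

variable {G : Type*} [Group G]

/-- A symmetric length function: non-negative, subadditive and invariant under inversion. -/
structure IsLength (ℓ : G → ℝ) : Prop where
  nonneg : ∀ g, 0 ≤ ℓ g
  mul_le : ∀ g h, ℓ (g * h) ≤ ℓ g + ℓ h
  inv : ∀ g, ℓ g⁻¹ = ℓ g

variable {S : Set G} {ℓ : G → ℝ}

lemma IsLength.pow_le (hℓ : IsLength ℓ) (g : G) (n : ℕ) : ℓ (g ^ n) ≤ ℓ 1 + n * ℓ g := by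
  induction n with
  | zero => simp
  | succ n ih =>
    rw [pow_succ]
    have := hℓ.mul_le (g ^ n) g
    push_cast
    linarith

/-- `g` is a product `u * w` with `u` of length `≤ C / t` and `w` of cost `≤ C` in letters of
weight at least `k`. -/
def IsShortMod (S : Set G) (ℓ : G → ℝ) (k : ℕ) (C t : ℝ) (g : G) : Prop :=
  ∃ u w, g = u * w ∧ ℓ u ≤ C / t ∧ HasCost (letters S k) t C w

/-- In (u w)(u' w') the heavy part w moves past u' by a conjugation. This is why the cost of the
second factor, and hence of u', must be bounded. -/
lemma IsShortMod.mul (hS : ∀ x ∈ S, x⁻¹ ∈ S) (hℓ : IsLength ℓ) {k : ℕ} {C C' R t : ℝ} {g h : G}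
    (ht : 0 < t) (hg : IsShortMod S ℓ k C t g) (hh : IsShortMod S ℓ k C' t h)
    (hR : HasCost (letters S 0) t R h) :
    IsShortMod S ℓ k (C + Real.exp (R + C') * C + C') t (g * h) := by
  obtain ⟨u, w, rfl, hu, hw⟩ := hg
  obtain ⟨u', w', rfl, hu', hw'⟩ := hh
  have hC := hw.nonneg ht.le
  have hC' := hw'.nonneg ht.le
  have cu' : HasCost (letters S 0) t (R + C') u' := by
    simpa using hR.mul ((hw'.anti (Nat.zero_le _)).inv (letters_inv hS 0))
  have h1 := (HasCost.conj ht.le (cu'.inv (letters_inv hS 0)) hw).mul hw'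
  refine ⟨u * u', u'⁻¹ * w * u'⁻¹⁻¹ * w', by group, ?_, h1.mono (by linarith)⟩
  calc ℓ (u * u') ≤ ℓ u + ℓ u' := hℓ.mul_le _ _
    _ ≤ C / t + C' / t := add_le_add hu hu'
    _ = (C + C') / t := by ring
    _ ≤ _ := by
      gcongr
      have := Real.exp_pos (R + C')
      nlinarith

/-- Modulo letters of weight above i + j, both entries may be replaced by their short parts u and v.
The length of ⁅u, v⁆ is at most twice the sum of theirs. -/
lemma IsShortMod.commutator (hS : ∀ x ∈ S, x⁻¹ ∈ S) (hℓ : IsLength ℓ) {i j : ℕ} {C R t : ℝ}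
    {g h : G} (ht : 0 < t)
    (hg : IsShortMod S ℓ (i + 1) C t g) (hh : IsShortMod S ℓ (j + 1) C t h)
    (hgR : HasCost (letters S i) t R g) (hhR : HasCost (letters S j) t R h) :
    ∃ u w w', ⁅g, h⁆ = w * u * w' ∧ ℓ u ≤ 4 * C / t ∧
      HasCost (letters S (i + j + 1)) t (Real.exp (R + C) * (C * R * Real.exp (C + R))) w ∧
      HasCost (letters S (i + j + 1)) t
        (Real.exp (R + C) * ((R + C) * C * Real.exp (R + C + C))) w' := by
  obtain ⟨u, w, rfl, hu, hw⟩ := hg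
  obtain ⟨v, z, rfl, hv, hz⟩ := hh
  have cu : HasCost (letters S i) t (R + C) u := by
    simpa using hgR.mul ((hw.anti (Nat.le_succ i)).inv (letters_inv hS i))
  have cv : HasCost (letters S j) t (R + C) v := by
    simpa using hhR.mul ((hz.anti (Nat.le_succ j)).inv (letters_inv hS j))
  have h1 := (HasCost.conj ht.le cu (hw.commutator ht.le hhR)).anti
    (show i + j + 1 ≤ i + 1 + j by omega)
  have h2 := (HasCost.conj ht.le cv (cu.commutator ht.le hz)).anti
    (show i + j + 1 ≤ i + (j + 1) by omega)
  refine ⟨⁅u, v⁆, _, _, ?_, ?_, h1, h2⟩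
  · simp only [commutatorElement_def]; group
  · rw [commutatorElement_def]
    have a1 := hℓ.mul_le (u * v * u⁻¹) v⁻¹
    have a2 := hℓ.mul_le (u * v) u⁻¹
    have a3 := hℓ.mul_le u v
    rw [hℓ.inv] at a1 a2
    calc _ ≤ C / t + C / t + C / t + C / t := by linarith
      _ = _ := by ring

/-- Powers of a letter of weight `i` with exponent `O(t ^ (-i))` have length `O(1 / t)`, up to
letters of higher weight. -/
lemma IsLetter.isShortMod_pow (hS : ∀ x ∈ S, x⁻¹ ∈ S) (hℓ : IsLength ℓ) {k : ℕ} {e : G}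
    (he : IsLetter S k e) (R : ℝ) :
    ∃ C, ∀ t, 0 < t → t ≤ 1 → ∀ m : ℕ, m * t ^ k ≤ R → IsShortMod S ℓ (k + 1) C t (e ^ m) := by
  induction he generalizing R with
  | @gen x hx =>
    refine ⟨ℓ 1 + |R| * ℓ x, fun t ht ht1 m hm => ⟨x ^ m, 1, by simp, ?_, .one ?_⟩⟩
    · rw [le_div_iff₀ ht]
      have := hℓ.nonneg x
      have := hℓ.nonneg 1
      calc ℓ (x ^ m) * t ≤ (ℓ 1 + m * ℓ x) * t := by gcongr; exact hℓ.pow_le x m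
        _ = ℓ 1 * t + (m * t ^ 1) * ℓ x := by ring
        _ ≤ ℓ 1 * 1 + |R| * ℓ x := by gcongr; exact hm.trans (le_abs_self R)
        _ = _ := by ring
    · have := hℓ.nonneg x
      have := hℓ.nonneg 1
      positivity
  | @comm i j a b ha hb iha ihb =>
    -- The saving: ⁅a, b⁆ ^ (P Q) is ⁅a ^ P, b ^ Q⁆ up to heavier letters, and the latter is a
    -- commutator of two elements that are short by induction.
    have key : ∀ R : ℝ, ∃ C, ∀ t, 0 < t → t ≤ 1 → ∀ P Q : ℕ, P * t ^ i ≤ R → Q * t ^ j ≤ R →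
        IsShortMod S ℓ (i + j + 1) C t (⁅a, b⁆ ^ (P * Q)) := by
      intro R
      obtain ⟨C₁, h₁⟩ := iha R
      obtain ⟨C₂, h₂⟩ := ihb R
      obtain ⟨C₃, hC₃, h₃⟩ := HasCost.commutator_pow_pow hS ha hb R
      set C := max C₁ C₂ with hC
      set K₁ := Real.exp (R + C) * (C * R * Real.exp (C + R))
      set K₂ := Real.exp (R + C) * ((R + C) * C * Real.exp (R + C + C))
      refine ⟨max (4 * C) (Real.exp (K₁ + R * R * Real.exp (R + R) + K₂) * K₁ + (K₂ + C₃)),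
        fun t ht ht1 P Q hP hQ => ?_⟩
      have up : ∀ {k : ℕ} {c : ℝ} {g : G}, c ≤ C → IsShortMod S ℓ k c t g →
          IsShortMod S ℓ k C t g := by
        rintro k c g hc ⟨u, w, h, hu, hw⟩
        exact ⟨u, w, h, hu.trans (by gcongr), hw.mono hc⟩
      have ca := up (le_max_left _ _) (h₁ t ht ht1 P hP)
      have cb := up (le_max_right _ _) (h₂ t ht ht1 Q hQ)
      have ra : HasCost (letters S i) t R (a ^ P) :=
        ((HasCost.letter ⟨le_rfl, ha⟩).pow P).mono hP
      have rb : HasCost (letters S j) t R (b ^ Q) :=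
        ((HasCost.letter ⟨le_rfl, hb⟩).pow Q).mono hQ
      obtain ⟨u, w, w', huw, hu, hw, hw'⟩ := IsShortMod.commutator hS hℓ ht ca cb ra rb
      have h4 := h₃ t ht ht1 P Q hP hQ
      have h5 := ((ra.commutator ht.le rb).anti (Nat.zero_le _))
      have h6 : HasCost (letters S 0) t (K₁ + R * R * Real.exp (R + R) + K₂) u := by
        have : u = w⁻¹ * ⁅a ^ P, b ^ Q⁆ * w'⁻¹ := by rw [huw]; group
        rw [this]
        exact (((hw.anti (Nat.zero_le _)).inv (letters_inv hS 0)).mul h5).mul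
          ((hw'.anti (Nat.zero_le _)).inv (letters_inv hS 0))
      have h7 := (HasCost.conj ht.le (h6.inv (letters_inv hS 0)) hw).mul
        (hw'.mul (h4.inv (letters_inv hS _)))
      refine ⟨u, _, ?_, hu.trans ?_, h7.mono (le_max_right _ _)⟩
      · rw [huw]; simp only [mul_inv_rev, inv_inv]; group
      · gcongr; exact le_max_left _ _
    -- Divide m by Q, the ceiling of t ^ (-j): the quotient is O(t ^ (-i)), and the remainder is
    -- treated as the product 1 · (m % Q). The 2 bounds Q t ^ j and also covers P = 1.
    obtain ⟨C, hC⟩ := key (max R 2)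
    refine ⟨C + Real.exp (2 + C) * C + C, fun t ht ht1 m hm => ?_⟩
    have htj : 0 < t ^ j := pow_pos ht j
    have htj1 : t ^ j ≤ 1 := pow_le_one₀ ht.le ht1
    have hti : 0 < t ^ i := pow_pos ht i
    have hti1 : t ^ i ≤ 1 := pow_le_one₀ ht.le ht1
    set Q := ⌈(t ^ j)⁻¹⌉₊ with hQ
    have hQ1 : (t ^ j)⁻¹ ≤ Q := Nat.le_ceil _
    have hQ1' : 1 ≤ Q * t ^ j := by
      rwa [inv_le_iff_one_le_mul₀ htj] at hQ1
    have hQ0 : 0 < Q := Nat.ceil_pos.mpr (by positivity)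
    have hQ2 : Q * t ^ j ≤ 2 := by
      have : (Q : ℝ) ≤ (t ^ j)⁻¹ + 1 := (Nat.ceil_lt_add_one (by positivity)).le
      calc Q * t ^ j ≤ ((t ^ j)⁻¹ + 1) * t ^ j := by gcongr
        _ = 1 + t ^ j := by field_simp
        _ ≤ 2 := by linarith
    have hdm : m / Q * Q + m % Q = m := Nat.div_add_mod' m Q
    have hr : m % Q < Q := Nat.mod_lt _ hQ0
    have hP : ((m / Q : ℕ) : ℝ) * t ^ i ≤ R := by
      calc ((m / Q : ℕ) : ℝ) * t ^ i ≤ ((m / Q : ℕ) : ℝ) * t ^ i * (Q * t ^ j) :=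
            le_mul_of_one_le_right (by positivity) hQ1'
        _ = ((m / Q * Q : ℕ) : ℝ) * t ^ (i + j) := by push_cast; ring
        _ ≤ m * t ^ (i + j) := by
            gcongr; exact Nat.div_mul_le_self m Q
        _ ≤ R := hm
    have hr2 : ((m % Q : ℕ) : ℝ) * t ^ j ≤ 2 := le_trans (by gcongr) hQ2
    have h1 := hC t ht ht1 (m / Q) Q (hP.trans (le_max_left _ _)) (hQ2.trans (le_max_right _ _))
    have h2 := hC t ht ht1 1 (m % Q)
      (by have := le_max_right R 2; push_cast; linarith) (hr2.trans (le_max_right _ _))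
    rw [one_mul] at h2
    have h3 : HasCost (letters S 0) t 2 (⁅a, b⁆ ^ (m % Q)) := by
      refine ((HasCost.letter ⟨Nat.zero_le _, ha.comm hb⟩).pow _).mono ?_
      calc ((m % Q : ℕ) : ℝ) * t ^ (i + j) = ((m % Q : ℕ) : ℝ) * t ^ j * t ^ i := by ring
        _ ≤ 2 * 1 := by gcongr
        _ = 2 := by norm_num
    have h4 := h1.mul hS hℓ ht h2 h3
    rwa [← pow_add, hdm] at h4

/-- Letters of weight more than `k`, or of weight `k` and in `F`. -/
def lettersWith (S : Set G) (k : ℕ) (F : Set G) : ℕ → G → Prop :=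
  fun j x => IsLetter S j x ∧ (k + 1 ≤ j ∨ (j = k ∧ x ∈ F))

/-- All copies of e are collected on the left by x e ^ m = e ^ m ⁅e ^ (-m), x⁆ x. The new
commutators have weight above k, and their cost is a bounded multiple of that of x because m t ^ k ≤
R. This removes one letter of weight k from the alphabet. -/
lemma HasCost.pull (hS : ∀ x ∈ S, x⁻¹ ∈ S) {k : ℕ} {F : Set G} {e : G} (he : IsLetter S k e)
    {t R r : ℝ} {g : G} (ht : 0 < t) (ht1 : t ≤ 1)
    (hg : HasCost (lettersWith S k (insert e F)) t r g) (hr : r ≤ R) :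
    ∃ (m : ℕ) (g' : G), g = e ^ m * g' ∧ m * t ^ k ≤ r ∧
      HasCost (lettersWith S k F) t (r * (1 + R * Real.exp (R + 1))) g' := by
  have hk := he.one_le
  induction hg with
  | one hr0 =>
    have : 0 ≤ R := hr0.trans hr
    exact ⟨0, 1, by simp, by simpa using hr0, .one (by positivity)⟩
  | @cons j x g r r' hx hg hrr ih =>
    have hj := pow_pos ht j
    have hr0 := hg.nonneg ht.le
    have hR0 : 0 ≤ R := by linarith
    obtain ⟨m, g', rfl, hm, hg'⟩ := ih (by linarith)
    by_cases hxe : j = k ∧ x = e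
    · obtain ⟨rfl, rfl⟩ := hxe
      refine ⟨m + 1, g', by rw [pow_succ']; group, by push_cast; linarith, hg'.mono ?_⟩
      gcongr; linarith
    · have hxF : lettersWith S k F j x := by
        refine ⟨hx.1, hx.2.imp_right fun ⟨h1, h2⟩ => ⟨h1, ?_⟩⟩
        exact (Set.mem_insert_iff.mp h2).resolve_left fun h => hxe ⟨h1, h⟩
      have ce : HasCost (letters S k) t (m * t ^ k) (e ^ m) := (HasCost.letter ⟨le_rfl, he⟩).pow m
      have cx : HasCost (letters S 1) t (t ^ j) x := .letter ⟨hx.1.one_le, hx.1⟩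
      have cxj : HasCost (letters S j) t (t ^ j) x := .letter ⟨le_rfl, hx.1⟩
      have cc := ((ce.inv (letters_inv hS _)).commutator ht.le cxj)
      have hj1 := hx.1.one_le
      have cc' : HasCost (lettersWith S k F) t (m * t ^ k * t ^ j * Real.exp (m * t ^ k + t ^ j))
          ⁅(e ^ m)⁻¹, x⁆ :=
        cc.mono_letters fun l y hy => ⟨hy.2, Or.inl (by have := hy.1; omega)⟩
      refine ⟨m, ⁅(e ^ m)⁻¹, x⁆ * x * g', ?_, by linarith, ?_⟩
      · rw [commutatorElement_def]; group
      · refine ((cc'.mul (.letter hxF)).mul hg').mono ?_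
        have htj1 : t ^ j ≤ 1 := pow_le_one₀ ht.le ht1
        calc m * t ^ k * t ^ j * Real.exp (m * t ^ k + t ^ j) + t ^ j
              + r * (1 + R * Real.exp (R + 1))
            ≤ R * t ^ j * Real.exp (R + 1) + t ^ j + r * (1 + R * Real.exp (R + 1)) := by
              gcongr <;> linarith
          _ = (t ^ j + r) * (1 + R * Real.exp (R + 1)) := by ring
          _ ≤ _ := by gcongr

/-- In a nilpotent group, words of cost `O(1)` have length `O(1 / t)`. -/
theorem HasCost.length_le [Group.IsNilpotent G] (hfin : S.Finite) (hS : ∀ x ∈ S, x⁻¹ ∈ S)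
    (hℓ : IsLength ℓ) (k : ℕ) (R : ℝ) :
    ∃ C, ∀ t, 0 < t → t ≤ 1 → ∀ g, HasCost (letters S k) t R g → ℓ g ≤ C / t := by
  obtain ⟨D, hD⟩ := IsLetter.exists_eq_one_of_nilpotent S
  have base : ∀ R : ℝ, ∃ C, ∀ t, 0 < t → t ≤ 1 → ∀ g, HasCost (letters S (D + 1)) t R g →
      ℓ g ≤ C / t := by
    intro R
    refine ⟨ℓ 1, fun t ht ht1 g hg => ?_⟩
    have : g = 1 := by
      clear ht ht1
      induction hg with
      | one => rfl
      | cons hx _ _ ih => rw [ih, hD _ _ hx.1 hx.2, one_mul]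
    rw [this, le_div_iff₀ ht]
    exact mul_le_of_le_one_right (hℓ.nonneg 1) ht1
  -- Descending induction on the weight. Within weight k, the finitely many letters are pulled out
  -- one at a time, and each power e ^ m is short modulo heavier letters.
  have step : ∀ k, 1 ≤ k → (∀ R : ℝ, ∃ C, ∀ t, 0 < t → t ≤ 1 → ∀ g,
        HasCost (letters S (k + 1)) t R g → ℓ g ≤ C / t) →
      ∀ R : ℝ, ∃ C, ∀ t, 0 < t → t ≤ 1 → ∀ g, HasCost (letters S k) t R g → ℓ g ≤ C / t := by
    intro k hk ih
    have hF : ∀ F : Set G, F.Finite → (∀ x ∈ F, IsLetter S k x) → ∀ R : ℝ, ∃ C, ∀ t, 0 < t →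
        t ≤ 1 → ∀ g, HasCost (lettersWith S k F) t R g → ℓ g ≤ C / t := by
      intro F hFin
      induction F, hFin using Set.Finite.induction_on with
      | empty =>
        intro _ R
        obtain ⟨C, hC⟩ := ih R
        exact ⟨C, fun t ht ht1 g hg => hC t ht ht1 g
          (hg.mono_letters fun j x hx => ⟨by simpa using hx.2, hx.1⟩)⟩
      | @insert e F _ _ ihF =>
        intro hletter R
        have he : IsLetter S k e := hletter e (by simp)
        obtain ⟨C₁, h₁⟩ := ihF (fun x hx => hletter x (by simp [hx]))
          (R * (1 + R * Real.exp (R + 1)))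
        obtain ⟨C₂, h₂⟩ := he.isShortMod_pow hS hℓ R
        obtain ⟨C₃, h₃⟩ := ih C₂
        refine ⟨C₂ + C₃ + C₁, fun t ht ht1 g hg => ?_⟩
        obtain ⟨m, g', rfl, hm, hg'⟩ := hg.pull hS he ht ht1 le_rfl
        obtain ⟨u, w, huw, hu, hw⟩ := h₂ t ht ht1 m hm
        rw [huw]
        have a1 := hℓ.mul_le (u * w) g'
        have a2 := hℓ.mul_le u w
        have a3 := h₁ t ht ht1 g' hg'
        have a4 := h₃ t ht ht1 w hw
        rw [add_div, add_div]
        linarith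
    intro R
    obtain ⟨C, hC⟩ := hF _ (IsLetter.finite hfin k) (fun x hx => hx) R
    refine ⟨C, fun t ht ht1 g hg => hC t ht ht1 g (hg.mono_letters fun j x hx => ⟨hx.2, ?_⟩)⟩
    rcases hx.1.lt_or_eq with h | rfl
    · exact Or.inl h
    · exact Or.inr ⟨rfl, hx.2⟩
  have all : ∀ n k, 1 ≤ k → D + 1 ≤ k + n → ∀ R : ℝ, ∃ C, ∀ t, 0 < t → t ≤ 1 → ∀ g,
      HasCost (letters S k) t R g → ℓ g ≤ C / t := by
    intro n
    induction n with
    | zero =>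
      intro k _ hk R
      obtain ⟨C, hC⟩ := base R
      exact ⟨C, fun t ht ht1 g hg => hC t ht ht1 g (hg.anti hk)⟩
    | succ n ih =>
      intro k hk1 hk
      exact step k hk1 (ih (k + 1) (by omega) (by omega))
  obtain ⟨C, hC⟩ := all D 1 le_rfl (by omega) R
  exact ⟨C, fun t ht ht1 g hg => hC t ht ht1 g
    (hg.mono_letters fun j x hx => ⟨hx.2.one_le, hx.2⟩)⟩

/-- In a nilpotent group, words of small cost have length at most `δ / t`. -/
theorem HasCost.length_le_of_small [Group.IsNilpotent G] (hfin : S.Finite)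
    (hS : ∀ x ∈ S, x⁻¹ ∈ S) (hℓ : IsLength ℓ) {δ : ℝ} (hδ : 0 < δ) :
    ∃ ε > 0, ∃ t₀ > 0, ∀ t, 0 < t → t ≤ t₀ → ∀ g, HasCost (letters S 0) t ε g → ℓ g ≤ δ / t := by
  obtain ⟨D, hD⟩ := IsLetter.exists_eq_one_of_nilpotent S
  obtain ⟨C, hC⟩ := HasCost.length_le (ℓ := ℓ) hfin hS hℓ 0 1
  -- Coarsen the scale from t to q t. Nontrivial letters have weight at most D, so the cost grows by
  -- at most q ^ D and stays below 1, while the length bound improves to C / (q t) ≤ δ / t.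
  set q := max 1 (C / δ) with hq
  have hq1 : 1 ≤ q := le_max_left _ _
  have hq0 : 0 < q := by linarith
  refine ⟨(q ^ D)⁻¹, by positivity, q⁻¹, by positivity, fun t ht ht0 g hg => ?_⟩
  have scale : ∀ r g, HasCost (letters S 0) t r g → HasCost (letters S 0) (q * t) (q ^ D * r) g := by
    intro r g hg
    induction hg with
    | one hr => exact .one (by positivity)
    | @cons j x g r r' hx hg hr ih =>
      have htj := pow_pos ht j
      by_cases hj : D < j
      · rw [hD j x hj hx.2, one_mul]
        refine ih.mono ?_
        gcongr; linarith
      · refine .cons hx ih ?_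
        have : q ^ j ≤ q ^ D := pow_le_pow_right₀ hq1 (by omega)
        calc (q * t) ^ j + q ^ D * r = q ^ j * t ^ j + q ^ D * r := by rw [mul_pow]
          _ ≤ q ^ D * t ^ j + q ^ D * r := by gcongr
          _ = q ^ D * (t ^ j + r) := by ring
          _ ≤ _ := by gcongr
  have h1 := scale _ _ hg
  rw [mul_inv_cancel₀ (by positivity)] at h1
  have h2 : q * t ≤ 1 := by
    calc q * t ≤ q * q⁻¹ := by gcongr
      _ = 1 := mul_inv_cancel₀ hq0.ne'
  refine (hC (q * t) (by positivity) h2 g h1).trans ?_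
  rw [div_le_div_iff₀ (by positivity) ht]
  have h3 : C ≤ δ * q := by
    have : C / δ ≤ q := le_max_right _ _
    rwa [div_le_iff₀' hδ] at this
  nlinarith

end Lengths

/-! ### Sublinear estimates for powers, conjugates and perturbed products -/

section Asymptotics

open scoped commutatorElement

variable {G : Type*} [Group G]

lemma exists_finite_symmetric_generators (G : Type*) [Group G] [Group.FG G] :
    ∃ S : Set G, S.Finite ∧ (∀ x ∈ S, x⁻¹ ∈ S) ∧ Subgroup.closure S = ⊤ := by
  obtain ⟨S, hS, hfin⟩ := Group.fg_iff.mp ‹Group.FG G›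
  refine ⟨S ∪ S⁻¹, hfin.union hfin.inv, fun x hx => ?_, ?_⟩
  · rcases hx with hx | hx
    · exact Or.inr (by simpa using hx)
    · exact Or.inl (by simpa using hx)
  · rw [eq_top_iff, ← hS]
    exact Subgroup.closure_mono Set.subset_union_left

variable {S : Set G}

lemma exists_hasCost_of_closure_eq_top (hS : ∀ x ∈ S, x⁻¹ ∈ S) (hgen : Subgroup.closure S = ⊤)
    (g : G) : ∃ N : ℝ, 0 ≤ N ∧ ∀ t, 0 ≤ t → HasCost (letters S 1) t (N * t) g := by
  have hg : g ∈ Subgroup.closure S := by rw [hgen]; trivial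
  induction hg using Subgroup.closure_induction with
  | mem x hx => exact ⟨1, zero_le_one, fun t _ => by
      simpa using HasCost.letter (A := letters S 1) (t := t) ⟨le_rfl, IsLetter.gen hx⟩⟩
  | one => exact ⟨0, le_rfl, fun t _ => .one (by simp)⟩
  | mul x y _ _ hx hy =>
    obtain ⟨N, hN, h⟩ := hx
    obtain ⟨M, hM, h'⟩ := hy
    exact ⟨N + M, by positivity, fun t ht => by rw [add_mul]; exact (h t ht).mul (h' t ht)⟩
  | inv x _ hx =>
    obtain ⟨N, hN, h⟩ := hx
    exact ⟨N, hN, fun t ht => (h t ht).inv (letters_inv hS 1)⟩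

/-- The gain over an arbitrary element is t ^ 2 in place of t. With t = 1/n, even n conjugates of
such an element together have cost O(1/n). -/
lemma exists_hasCost_of_mem_commutator (hS : ∀ x ∈ S, x⁻¹ ∈ S) (hgen : Subgroup.closure S = ⊤)
    {g : G} (hg : g ∈ commutator G) :
    ∃ M : ℝ, 0 ≤ M ∧ ∀ t, 0 ≤ t → t ≤ 1 → HasCost (letters S 2) t (M * t ^ 2) g := by
  rw [commutator_eq_closure] at hg
  induction hg using Subgroup.closure_induction with
  | mem x hx =>
    obtain ⟨a, b, rfl⟩ := hx
    obtain ⟨N, hN, h⟩ := exists_hasCost_of_closure_eq_top hS hgen a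
    obtain ⟨M, hM, h'⟩ := exists_hasCost_of_closure_eq_top hS hgen b
    refine ⟨N * M * Real.exp (N + M), by positivity, fun t ht ht1 => ?_⟩
    refine ((h t ht).commutator ht (h' t ht)).mono ?_
    calc N * t * (M * t) * Real.exp (N * t + M * t)
        ≤ N * t * (M * t) * Real.exp (N * 1 + M * 1) := by gcongr
      _ = _ := by ring_nf
  | one => exact ⟨0, le_rfl, fun t _ _ => .one (by simp)⟩
  | mul x y _ _ hx hy =>
    obtain ⟨N, hN, h⟩ := hx
    obtain ⟨M, hM, h'⟩ := hy
    exact ⟨N + M, by positivity, fun t ht ht1 => by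
      rw [add_mul]; exact (h t ht ht1).mul (h' t ht ht1)⟩
  | inv x _ hx =>
    obtain ⟨N, hN, h⟩ := hx
    exact ⟨N, hN, fun t ht ht1 => (h t ht ht1).inv (letters_inv hS 2)⟩

lemma HasCost.pow_conj {k : ℕ} {N t r : ℝ} {T g : G} (ht : 0 ≤ t) (n : ℕ)
    (hT : HasCost (letters S 1) t (N * t) T) (hg : HasCost (letters S k) t r g) :
    HasCost (letters S k) t (Real.exp (n * (N * t)) * r) (T ^ n * g * (T ^ n)⁻¹) :=
  (hT.pow n).conj ht hg

variable [Group.FG G] [Group.IsNilpotent G] {ℓ : G → ℝ}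

omit [Group.FG G] in
lemma tendsto_length_div_of_hasCost (hfin : S.Finite) (hS : ∀ x ∈ S, x⁻¹ ∈ S) (hℓ : IsLength ℓ)
    {g : ℕ → G} {c : ℕ → ℝ} (hc : Tendsto c atTop (𝓝 0))
    (hg : ∀ᶠ n : ℕ in atTop, HasCost (letters S 0) ((n : ℝ)⁻¹) (c n) (g n)) :
    Tendsto (fun n : ℕ => ℓ (g n) / n) atTop (𝓝 0) := by
  rw [Metric.tendsto_atTop']
  intro δ hδ
  obtain ⟨ε, hε, t₀, ht₀, h⟩ := HasCost.length_le_of_small hfin hS hℓ (half_pos hδ)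
  have h1 : ∀ᶠ n : ℕ in atTop, c n < ε := hc.eventually_lt_const hε
  have h2 : ∀ᶠ n : ℕ in atTop, ((n : ℝ)⁻¹) < t₀ :=
    tendsto_inv_atTop_nhds_zero_nat.eventually_lt_const ht₀
  obtain ⟨N, hN⟩ := eventually_atTop.mp (h1.and (h2.and (hg.and (eventually_gt_atTop 0))))
  refine ⟨N, fun n hn => ?_⟩
  obtain ⟨a1, a2, a3, a4⟩ := hN n hn.le
  have hn0 : (0 : ℝ) < n := by exact_mod_cast a4
  have a5 := h _ (inv_pos.mpr hn0) a2.le _ (a3.mono a1.le)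
  rw [div_inv_eq_mul] at a5
  rw [Real.dist_eq, sub_zero, abs_of_nonneg (div_nonneg (hℓ.nonneg _) hn0.le), div_lt_iff₀ hn0]
  nlinarith

/-- Conjugating a fixed element by `T ^ n` gives elements of length `o(n)`. -/
theorem tendsto_length_conj_pow_div (hℓ : IsLength ℓ) (T g : G) :
    Tendsto (fun n : ℕ => ℓ (T ^ n * g * (T ^ n)⁻¹) / n) atTop (𝓝 0) := by
  obtain ⟨S, hfin, hS, hgen⟩ := exists_finite_symmetric_generators G
  obtain ⟨N, hN, h⟩ := exists_hasCost_of_closure_eq_top hS hgen T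
  obtain ⟨M, hM, h'⟩ := exists_hasCost_of_closure_eq_top hS hgen g
  refine tendsto_length_div_of_hasCost hfin hS hℓ (c := fun n : ℕ => Real.exp N * M * (n : ℝ)⁻¹)
    ?_ ?_
  · simpa using tendsto_inv_atTop_nhds_zero_nat.const_mul (Real.exp N * M)
  · filter_upwards [eventually_gt_atTop 0] with n hn
    have hn0 : (0 : ℝ) < n := by exact_mod_cast hn
    have := ((h _ (inv_nonneg.mpr hn0.le)).pow_conj (inv_nonneg.mpr hn0.le) n
      (h' _ (inv_nonneg.mpr hn0.le))).anti (Nat.zero_le 1)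
    refine this.mono (le_of_eq ?_)
    rw [show (n : ℝ) * (N * (n : ℝ)⁻¹) = N by field_simp]
    ring

/-- If `A` and `B` agree in the abelianization then `A ^ n` and `B ^ n` differ by elements of
length `o(n)`. -/
theorem tendsto_length_pow_mul_inv_pow_div (hℓ : IsLength ℓ) {A B : G}
    (hAB : Abelianization.of A = Abelianization.of B) :
    Tendsto (fun n : ℕ => ℓ (A ^ n * (B ^ n)⁻¹) / n) atTop (𝓝 0) := by
  obtain ⟨S, hfin, hS, hgen⟩ := exists_finite_symmetric_generators G
  have hz : B⁻¹ * A ∈ commutator G := by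
    rw [← Abelianization.ker_of, MonoidHom.mem_ker]
    simp [hAB]
  obtain ⟨N, hN, h⟩ := exists_hasCost_of_closure_eq_top hS hgen B
  obtain ⟨M, hM, h'⟩ := exists_hasCost_of_mem_commutator hS hgen hz
  -- A ^ n B ^ (-n) is a product of conjugates of z = B⁻¹ A by powers of B. The auxiliary m keeps
  -- one exponential factor throughout the induction on n.
  have key : ∀ t, 0 ≤ t → t ≤ 1 → ∀ n m : ℕ, n ≤ m → HasCost (letters S 2) t
      (n * (Real.exp (m * (N * t)) * (M * t ^ 2))) (A ^ n * (B ^ n)⁻¹) := by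
    intro t ht ht1 n m hnm
    induction n with
    | zero => simpa using HasCost.one le_rfl
    | succ n ih =>
      have h1 := (h t ht).pow_conj ht (n + 1) (h' t ht ht1)
      have h2 := (ih (by omega)).mul h1
      have h3 : A ^ (n + 1) * (B ^ (n + 1))⁻¹ =
          A ^ n * (B ^ n)⁻¹ * (B ^ (n + 1) * (B⁻¹ * A) * (B ^ (n + 1))⁻¹) := by
        simp only [pow_succ]; group
      rw [h3]
      refine h2.mono ?_
      have : Real.exp ((n + 1 : ℕ) * (N * t)) ≤ Real.exp (m * (N * t)) := by
        apply Real.exp_le_exp.mpr; gcongr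
      calc _ ≤ n * (Real.exp (m * (N * t)) * (M * t ^ 2)) +
            Real.exp (m * (N * t)) * (M * t ^ 2) := by gcongr
        _ = _ := by push_cast; ring
  refine tendsto_length_div_of_hasCost hfin hS hℓ (c := fun n : ℕ => Real.exp N * M * (n : ℝ)⁻¹)
    ?_ ?_
  · simpa using tendsto_inv_atTop_nhds_zero_nat.const_mul (Real.exp N * M)
  · filter_upwards [eventually_gt_atTop 0] with n hn
    have hn0 : (0 : ℝ) < n := by exact_mod_cast hn
    have hn1 : (1 : ℝ) ≤ n := by exact_mod_cast hn
    refine ((key _ (inv_nonneg.mpr hn0.le) (inv_le_one_of_one_le₀ hn1) n n le_rfl).anti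
      (Nat.zero_le 2)).mono (le_of_eq ?_)
    rw [show (n : ℝ) * (N * (n : ℝ)⁻¹) = N by field_simp]
    field_simp

/-- The product `Tₖ ^ n * ⋯ * T₁ ^ n` for a list `[T₁, …, Tₖ]`. -/
def reversePowProd (n : ℕ) : List G → G
  | [] => 1
  | T :: l => reversePowProd n l * T ^ n

/-- `z = Tₖ ^ bₖ * ⋯ * T₁ ^ b₁` for some exponents in `[n, n + r]`. -/
def IsNearPowProd (r : ℝ) (n : ℕ) : List G → G → Prop
  | [], z => z = 1
  | T :: l, z => ∃ b : ℕ, n ≤ b ∧ (b : ℝ) ≤ n + r ∧ ∃ z', IsNearPowProd r n l z' ∧ z = z' * T ^ b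

omit [Group.FG G] [Group.IsNilpotent G] in
lemma reversePowProd_eq (n : ℕ) (l : List G) :
    reversePowProd n l = (l.map (· ^ n)).reverse.prod := by
  induction l with
  | nil => simp [reversePowProd]
  | cons T l ih => simp [reversePowProd, ih]

omit [Group.FG G] [Group.IsNilpotent G] in
lemma exists_hasCost_reversePowProd (hS : ∀ x ∈ S, x⁻¹ ∈ S) (hgen : Subgroup.closure S = ⊤)
    (l : List G) : ∃ N : ℝ, 0 ≤ N ∧ ∀ n : ℕ, 0 < n →
      HasCost (letters S 1) ((n : ℝ)⁻¹) N (reversePowProd n l) := by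
  induction l with
  | nil => exact ⟨0, le_rfl, fun n _ => .one le_rfl⟩
  | cons T l ih =>
    obtain ⟨N, hN, h⟩ := ih
    obtain ⟨M, hM, h'⟩ := exists_hasCost_of_closure_eq_top hS hgen T
    refine ⟨N + M, by positivity, fun n hn => (h n hn).mul ?_⟩
    have hn0 : (0 : ℝ) < n := by exact_mod_cast hn
    refine ((h' _ (inv_nonneg.mpr hn0.le)).pow n).mono (le_of_eq ?_)
    field_simp

-- At scale 1/n each surplus power T ^ (b - n) costs O(κ). Conjugating it by the remaining product,
-- whose cost is bounded independently of n, keeps it O(κ).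
omit [Group.FG G] [Group.IsNilpotent G] in
lemma exists_hasCost_near (hS : ∀ x ∈ S, x⁻¹ ∈ S) (hgen : Subgroup.closure S = ⊤)
    (l : List G) : ∃ K : ℝ, 0 ≤ K ∧ ∀ n : ℕ, 0 < n → ∀ κ, 0 ≤ κ → ∀ z,
      IsNearPowProd (κ * n) n l z →
      HasCost (letters S 1) ((n : ℝ)⁻¹) (K * κ) (z * (reversePowProd n l)⁻¹) := by
  induction l with
  | nil =>
    refine ⟨0, le_rfl, fun n _ κ _ z hz => ?_⟩
    rw [show z = 1 from hz]
    simpa [reversePowProd] using HasCost.one le_rfl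
  | cons T l ih =>
    obtain ⟨K, hK, h⟩ := ih
    obtain ⟨N, hN, hy⟩ := exists_hasCost_reversePowProd hS hgen l
    obtain ⟨M, hM, h'⟩ := exists_hasCost_of_closure_eq_top hS hgen T
    refine ⟨K + Real.exp N * M, by positivity, fun n hn κ hκ z hz => ?_⟩
    obtain ⟨b, hb, hb', z', hz', rfl⟩ := hz
    have hn0 : (0 : ℝ) < n := by exact_mod_cast hn
    have ht : (0 : ℝ) ≤ (n : ℝ)⁻¹ := inv_nonneg.mpr hn0.le
    have h1 : HasCost (letters S 1) ((n : ℝ)⁻¹) (M * κ) (T ^ (b - n)) := by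
      refine ((h' _ ht).pow (b - n)).mono ?_
      rw [Nat.cast_sub hb]
      have : (b : ℝ) - n ≤ κ * n := by linarith
      calc ((b : ℝ) - n) * (M * (n : ℝ)⁻¹) ≤ (κ * n) * (M * (n : ℝ)⁻¹) := by gcongr
        _ = M * κ := by field_simp
    have h2 := (h n hn κ hκ z' hz').mul ((hy n hn).conj ht h1)
    have h3 : z' * T ^ b * (reversePowProd n (T :: l))⁻¹ = z' * (reversePowProd n l)⁻¹ *
        (reversePowProd n l * T ^ (b - n) * (reversePowProd n l)⁻¹) := by
      have : T ^ b = T ^ (b - n) * T ^ n := by rw [← pow_add, Nat.sub_add_cancel hb]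
      rw [this, reversePowProd]; group
    rw [h3]
    exact h2.mono (le_of_eq (by ring))

/-- Changing the exponents of a product of powers slightly changes the product by short
elements, also after conjugation by `T ^ n`. -/
theorem exists_length_near_le (hℓ : IsLength ℓ) (l : List G) (T : G) {δ : ℝ} (hδ : 0 < δ) :
    ∃ κ > 0, ∀ᶠ n : ℕ in atTop, ∀ z, IsNearPowProd (κ * n) n l z →
      ℓ (z * (reversePowProd n l)⁻¹) ≤ δ * n ∧
      ℓ (T ^ n * (z * (reversePowProd n l)⁻¹) * (T ^ n)⁻¹) ≤ δ * n := by
  obtain ⟨S, hfin, hS, hgen⟩ := exists_finite_symmetric_generators G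
  obtain ⟨K, hK, h⟩ := exists_hasCost_near hS hgen l
  obtain ⟨N, hN, hT⟩ := exists_hasCost_of_closure_eq_top hS hgen T
  obtain ⟨ε, hε, t₀, ht₀, hε'⟩ := HasCost.length_le_of_small hfin hS hℓ hδ
  have hE := Real.exp_pos N
  set κ := ε / ((K + 1) * Real.exp N) with hκ
  have hκ0 : 0 < κ := by positivity
  have hκ1 : Real.exp N * (K * κ) ≤ ε := by
    calc Real.exp N * (K * κ) ≤ Real.exp N * ((K + 1) * κ) := by gcongr; linarith
      _ = ε := by rw [hκ]; field_simp
  have hκ2 : K * κ ≤ ε := by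
    refine le_trans (le_mul_of_one_le_left (by positivity) (Real.one_le_exp hN)) hκ1
  refine ⟨κ, hκ0, ?_⟩
  have h2 : ∀ᶠ n : ℕ in atTop, ((n : ℝ)⁻¹) < t₀ :=
    tendsto_inv_atTop_nhds_zero_nat.eventually_lt_const ht₀
  filter_upwards [h2, eventually_gt_atTop 0] with n hn1 hn z hz
  have hn0 : (0 : ℝ) < n := by exact_mod_cast hn
  have ht : (0 : ℝ) < (n : ℝ)⁻¹ := inv_pos.mpr hn0
  have c1 := h n hn κ hκ0.le z hz
  have c2 := (hT _ ht.le).pow_conj ht.le n c1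
  rw [show (n : ℝ) * (N * (n : ℝ)⁻¹) = N by field_simp] at c2
  have d1 := hε' _ ht hn1.le _ ((c1.anti (Nat.zero_le 1)).mono hκ2)
  have d2 := hε' _ ht hn1.le _ ((c2.anti (Nat.zero_le 1)).mono hκ1)
  rw [div_inv_eq_mul] at d1 d2
  exact ⟨d1, d2⟩

end Asymptotics

/-! ### Homogenization of subadditive functions on a lattice -/

section Homogenization

variable {ι : Type*} [Fintype ι]

/-- The coordinatewise floor of a real vector. -/
noncomputable def floorVec (v : ι → ℝ) : ι → ℤ := fun i => ⌊v i⌋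

/-- The inclusion of integer vectors into real vectors. -/
def castVec (a : ι → ℤ) : ι → ℝ := fun i => (a i : ℝ)

lemma norm_castVec (a : ι → ℤ) : ‖castVec a‖ = ‖a‖ := by
  simp only [castVec, Pi.norm_def]
  norm_cast

omit [Fintype ι] in
lemma castVec_sub (a b : ι → ℤ) : castVec (a - b) = castVec a - castVec b := by
  ext i; simp [castVec]

omit [Fintype ι] in
lemma castVec_add (a b : ι → ℤ) : castVec (a + b) = castVec a + castVec b := by
  ext i; simp [castVec]

lemma norm_castVec_floorVec_sub_le (v : ι → ℝ) : ‖castVec (floorVec v) - v‖ ≤ 1 := by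
  refine (pi_norm_le_iff_of_nonneg zero_le_one).mpr fun i => ?_
  simp only [castVec, floorVec, Pi.sub_apply, Real.norm_eq_abs]
  rw [abs_sub_comm, Int.self_sub_floor, abs_of_nonneg (Int.fract_nonneg _)]
  exact (Int.fract_lt_one _).le

lemma apply_sum_le_of_subadditive {E : Type*} [AddCommMonoid E] {F : E → ℝ}
    (hadd : ∀ a b, F (a + b) ≤ F a + F b) {κ : Type*} (s : Finset κ) (x : κ → E) :
    F (∑ i ∈ s, x i) ≤ F 0 + ∑ i ∈ s, F (x i) := by
  classical
  induction s using Finset.induction_on with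
  | empty => simp
  | insert i s hi ih =>
    rw [Finset.sum_insert hi, Finset.sum_insert hi]
    linarith [hadd (x i) (∑ j ∈ s, x j)]

lemma apply_nsmul_le_of_subadditive {E : Type*} [AddCommMonoid E] {F : E → ℝ}
    (hadd : ∀ a b, F (a + b) ≤ F a + F b) (n : ℕ) (x : E) : F (n • x) ≤ F 0 + n * F x := by
  simpa using apply_sum_le_of_subadditive hadd (Finset.range n) fun _ => x

/-- Subadditive functions on `ℤ ^ d` grow at most linearly. -/
lemma exists_linear_bound {F : (ι → ℤ) → ℝ} (h0 : ∀ a, 0 ≤ F a)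
    (hadd : ∀ a b, F (a + b) ≤ F a + F b) : ∃ L, 0 ≤ L ∧ ∀ a, F a ≤ L * (1 + ‖a‖) := by
  classical
  set M : ι → ℝ := fun i => F (Pi.single i 1) + F (-Pi.single i 1) with hM
  have hM0 : ∀ i, 0 ≤ M i := fun i => add_nonneg (h0 _) (h0 _)
  have hsingle : ∀ (i : ι) (n : ℤ), F (Pi.single i n) ≤ F 0 + |(n : ℝ)| * M i := by
    intro i n
    have hp := h0 (Pi.single i 1)
    have hm := h0 (-Pi.single i 1)
    rcases Int.natAbs_eq n with h | h
    · have h1 := apply_nsmul_le_of_subadditive hadd n.natAbs (Pi.single i (1 : ℤ))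
      have h2 : n.natAbs • (Pi.single i (1 : ℤ) : ι → ℤ) = Pi.single i n := by
        rw [← Pi.single_smul]; congr 1; rw [nsmul_eq_mul]; omega
      rw [h2, Nat.cast_natAbs] at h1
      push_cast at h1
      refine h1.trans ?_
      gcongr
      linarith
    · have h1 := apply_nsmul_le_of_subadditive hadd n.natAbs (-Pi.single i (1 : ℤ))
      have h2 : n.natAbs • (-Pi.single i (1 : ℤ) : ι → ℤ) = Pi.single i n := by
        rw [← Pi.single_neg, ← Pi.single_smul]; congr 1; rw [nsmul_eq_mul]; omega
      rw [h2, Nat.cast_natAbs] at h1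
      push_cast at h1
      refine h1.trans ?_
      gcongr
      linarith
  refine ⟨F 0 + ∑ i, (F 0 + M i), ?_, fun a => ?_⟩
  · exact add_nonneg (h0 _) (Finset.sum_nonneg fun i _ => add_nonneg (h0 _) (hM0 i))
  · have h1 := apply_sum_le_of_subadditive hadd Finset.univ fun i => Pi.single i (a i)
    rw [Finset.univ_sum_single] at h1
    refine h1.trans ?_
    rw [add_mul, Finset.sum_mul]
    have ha := norm_nonneg a
    have hF0 := h0 0
    refine add_le_add (by nlinarith) (Finset.sum_le_sum fun i _ => (hsingle i (a i)).trans ?_)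
    have h2 : |(a i : ℝ)| ≤ ‖a‖ := by
      have := norm_le_pi_norm a i
      rwa [Int.norm_eq_abs] at this
    have := hM0 i
    nlinarith [mul_le_mul_of_nonneg_right h2 this, mul_nonneg hF0 ha]

lemma lipschitz_of_linear_bound {F : (ι → ℤ) → ℝ} (hadd : ∀ a b, F (a + b) ≤ F a + F b) {L : ℝ}
    (hL : ∀ a, F a ≤ L * (1 + ‖a‖)) (a b : ι → ℤ) : F a ≤ F b + L * (1 + ‖a - b‖) := by
  have h1 := hadd b (a - b)
  rw [add_sub_cancel] at h1
  linarith [hL (a - b)]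

/-- The homogenization `v ↦ lim F(⌊n v⌋) / n` of a subadditive function `F` on `ℤ ^ d`. -/
noncomputable def homogenization (F : (ι → ℤ) → ℝ) (v : ι → ℝ) : ℝ :=
  limUnder atTop fun n : ℕ => F (floorVec ((n : ℝ) • v)) / n

variable {F : (ι → ℤ) → ℝ}

lemma tendsto_homogenization (h0 : ∀ a, 0 ≤ F a) (hadd : ∀ a b, F (a + b) ≤ F a + F b)
    (v : ι → ℝ) :
    Tendsto (fun n : ℕ => F (floorVec ((n : ℝ) • v)) / n) atTop (𝓝 (homogenization F v)) := by
  obtain ⟨L, hL0, hL⟩ := exists_linear_bound h0 hadd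
  refine tendsto_nhds_limUnder ?_
  -- Three roundings, each of norm at most 1, make a discrepancy of at most 3, so the Lipschitz
  -- error is L (1 + 3). Adding the constant restores exact subadditivity, and Fekete's lemma
  -- applies.
  have hsub : Subadditive fun n : ℕ => F (floorVec ((n : ℝ) • v)) + 4 * L := by
    intro m n
    have h1 := lipschitz_of_linear_bound hadd hL (floorVec (((m + n : ℕ) : ℝ) • v))
      (floorVec ((m : ℝ) • v) + floorVec ((n : ℝ) • v))
    have h2 := hadd (floorVec ((m : ℝ) • v)) (floorVec ((n : ℝ) • v))
    have h3 : ‖floorVec (((m + n : ℕ) : ℝ) • v) -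
        (floorVec ((m : ℝ) • v) + floorVec ((n : ℝ) • v))‖ ≤ 3 := by
      rw [← norm_castVec, castVec_sub, castVec_add]
      have e : castVec (floorVec (((m + n : ℕ) : ℝ) • v)) -
          (castVec (floorVec ((m : ℝ) • v)) + castVec (floorVec ((n : ℝ) • v))) =
          (castVec (floorVec (((m + n : ℕ) : ℝ) • v)) - ((m + n : ℕ) : ℝ) • v) -
          (castVec (floorVec ((m : ℝ) • v)) - (m : ℝ) • v) -
          (castVec (floorVec ((n : ℝ) • v)) - (n : ℝ) • v) := by
        push_cast; rw [add_smul]; abel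
      rw [e]
      refine (norm_sub_le _ _).trans ?_
      have := norm_sub_le (castVec (floorVec (((m + n : ℕ) : ℝ) • v)) - ((m + n : ℕ) : ℝ) • v)
        (castVec (floorVec ((m : ℝ) • v)) - (m : ℝ) • v)
      have h1 := norm_castVec_floorVec_sub_le (((m + n : ℕ) : ℝ) • v)
      have h2 := norm_castVec_floorVec_sub_le ((m : ℝ) • v)
      have h3 := norm_castVec_floorVec_sub_le ((n : ℝ) • v)
      linarith
    have h4 : L * (1 + ‖floorVec (((m + n : ℕ) : ℝ) • v) -
        (floorVec ((m : ℝ) • v) + floorVec ((n : ℝ) • v))‖) ≤ L * (1 + 3) := by gcongr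
    dsimp only
    linarith
  have hlim := hsub.tendsto_lim ⟨0, by rintro _ ⟨n, rfl⟩; have := h0 (floorVec ((n : ℝ) • v)); positivity⟩
  refine ⟨hsub.lim, ?_⟩
  have h5 := hlim.sub (tendsto_const_div_atTop_nhds_zero_nat (4 * L))
  rw [sub_zero] at h5
  refine h5.congr fun n => ?_
  rw [← sub_div]
  simp

/-- The homogenization can be computed along any integer points at bounded distance of `n v`. -/
lemma tendsto_homogenization_of_bounded (h0 : ∀ a, 0 ≤ F a)
    (hadd : ∀ a b, F (a + b) ≤ F a + F b) {v : ι → ℝ} {w : ℕ → ι → ℤ} {K : ℝ}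
    (hw : ∀ n : ℕ, ‖castVec (w n) - (n : ℝ) • v‖ ≤ K) :
    Tendsto (fun n : ℕ => F (w n) / n) atTop (𝓝 (homogenization F v)) := by
  obtain ⟨L, hL0, hL⟩ := exists_linear_bound h0 hadd
  have hd : ∀ n : ℕ, |F (w n) - F (floorVec ((n : ℝ) • v))| ≤ L * (1 + (K + 1)) := by
    intro n
    have e : ‖w n - floorVec ((n : ℝ) • v)‖ ≤ K + 1 := by
      rw [← norm_castVec, castVec_sub]
      have := norm_sub_le_norm_sub_add_norm_sub (castVec (w n)) ((n : ℝ) • v)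
        (castVec (floorVec ((n : ℝ) • v)))
      rw [norm_sub_rev ((n : ℝ) • v)] at this
      linarith [hw n, norm_castVec_floorVec_sub_le ((n : ℝ) • v)]
    have h1 := lipschitz_of_linear_bound hadd hL (w n) (floorVec ((n : ℝ) • v))
    have h2 := lipschitz_of_linear_bound hadd hL (floorVec ((n : ℝ) • v)) (w n)
    rw [norm_sub_rev] at h2
    have h3 : L * (1 + ‖w n - floorVec ((n : ℝ) • v)‖) ≤ L * (1 + (K + 1)) := by gcongr
    rw [abs_le]
    constructor <;> linarith
  have h1 : Tendsto (fun n : ℕ => (F (w n) - F (floorVec ((n : ℝ) • v))) / n) atTop (𝓝 0) := by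
    refine squeeze_zero_norm (fun n => ?_)
      (tendsto_const_div_atTop_nhds_zero_nat (L * (1 + (K + 1))))
    rw [norm_div, Real.norm_eq_abs, Real.norm_natCast]
    gcongr
    exact hd n
  have h2 := h1.add (tendsto_homogenization h0 hadd v)
  rw [zero_add] at h2
  refine h2.congr fun n => ?_
  rw [← add_div, sub_add_cancel]

lemma homogenization_nonneg (h0 : ∀ a, 0 ≤ F a) (hadd : ∀ a b, F (a + b) ≤ F a + F b)
    (v : ι → ℝ) : 0 ≤ homogenization F v :=
  ge_of_tendsto' (tendsto_homogenization h0 hadd v) fun n => div_nonneg (h0 _) (Nat.cast_nonneg n)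

lemma homogenization_add_le (h0 : ∀ a, 0 ≤ F a) (hadd : ∀ a b, F (a + b) ≤ F a + F b)
    (v w : ι → ℝ) : homogenization F (v + w) ≤ homogenization F v + homogenization F w := by
  have h1 : Tendsto (fun n : ℕ => F (floorVec ((n : ℝ) • v) + floorVec ((n : ℝ) • w)) / n) atTop
      (𝓝 (homogenization F (v + w))) := by
    refine tendsto_homogenization_of_bounded h0 hadd (K := 2) fun n => ?_
    have e : castVec (floorVec ((n : ℝ) • v) + floorVec ((n : ℝ) • w)) - (n : ℝ) • (v + w) =
        (castVec (floorVec ((n : ℝ) • v)) - (n : ℝ) • v) +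
        (castVec (floorVec ((n : ℝ) • w)) - (n : ℝ) • w) := by
      rw [castVec_add, smul_add]; abel
    rw [e]
    refine (norm_add_le _ _).trans ?_
    linarith [norm_castVec_floorVec_sub_le ((n : ℝ) • v), norm_castVec_floorVec_sub_le ((n : ℝ) • w)]
  refine le_of_tendsto_of_tendsto' h1
    ((tendsto_homogenization h0 hadd v).add (tendsto_homogenization h0 hadd w)) fun n => ?_
  rw [← add_div]
  gcongr
  exact hadd _ _

lemma homogenization_smul (h0 : ∀ a, 0 ≤ F a) (hadd : ∀ a b, F (a + b) ≤ F a + F b)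
    {t : ℝ} (ht : 0 < t) (v : ι → ℝ) : homogenization F (t • v) = t * homogenization F v := by
  set m : ℕ → ℕ := fun n => ⌊(t * n : ℝ)⌋₊ with hm
  have hm1 : Tendsto m atTop atTop :=
    tendsto_nat_floor_atTop.comp (tendsto_natCast_atTop_atTop.const_mul_atTop ht)
  have h1 : Tendsto (fun n : ℕ => F (floorVec ((m n : ℝ) • v)) / n) atTop
      (𝓝 (homogenization F (t • v))) := by
    refine tendsto_homogenization_of_bounded h0 hadd (K := 1 + ‖v‖) fun n => ?_
    refine (norm_sub_le_norm_sub_add_norm_sub _ ((m n : ℝ) • v) _).trans ?_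
    refine add_le_add (norm_castVec_floorVec_sub_le _) ?_
    rw [smul_smul, ← sub_smul, norm_smul]
    refine mul_le_of_le_one_left (norm_nonneg v) ?_
    rw [Real.norm_eq_abs, abs_le]
    have a1 := Nat.floor_le (show 0 ≤ t * (n : ℝ) by positivity)
    have a2 := Nat.lt_floor_add_one (t * (n : ℝ))
    simp only [hm]
    constructor <;> linarith
  have h2 : Tendsto (fun n : ℕ => (m n : ℝ) / n) atTop (𝓝 t) :=
    (tendsto_nat_floor_mul_div_atTop ht.le).comp tendsto_natCast_atTop_atTop
  have h3 := h2.mul ((tendsto_homogenization h0 hadd v).comp hm1)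
  refine tendsto_nhds_unique h1 (h3.congr' ?_)
  filter_upwards [hm1.eventually_gt_atTop 0] with n hn
  have : (m n : ℝ) ≠ 0 := by exact_mod_cast hn.ne'
  simp only [Function.comp]
  field_simp

lemma tendsto_homogenization_castVec (h0 : ∀ a, 0 ≤ F a) (hadd : ∀ a b, F (a + b) ≤ F a + F b)
    (a : ι → ℤ) :
    Tendsto (fun n : ℕ => F (n • a) / n) atTop (𝓝 (homogenization F (castVec a))) := by
  refine tendsto_homogenization_of_bounded h0 hadd (K := 0) fun n => le_of_eq ?_
  rw [norm_eq_zero, sub_eq_zero]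
  ext i
  simp [castVec]

lemma homogenization_castVec_le (h0 : ∀ a, 0 ≤ F a) (hadd : ∀ a b, F (a + b) ≤ F a + F b)
    (a : ι → ℤ) : homogenization F (castVec a) ≤ F a := by
  have h1 : Tendsto (fun n : ℕ => F 0 / n + F a) atTop (𝓝 (0 + F a)) :=
    (tendsto_const_div_atTop_nhds_zero_nat (F 0)).add_const _
  rw [zero_add] at h1
  refine le_of_tendsto_of_tendsto (tendsto_homogenization_castVec h0 hadd a) h1 ?_
  filter_upwards [eventually_gt_atTop 0] with n hn
  have hn0 : (0 : ℝ) < n := by exact_mod_cast hn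
  calc F (n • a) / n ≤ (F 0 + n * F a) / n := by
        gcongr; exact apply_nsmul_le_of_subadditive hadd n a
    _ = _ := by field_simp

lemma homogenization_le_add (h0 : ∀ a, 0 ≤ F a) (hadd : ∀ a b, F (a + b) ≤ F a + F b) {L : ℝ}
    (hL0 : 0 ≤ L) (hL : ∀ a, F a ≤ L * (1 + ‖a‖)) (v w : ι → ℝ) :
    homogenization F v ≤ homogenization F w + L * ‖v - w‖ := by
  have h1 : Tendsto (fun n : ℕ => F (floorVec ((n : ℝ) • w)) / n + (L * 3 / n + L * ‖v - w‖))
      atTop (𝓝 (homogenization F w + (0 + L * ‖v - w‖))) :=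
    (tendsto_homogenization h0 hadd w).add
      ((tendsto_const_div_atTop_nhds_zero_nat (L * 3)).add_const _)
  rw [zero_add] at h1
  refine le_of_tendsto_of_tendsto (tendsto_homogenization h0 hadd v) h1 ?_
  filter_upwards [eventually_gt_atTop 0] with n hn
  have hn0 : (0 : ℝ) < n := by exact_mod_cast hn
  have e : ‖floorVec ((n : ℝ) • v) - floorVec ((n : ℝ) • w)‖ ≤ 2 + n * ‖v - w‖ := by
    rw [← norm_castVec, castVec_sub]
    have e1 : castVec (floorVec ((n : ℝ) • v)) - castVec (floorVec ((n : ℝ) • w)) =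
        (castVec (floorVec ((n : ℝ) • v)) - (n : ℝ) • v) -
        (castVec (floorVec ((n : ℝ) • w)) - (n : ℝ) • w) + (n : ℝ) • (v - w) := by
      rw [smul_sub]; abel
    rw [e1]
    refine (norm_add_le _ _).trans ?_
    rw [norm_smul, Real.norm_natCast]
    have := norm_sub_le (castVec (floorVec ((n : ℝ) • v)) - (n : ℝ) • v)
      (castVec (floorVec ((n : ℝ) • w)) - (n : ℝ) • w)
    linarith [norm_castVec_floorVec_sub_le ((n : ℝ) • v),
      norm_castVec_floorVec_sub_le ((n : ℝ) • w)]
  have h2 := lipschitz_of_linear_bound hadd hL (floorVec ((n : ℝ) • v)) (floorVec ((n : ℝ) • w))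
  calc F (floorVec ((n : ℝ) • v)) / n
      ≤ (F (floorVec ((n : ℝ) • w)) + L * (1 + (2 + n * ‖v - w‖))) / n := by
        gcongr
        exact h2.trans (by gcongr)
    _ = _ := by field_simp; ring

/-- A subadditive function on `ℤ ^ d` is asymptotic to its homogenization. -/
theorem le_homogenization_add (h0 : ∀ a, 0 ≤ F a) (hadd : ∀ a b, F (a + b) ≤ F a + F b)
    {ε : ℝ} (hε : 0 < ε) :
    ∃ C, ∀ a, F a ≤ homogenization F (castVec a) + ε * ‖a‖ + C := by
  obtain ⟨L, hL0, hL⟩ := exists_linear_bound h0 hadd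
  -- Pointwise convergence is made uniform by a finite η-net of the unit ball. One η comes from
  -- convergence on the net, and one L η each from the Lipschitz bounds for F and for its
  -- homogenization.
  set η := ε / (1 + 2 * L) with hη
  have hη0 : 0 < η := by positivity
  have hηε : (1 + 2 * L) * η = ε := by rw [hη]; field_simp
  obtain ⟨s, -, hsfin, hs⟩ := (isCompact_closedBall (0 : ι → ℝ) 1).finite_cover_balls hη0
  have hN : ∀ᶠ n : ℕ in atTop, ∀ v ∈ s, F (floorVec ((n : ℝ) • v)) / n < homogenization F v + η := by
    rw [eventually_all_finite hsfin]
    intro v _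
    exact (tendsto_homogenization h0 hadd v).eventually_lt_const (by linarith)
  obtain ⟨N, hN⟩ := eventually_atTop.mp hN
  refine ⟨L * (1 + N) + ε + 2 * L, fun a => ?_⟩
  set n := ⌈‖a‖⌉₊ with hn
  have hn1 : ‖a‖ ≤ n := Nat.le_ceil _
  have hn2 : (n : ℝ) ≤ ‖a‖ + 1 := (Nat.ceil_lt_add_one (norm_nonneg a)).le
  have hφ0 := homogenization_nonneg h0 hadd (castVec a)
  by_cases hnN : N ≤ n ∧ 0 < n
  · obtain ⟨hnN, hnpos⟩ := hnN
    have hn0 : (0 : ℝ) < n := by exact_mod_cast hnpos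
    have hball : (n : ℝ)⁻¹ • castVec a ∈ Metric.closedBall (0 : ι → ℝ) 1 := by
      rw [mem_closedBall_zero_iff, norm_smul, norm_castVec, norm_inv, Real.norm_natCast,
        inv_mul_le_iff₀ hn0, mul_one]
      exact hn1
    obtain ⟨v, hv, hav⟩ : ∃ v ∈ s, (n : ℝ)⁻¹ • castVec a ∈ Metric.ball v η := by
      simpa using hs hball
    rw [mem_ball_iff_norm] at hav
    have h1 := hN n hnN v hv
    rw [div_lt_iff₀ hn0] at h1
    have h2 := lipschitz_of_linear_bound hadd hL a (floorVec ((n : ℝ) • v))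
    have h3 : ‖a - floorVec ((n : ℝ) • v)‖ ≤ n * η + 1 := by
      rw [← norm_castVec, castVec_sub]
      refine (norm_sub_le_norm_sub_add_norm_sub _ ((n : ℝ) • v) _).trans ?_
      refine add_le_add ?_ ?_
      · have : castVec a - (n : ℝ) • v = (n : ℝ) • ((n : ℝ)⁻¹ • castVec a - v) := by
          rw [smul_sub, smul_smul, mul_inv_cancel₀ hn0.ne', one_smul]
        rw [this, norm_smul, Real.norm_natCast]
        gcongr
      · rw [norm_sub_rev]; exact norm_castVec_floorVec_sub_le _
    have h4 := homogenization_le_add h0 hadd hL0 hL v ((n : ℝ)⁻¹ • castVec a)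
    rw [homogenization_smul h0 hadd (inv_pos.mpr hn0), norm_sub_rev] at h4
    have h5 : n * homogenization F v ≤ homogenization F (castVec a) + n * (L * η) := by
      calc n * homogenization F v
          ≤ n * ((n : ℝ)⁻¹ * homogenization F (castVec a) + L * η) := by
            gcongr; exact h4.trans (by gcongr)
        _ = _ := by field_simp
    have h6 : L * (1 + ‖a - floorVec ((n : ℝ) • v)‖) ≤ L * (1 + (n * η + 1)) := by gcongr
    have h7 : n * ε ≤ (‖a‖ + 1) * ε := by gcongr
    have h8 : n * ((1 + 2 * L) * η) = n * ε := by rw [hηε]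
    have h9 : 0 ≤ L * (1 + (N : ℝ)) := by positivity
    nlinarith
  · have h1 : (n : ℝ) ≤ N := by
      rw [not_and_or] at hnN
      have : n ≤ N := by omega
      exact_mod_cast this
    have h2 := hL a
    have h3 : L * (1 + ‖a‖) ≤ L * (1 + N) := by gcongr; linarith
    have h4 : 0 ≤ ε * ‖a‖ := by positivity
    linarith

lemma exists_norm_bound_of_homogeneous {ψ : (ι → ℝ) → ℝ} (h0 : ∀ v, 0 ≤ ψ v)
    (hadd : ∀ v w, ψ (v + w) ≤ ψ v + ψ w) (hsmul : ∀ (t : ℝ) v, 0 < t → ψ (t • v) = t * ψ v) :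
    ∃ K, 0 ≤ K ∧ ∀ v, ψ v ≤ K * ‖v‖ := by
  classical
  have hz : ψ 0 = 0 := by
    have := hsmul 2 0 two_pos
    rw [smul_zero] at this
    linarith
  refine ⟨∑ i, (ψ (Pi.single i 1) + ψ (-Pi.single i 1)),
    Finset.sum_nonneg fun i _ => add_nonneg (h0 _) (h0 _), fun v => ?_⟩
  have h1 := apply_sum_le_of_subadditive hadd Finset.univ fun i => Pi.single i (v i)
  rw [Finset.univ_sum_single, hz, zero_add] at h1
  refine h1.trans ?_
  rw [Finset.sum_mul]
  refine Finset.sum_le_sum fun i _ => ?_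
  have hi : |v i| ≤ ‖v‖ := norm_le_pi_norm v i
  have hp := h0 (Pi.single i 1)
  have hm := h0 (-Pi.single i 1)
  rcases lt_trichotomy (v i) 0 with h | h | h
  · have e : Pi.single i (v i) = (-v i) • (-Pi.single i (1 : ℝ) : ι → ℝ) := by
      rw [neg_smul_neg, ← Pi.single_smul, smul_eq_mul, mul_one]
    rw [e, hsmul _ _ (by linarith)]
    rw [abs_of_neg h] at hi
    nlinarith
  · rw [h, Pi.single_zero, hz]
    positivity
  · have e : Pi.single i (v i) = (v i) • (Pi.single i (1 : ℝ) : ι → ℝ) := by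
      rw [← Pi.single_smul, smul_eq_mul, mul_one]
    rw [e, hsmul _ _ h]
    rw [abs_of_pos h] at hi
    nlinarith

/-- Homogeneous subadditive functions that are asymptotic on integer points are equal. -/
theorem eq_of_homogeneous_of_asymptotic {φ ψ : (ι → ℝ) → ℝ} (h0 : ∀ v, 0 ≤ φ v)
    (hadd : ∀ v w, φ (v + w) ≤ φ v + φ w) (hsmul : ∀ (t : ℝ) v, 0 < t → φ (t • v) = t * φ v)
    (h0' : ∀ v, 0 ≤ ψ v) (hadd' : ∀ v w, ψ (v + w) ≤ ψ v + ψ w)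
    (hsmul' : ∀ (t : ℝ) v, 0 < t → ψ (t • v) = t * ψ v)
    (h : ∀ ε > 0, ∃ C, ∀ a : ι → ℤ, |φ (castVec a) - ψ (castVec a)| ≤ ε * ‖a‖ + C) : φ = ψ := by
  obtain ⟨K, hK0, hK⟩ := exists_norm_bound_of_homogeneous h0 hadd hsmul
  obtain ⟨K', hK0', hK'⟩ := exists_norm_bound_of_homogeneous h0' hadd' hsmul'
  have lip : ∀ {χ : (ι → ℝ) → ℝ} {K : ℝ}, 0 ≤ K → (∀ v w, χ (v + w) ≤ χ v + χ w) →
      (∀ v, χ v ≤ K * ‖v‖) → ∀ v, |χ (castVec (floorVec v)) - χ v| ≤ K := by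
    intro χ K hK0 hadd hK v
    have h1 := hadd v (castVec (floorVec v) - v)
    have h2 := hadd (castVec (floorVec v)) (v - castVec (floorVec v))
    rw [add_sub_cancel] at h1 h2
    have h3 := norm_castVec_floorVec_sub_le v
    have h4 := hK (castVec (floorVec v) - v)
    have h5 := hK (v - castVec (floorVec v))
    rw [norm_sub_rev] at h5
    rw [abs_le]
    constructor <;> nlinarith
  funext v
  by_contra hne
  have hpos : 0 < |φ v - ψ v| := abs_pos.mpr (sub_ne_zero.mpr hne)
  set d := |φ v - ψ v| with hd
  -- Along n v the difference of the functions grows exactly like n d, whereas this ε limits it to n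
  -- d / 2 plus a constant.
  obtain ⟨C, hC⟩ := h (d / (2 * (‖v‖ + 1))) (by positivity)
  have key : ∀ n : ℕ, 0 < n → n * d ≤ n * (d / 2) + (d + |C| + K + K') := by
    intro n hn
    have hn0 : (0 : ℝ) < n := by exact_mod_cast hn
    have e1 := hsmul n v hn0
    have e2 := hsmul' n v hn0
    have a1 := lip hK0 hadd hK ((n : ℝ) • v)
    have a2 := lip hK0' hadd' hK' ((n : ℝ) • v)
    have a3 := hC (floorVec ((n : ℝ) • v))
    have a4 : ‖floorVec ((n : ℝ) • v)‖ ≤ n * ‖v‖ + 1 := by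
      rw [← norm_castVec]
      have := norm_sub_norm_le (castVec (floorVec ((n : ℝ) • v))) ((n : ℝ) • v)
      rw [norm_smul, Real.norm_natCast] at this
      linarith [norm_castVec_floorVec_sub_le ((n : ℝ) • v)]
    have a5 : d / (2 * (‖v‖ + 1)) * ‖floorVec ((n : ℝ) • v)‖ ≤ n * (d / 2) + d := by
      calc d / (2 * (‖v‖ + 1)) * ‖floorVec ((n : ℝ) • v)‖
          ≤ d / (2 * (‖v‖ + 1)) * ((n + 1) * (‖v‖ + 1)) := by
            gcongr
            nlinarith [norm_nonneg v]
        _ = (n + 1) * (d / 2) := by field_simp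
        _ ≤ _ := by linarith
    have a6 : n * d = |φ ((n : ℝ) • v) - ψ ((n : ℝ) • v)| := by
      rw [e1, e2, ← mul_sub, abs_mul, Nat.abs_cast]
    rw [a6]
    have a7 := le_abs_self C
    rw [abs_le] at a1 a2 a3
    rw [abs_le]
    constructor <;> linarith
  obtain ⟨n, hn⟩ := exists_nat_gt ((d + |C| + K + K') / (d / 2))
  rw [div_lt_iff₀ (by positivity)] at hn
  have hn0 : 0 < n := by
    rcases Nat.eq_zero_or_pos n with rfl | h
    · have : 0 ≤ d + |C| + K + K' := by positivity
      simp at hn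
      linarith
    · exact h
  linarith [key n hn0]

end Homogenization

/-! ### The homogeneous representative on the abelianization -/

section Representative

section WordLength

variable {G : Type*} [Group G] {S : Set G}

lemma exists_list_of_closure_eq_top (hS : Subgroup.closure S = ⊤) (g : G) :
    ∃ l : List G, (∀ s ∈ l, s ∈ S ∨ s⁻¹ ∈ S) ∧ l.prod = g := by
  have hg : g ∈ (Subgroup.closure S).toSubmonoid := by rw [hS]; trivial
  rw [Subgroup.closure_toSubmonoid] at hg
  obtain ⟨l, h1, h2⟩ := Submonoid.exists_list_of_mem_closure hg
  exact ⟨l, fun s hs => by simpa using h1 s hs, h2⟩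

lemma exists_list_wordLength (hS : Subgroup.closure S = ⊤) (g : G) :
    ∃ l : List G, (∀ s ∈ l, s ∈ S ∨ s⁻¹ ∈ S) ∧ l.prod = g ∧ l.length = wordLength S g := by
  obtain ⟨l, h1, h2⟩ := exists_list_of_closure_eq_top hS g
  exact Nat.sInf_mem (s := {n | ∃ l : List G, (∀ s ∈ l, s ∈ S ∨ s⁻¹ ∈ S) ∧ l.prod = g ∧
    l.length = n}) ⟨l.length, l, h1, h2, rfl⟩

lemma wordLength_mul_le (hS : Subgroup.closure S = ⊤) (g h : G) :
    wordLength S (g * h) ≤ wordLength S g + wordLength S h := by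
  obtain ⟨l, h1, h2, h3⟩ := exists_list_wordLength hS g
  obtain ⟨l', h1', h2', h3'⟩ := exists_list_wordLength hS h
  refine Nat.sInf_le ⟨l ++ l', ?_, by simp [h2, h2'], by simp [h3, h3']⟩
  intro s hs
  rcases List.mem_append.mp hs with hs | hs
  · exact h1 s hs
  · exact h1' s hs

/-- A subadditive function is bounded by a multiple of the word length. -/
lemma exists_le_mul_wordLength (hfin : S.Finite) (hS : Subgroup.closure S = ⊤) {N : G → ℝ}
    (h1 : N 1 = 0) (hmul : ∀ g h, N (g * h) ≤ N g + N h) :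
    ∃ B, 0 ≤ B ∧ ∀ g, N g ≤ B * wordLength S g := by
  obtain ⟨B, hB⟩ := ((hfin.union hfin.inv).image N).bddAbove
  refine ⟨max B 0, le_max_right _ _, fun g => ?_⟩
  obtain ⟨l, hl, rfl, hlen⟩ := exists_list_wordLength hS g
  rw [← hlen]
  clear hlen
  induction l with
  | nil => simp [h1]
  | cons s l ih =>
    rw [List.prod_cons, List.length_cons]
    have e1 := ih fun s hs => hl s (by simp [hs])
    have e2 : N s ≤ max B 0 := by
      refine le_max_of_le_left (hB ⟨s, ?_, rfl⟩)
      simpa using hl s (by simp)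
    have := hmul s l.prod
    push_cast
    linarith

end WordLength

variable {A : Type*} [CommGroup A] {ι : Type*} [Fintype ι]

/-- Asymptotic equivalence in coordinates. -/
lemma asymptoticallyEquivalent_of_coordinates (e : Additive A ≃+ (ι → ℤ)) {f f' : A → ℝ}
    (h : ∀ ε > 0, ∃ C, ∀ a, |f a - f' a| ≤ ε * ‖e (Additive.ofMul a)‖ + C) :
    AsymptoticallyEquivalent f f' := by
  intro S hS
  obtain ⟨B, hB0, hB⟩ := exists_le_mul_wordLength S.finite_toSet hS
    (N := fun a => ‖e (Additive.ofMul a)‖) (by simp)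
    (fun a b => by rw [ofMul_mul, map_add]; exact norm_add_le _ _)
  rw [Asymptotics.isLittleO_iff]
  intro c hc
  obtain ⟨C, hC⟩ := h (c / (2 * (B + 1))) (by positivity)
  have h1 := (tendsto_comap (f := wordLength (S : Set A)) (x := atTop)).eventually_ge_atTop
    ⌈2 * C / c⌉₊
  filter_upwards [h1] with a ha
  have h2 : 2 * C / c ≤ wordLength (S : Set A) a := (Nat.le_ceil _).trans (by exact_mod_cast ha)
  rw [div_le_iff₀ hc] at h2
  rw [Real.norm_eq_abs, Real.norm_natCast]
  refine (hC a).trans ?_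
  have h3 : c / (2 * (B + 1)) * ‖e (Additive.ofMul a)‖ ≤ c / 2 * wordLength (S : Set A) a := by
    calc c / (2 * (B + 1)) * ‖e (Additive.ofMul a)‖
        ≤ c / (2 * (B + 1)) * ((B + 1) * wordLength (S : Set A) a) := by
          gcongr
          refine (hB a).trans ?_
          gcongr
          linarith
      _ = _ := by field_simp
  linarith

/-- Word length and lattice norm bound each other up to constants. The o-condition says nothing at
bounded word length; there the linear growth of both functions bounds the difference by a constant.
-/
lemma AsymptoticallyEquivalent.coordinates [hfg : Group.FG A] (e : Additive A ≃+ (ι → ℤ))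
    {f f' : A → ℝ} (h : AsymptoticallyEquivalent f f') (h0 : ∀ a, 0 ≤ f a)
    (hadd : ∀ a b, f (a * b) ≤ f a + f b) (h0' : ∀ a, 0 ≤ f' a)
    (hadd' : ∀ a b, f' (a * b) ≤ f' a + f' b) :
    ∀ ε > 0, ∃ C, ∀ a, |f a - f' a| ≤ ε * ‖e (Additive.ofMul a)‖ + C := by
  intro ε hε
  obtain ⟨S, hS⟩ := Group.fg_def.mp hfg
  have lin : ∀ {g : A → ℝ}, (∀ a, 0 ≤ g a) → (∀ a b, g (a * b) ≤ g a + g b) →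
      ∃ L, 0 ≤ L ∧ ∀ a, g a ≤ L * (1 + ‖e (Additive.ofMul a)‖) := by
    intro g h0 hadd
    obtain ⟨L, hL0, hL⟩ := exists_linear_bound (F := fun x => g (e.symm x).toMul) (fun _ => h0 _)
      (fun a b => by rw [map_add]; exact hadd _ _)
    exact ⟨L, hL0, fun a => by simpa using hL (e (Additive.ofMul a))⟩
  obtain ⟨L, hL0, hL⟩ := lin h0 hadd
  obtain ⟨L', hL0', hL'⟩ := lin h0' hadd'
  obtain ⟨W, hW0, hW⟩ := lin (g := fun a => (wordLength (S : Set A) a : ℝ))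
    (fun _ => Nat.cast_nonneg _) (fun a b => by exact_mod_cast wordLength_mul_le hS a b)
  obtain ⟨B, hB0, hB⟩ := exists_le_mul_wordLength S.finite_toSet hS
    (N := fun a => ‖e (Additive.ofMul a)‖) (by simp)
    (fun a b => by rw [ofMul_mul, map_add]; exact norm_add_le _ _)
  have h1 := (Asymptotics.isLittleO_iff.mp (h S hS)) (c := ε / (W + 1)) (by positivity)
  rw [eventually_comap, eventually_atTop] at h1
  obtain ⟨N, hN⟩ := h1
  refine ⟨ε + (L + L') * (1 + B * N), fun a => ?_⟩
  have hn := norm_nonneg (e (Additive.ofMul a))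
  by_cases hNa : N ≤ wordLength (S : Set A) a
  · have h2 := hN _ hNa a rfl
    rw [Real.norm_eq_abs, Real.norm_natCast] at h2
    refine h2.trans ?_
    have h3 : ε / (W + 1) * wordLength (S : Set A) a ≤ ε * (1 + ‖e (Additive.ofMul a)‖) := by
      calc ε / (W + 1) * wordLength (S : Set A) a
          ≤ ε / (W + 1) * ((W + 1) * (1 + ‖e (Additive.ofMul a)‖)) := by
            gcongr
            refine (hW a).trans ?_
            gcongr
            linarith
        _ = _ := by field_simp
    have : 0 ≤ (L + L') * (1 + B * N) := by positivity
    linarith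
  · have h2 : ‖e (Additive.ofMul a)‖ ≤ B * N := by
      refine (hB a).trans ?_
      gcongr
      exact_mod_cast (not_le.mp hNa).le
    have h3 : L * (1 + ‖e (Additive.ofMul a)‖) ≤ L * (1 + B * N) := by gcongr
    have h4 : L' * (1 + ‖e (Additive.ofMul a)‖) ≤ L' * (1 + B * N) := by gcongr
    have h5 : 0 ≤ ε * ‖e (Additive.ofMul a)‖ := by positivity
    have h6 := hL a
    have h7 := hL' a
    have h8 := h0 a
    have h9 := h0' a
    rw [abs_le]
    constructor <;> linarith

variable {Γ : Type*} [Group Γ] [Group.FG Γ]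

/-- A finitely generated torsion-free abelian group is free, so a ℤ-basis reduces everything to the
lattice. The last clause, a formula for φ along powers, is the link to the averages of the cocycle.
-/
theorem exists_unique_homogeneousRepresentative
    (hab : ∀ a : Abelianization Γ, IsOfFinOrder a → a = 1) {f : Abelianization Γ → ℝ}
    (h0 : ∀ a, 0 ≤ f a) (hadd : ∀ a b, f (a * b) ≤ f a + f b) :
    ∃ φ : RealAbelianization Γ → ℝ, IsHomogeneousRepresentative f φ ∧
      (∀ ψ : RealAbelianization Γ → ℝ, IsHomogeneousRepresentative f ψ → ψ = φ) ∧
      ∀ a, Tendsto (fun n : ℕ => f (a ^ n) / n) atTop (𝓝 (φ (toRealAbelianization a))) := by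
  classical
  have hfgA : Group.FG (Abelianization Γ) :=
    Group.fg_of_surjective (f := Abelianization.of) QuotientGroup.mk_surjective
  have : Module.Finite ℤ (Additive (Abelianization Γ)) :=
    Module.Finite.iff_addGroup_fg.mpr (GroupFG.iff_add_fg.mp hfgA)
  have : IsMulTorsionFree (Abelianization Γ) :=
    isMulTorsionFree_iff_not_isOfFinOrder.mpr fun a ha h => ha (hab a h)
  have : Module.Free ℤ (Additive (Abelianization Γ)) := Module.free_of_finite_type_torsion_free'
  set b := Module.Free.chooseBasis ℤ (Additive (Abelianization Γ)) with hb
  set e : Additive (Abelianization Γ) ≃+ _ := b.equivFun.toAddEquiv with he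
  set E := (b.baseChange ℝ).equivFun with hE
  have hEe : ∀ a, E (toRealAbelianization a) = castVec (e (Additive.ofMul a)) := by
    intro a
    ext i
    simp [hE, he, toRealAbelianization, castVec, Module.Basis.baseChange_repr_tmul]
  set F : (Module.Free.ChooseBasisIndex ℤ (Additive (Abelianization Γ)) → ℤ) → ℝ :=
    fun x => f (e.symm x).toMul with hF
  have hFe : ∀ a, F (e (Additive.ofMul a)) = f a := fun a => by simp [hF]
  have F0 : ∀ x, 0 ≤ F x := fun _ => h0 _
  have Fadd : ∀ x y, F (x + y) ≤ F x + F y := fun x y => by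
    simp only [hF]; rw [map_add]; exact hadd _ _
  have hrep : IsHomogeneousRepresentative f fun v => homogenization F (E v) := by
    refine ⟨fun v => homogenization_nonneg F0 Fadd _, fun v w => ?_, fun t v ht => ?_, ?_⟩
    · rw [map_add]; exact homogenization_add_le F0 Fadd _ _
    · rw [map_smul]; exact homogenization_smul F0 Fadd ht _
    · refine asymptoticallyEquivalent_of_coordinates e fun ε hε => ?_
      obtain ⟨C, hC⟩ := le_homogenization_add F0 Fadd hε
      refine ⟨|C|, fun a => ?_⟩
      have h1 := hC (e (Additive.ofMul a))
      have h2 := homogenization_castVec_le F0 Fadd (e (Additive.ofMul a))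
      rw [hFe] at h1 h2
      have h3 : 0 ≤ ε * ‖e (Additive.ofMul a)‖ := by positivity
      have h4 := le_abs_self C
      have h5 := abs_nonneg C
      simp only [hEe]
      rw [abs_le]
      constructor <;> linarith
  refine ⟨_, hrep, fun ψ hψ => ?_, fun a => ?_⟩
  · have coord : ∀ {χ : RealAbelianization Γ → ℝ}, IsHomogeneousRepresentative f χ →
        ∀ ε > 0, ∃ C, ∀ x, |F x - χ (E.symm (castVec x))| ≤ ε * ‖x‖ + C := by
      intro χ hχ ε hε
      obtain ⟨C, hC⟩ := hχ.asymptotic.coordinates e h0 hadd (fun _ => hχ.nonneg _)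
        (fun a b => by
          have : toRealAbelianization (a * b) = toRealAbelianization a + toRealAbelianization b := by
            simp only [toRealAbelianization, ofMul_mul, TensorProduct.tmul_add]
          rw [this]
          exact hχ.subadditive _ _) ε hε
      refine ⟨C, fun x => ?_⟩
      have h1 := hC (e.symm x).toMul
      rw [ofMul_toMul, AddEquiv.apply_symm_apply] at h1
      have h2 : toRealAbelianization (e.symm x).toMul = E.symm (castVec x) := by
        rw [LinearEquiv.eq_symm_apply, hEe, ofMul_toMul, AddEquiv.apply_symm_apply]
      rwa [h2] at h1
    have key : (fun x => ψ (E.symm x)) = fun x => homogenization F (E (E.symm x)) := by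
      refine eq_of_homogeneous_of_asymptotic (fun _ => hψ.nonneg _)
        (fun v w => by rw [map_add]; exact hψ.subadditive _ _)
        (fun t v ht => by rw [map_smul]; exact hψ.homogeneous _ _ ht)
        (fun _ => hrep.nonneg _)
        (fun v w => by rw [map_add]; exact hrep.subadditive _ _)
        (fun t v ht => by rw [map_smul]; exact hrep.homogeneous _ _ ht) fun ε hε => ?_
      obtain ⟨C, hC⟩ := coord hψ (ε / 2) (half_pos hε)
      obtain ⟨C', hC'⟩ := coord hrep (ε / 2) (half_pos hε)
      refine ⟨C + C', fun x => ?_⟩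
      have h1 := abs_sub_le (ψ (E.symm (castVec x))) (F x)
        (homogenization F (E (E.symm (castVec x))))
      rw [abs_sub_comm _ (F x)] at h1
      linarith [hC x, hC' x]
    funext v
    have := congrFun key (E v)
    simpa using this
  · simp only [hEe]
    refine (tendsto_homogenization_castVec F0 Fadd (e (Additive.ofMul a))).congr fun n => ?_
    rw [← map_nsmul, ← ofMul_pow, hFe]

end Representative

/-! ### The mean ergodic theorem and ergodicity of the action -/

section MeanErgodic

variable {X : Type*} [MeasurableSpace X] {m : Measure X}

/-- A Cauchy sequence in `L¹`, expressed through integrals. -/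
def IsCauchyL1 (m : Measure X) (u : ℕ → X → ℝ) : Prop :=
  ∀ ε > 0, ∃ N, ∀ n ≥ N, ∀ k ≥ N, ∫ x, |u n x - u k x| ∂m ≤ ε

lemma norm_toL1_eq_integral_abs {f : X → ℝ} (hf : Integrable f m) :
    ‖hf.toL1 f‖ = ∫ x, |f x| ∂m := by
  rw [L1.norm_eq_integral_norm]
  refine integral_congr_ae ?_
  filter_upwards [hf.coeFn_toL1] with x hx
  rw [hx, Real.norm_eq_abs]

lemma IsCauchyL1.exists_limit {u : ℕ → X → ℝ} (hu : ∀ n, Integrable (u n) m)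
    (h : IsCauchyL1 m u) :
    ∃ G : X → ℝ, Integrable G m ∧ Tendsto (fun n => ∫ x, |u n x - G x| ∂m) atTop (𝓝 0) := by
  have hc : CauchySeq fun n => (hu n).toL1 (u n) := by
    rw [Metric.cauchySeq_iff]
    intro ε hε
    obtain ⟨N, hN⟩ := h (ε / 2) (half_pos hε)
    refine ⟨N, fun n hn k hk => ?_⟩
    rw [dist_eq_norm, ← Integrable.toL1_sub, norm_toL1_eq_integral_abs]
    exact (hN n hn k hk).trans_lt (half_lt_self hε)
  obtain ⟨G, hG⟩ := cauchySeq_tendsto_of_complete hc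
  refine ⟨G, L1.integrable_coeFn G, ?_⟩
  rw [tendsto_iff_norm_sub_tendsto_zero] at hG
  refine hG.congr fun n => ?_
  rw [L1.norm_eq_integral_norm]
  refine integral_congr_ae ?_
  filter_upwards [(hu n).coeFn_toL1, Lp.coeFn_sub ((hu n).toL1 (u n)) G] with x h1 h2
  rw [h2, Pi.sub_apply, h1, Real.norm_eq_abs]

/-- The average of `g` along the first `n` points of an orbit of `R`. -/
noncomputable def orbitAverage (R : X → X) (g : X → ℝ) (n : ℕ) (x : X) : ℝ :=
  (∑ i ∈ Finset.range n, g (R^[i] x)) / n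

lemma MeasureTheory.MeasurePreserving.integrable_comp_iterate {R : X → X}
    (hR : MeasurePreserving R m m) {g : X → ℝ} (hg : Integrable g m) (i : ℕ) :
    Integrable (fun x => g (R^[i] x)) m :=
  (hR.iterate i).integrable_comp_of_integrable hg

lemma MeasureTheory.MeasurePreserving.integral_comp_ae {R : X → X}
    (hR : MeasurePreserving R m m) {g : X → ℝ} (hg : AEStronglyMeasurable g m) :
    ∫ x, g (R x) ∂m = ∫ x, g x ∂m := by
  have h := integral_map (μ := m) hR.measurable.aemeasurable (f := g) (by rwa [hR.map_eq])
  rw [hR.map_eq] at h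
  exact h.symm

lemma integrable_orbitAverage {R : X → X} (hR : MeasurePreserving R m m) {g : X → ℝ}
    (hg : Integrable g m) (n : ℕ) : Integrable (orbitAverage R g n) m :=
  (integrable_finsetSum _ fun i _ => hR.integrable_comp_iterate hg i).div_const _

lemma integral_orbitAverage {R : X → X} (hR : MeasurePreserving R m m) {g : X → ℝ}
    (hg : Integrable g m) {n : ℕ} (hn : n ≠ 0) :
    ∫ x, orbitAverage R g n x ∂m = ∫ x, g x ∂m := by
  simp only [orbitAverage]
  rw [integral_div, integral_finsetSum _ fun i _ => hR.integrable_comp_iterate hg i]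
  simp_rw [(hR.iterate _).integral_comp_ae hg.aestronglyMeasurable]
  simp
  field_simp

lemma integral_abs_orbitAverage_le {R : X → X} (hR : MeasurePreserving R m m) {g : X → ℝ}
    (hg : Integrable g m) (n : ℕ) :
    ∫ x, |orbitAverage R g n x| ∂m ≤ ∫ x, |g x| ∂m := by
  rcases Nat.eq_zero_or_pos n with rfl | hn
  · simp only [orbitAverage, Finset.range_zero, Finset.sum_empty, zero_div, abs_zero,
      integral_zero]
    exact integral_nonneg fun x => abs_nonneg _
  · have h1 := integral_orbitAverage hR hg.abs hn.ne'
    rw [← h1]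
    refine integral_mono (integrable_orbitAverage hR hg n).abs
      (integrable_orbitAverage hR hg.abs n) fun x => ?_
    simp only [orbitAverage]
    rw [abs_div, Nat.abs_cast]
    gcongr
    exact Finset.abs_sum_le_sum_abs _ _

omit [MeasurableSpace X] in
lemma orbitAverage_sub (R : X → X) (g h : X → ℝ) (n : ℕ) (x : X) :
    orbitAverage R (fun x => g x - h x) n x = orbitAverage R g n x - orbitAverage R h n x := by
  simp only [orbitAverage, Finset.sum_sub_distrib, sub_div]

variable [IsProbabilityMeasure m]

/-- Von Neumann's theorem for the Koopman isometry of L²; on a probability space the L¹ norm is at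
most the L² norm. The limit need not be identified. -/
lemma isCauchyL1_orbitAverage_of_memLp_two {R : X → X} (hR : MeasurePreserving R m m) {g : X → ℝ}
    (hg : MemLp g 2 m) : IsCauchyL1 m (orbitAverage R g) := by
  set V : Lp ℝ 2 m →ₗᵢ[ℝ] Lp ℝ 2 m := Lp.compMeasurePreservingₗᵢ ℝ R hR with hV
  set G := hg.toLp g with hG
  have hlim := ContinuousLinearMap.tendsto_birkhoffAverage_orthogonalProjection
    V.toContinuousLinearMap V.norm_toContinuousLinearMap_le G
  set B : ℕ → Lp ℝ 2 m := fun n => birkhoffAverage ℝ V.toContinuousLinearMap _root_.id n G with hB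
  have hc : CauchySeq B := hlim.cauchySeq
  have hiter : ∀ i : ℕ, ((V.toContinuousLinearMap)^[i] G : X → ℝ) =ᵐ[m] fun x => g (R^[i] x) := by
    intro i
    induction i with
    | zero => exact hg.coeFn_toLp
    | succ i ih =>
      rw [Function.iterate_succ_apply']
      have h1 : (V.toContinuousLinearMap ((V.toContinuousLinearMap)^[i] G) : X → ℝ) =ᵐ[m]
          ((V.toContinuousLinearMap)^[i] G : X → ℝ) ∘ R :=
        Lp.coeFn_compMeasurePreserving _ hR
      refine h1.trans ?_
      have h2 := hR.quasiMeasurePreserving.ae_eq_comp ih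
      refine h2.trans (Eventually.of_forall fun x => ?_)
      simp [Function.comp, Function.iterate_succ_apply]
  have hav : ∀ n, (B n : X → ℝ) =ᵐ[m]
      orbitAverage R g n := by
    intro n
    have hsum : ((∑ i ∈ Finset.range n, (V.toContinuousLinearMap)^[i] G : Lp ℝ 2 m) : X → ℝ)
        =ᵐ[m] fun x => ∑ i ∈ Finset.range n, g (R^[i] x) := by
      induction n with
      | zero =>
        filter_upwards [Lp.coeFn_zero ℝ 2 m] with x hx
        simp
      | succ n ih =>
        rw [Finset.sum_range_succ]
        filter_upwards [Lp.coeFn_add (∑ i ∈ Finset.range n, (V.toContinuousLinearMap)^[i] G)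
          ((V.toContinuousLinearMap)^[n] G), ih, hiter n] with x h1 h2 h3
        rw [h1, Pi.add_apply, h2, h3, Finset.sum_range_succ]
    have he : B n =
        (n : ℝ)⁻¹ • ∑ i ∈ Finset.range n, (V.toContinuousLinearMap)^[i] G := rfl
    rw [he]
    filter_upwards [Lp.coeFn_smul ((n : ℝ)⁻¹)
      (∑ i ∈ Finset.range n, (V.toContinuousLinearMap)^[i] G), hsum] with x h1 h2
    rw [h1, Pi.smul_apply, h2, smul_eq_mul, orbitAverage, inv_mul_eq_div]
  have hnorm : ∀ φ : Lp ℝ 2 m, ∫ x, |φ x| ∂m ≤ ‖φ‖ := by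
    intro φ
    have h1 : ENNReal.ofReal (∫ x, |φ x| ∂m) ≤ eLpNorm φ 2 m := by
      have hi : Integrable φ m := (Lp.memLp φ).integrable (by norm_num)
      have := ofReal_integral_norm_eq_lintegral_enorm hi
      simp only [Real.norm_eq_abs] at this
      rw [this, ← eLpNorm_one_eq_lintegral_enorm]
      exact eLpNorm_le_eLpNorm_of_exponent_le (by norm_num) (Lp.aestronglyMeasurable φ)
    rw [Lp.norm_def]
    exact (ENNReal.ofReal_le_iff_le_toReal (Lp.eLpNorm_ne_top φ)).mp h1
  intro ε hε
  obtain ⟨N, hN⟩ := Metric.cauchySeq_iff.mp hc ε hε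
  refine ⟨N, fun n hn k hk => ?_⟩
  have h1 := hN n hn k hk
  rw [dist_eq_norm] at h1
  refine le_trans (le_of_eq ?_) ((hnorm _).trans h1.le)
  refine integral_congr_ae ?_
  filter_upwards [hav n, hav k, Lp.coeFn_sub (B n) (B k)] with x a b c
  rw [c, Pi.sub_apply, a, b]

/-- Mean ergodic theorem in `L¹`. -/
theorem isCauchyL1_orbitAverage {R : X → X} (hR : MeasurePreserving R m m) {g : X → ℝ}
    (hg : Integrable g m) : IsCauchyL1 m (orbitAverage R g) := by
  intro ε hε
  -- Simple functions lie in L² and are dense in L¹; orbit averages are L¹ contractions, so the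
  -- approximation error does not grow with n.
  obtain ⟨s, hs, hsm⟩ := (memLp_one_iff_integrable.mpr hg).exists_simpleFunc_eLpNorm_sub_lt
    ENNReal.one_ne_top (ε := ENNReal.ofReal (ε / 3)) (by simpa using hε)
  have hsi : Integrable s m := memLp_one_iff_integrable.mp hsm
  have hd : ∫ x, |g x - s x| ∂m ≤ ε / 3 := by
    have h1 := ofReal_integral_norm_eq_lintegral_enorm (hg.sub hsi)
    rw [← eLpNorm_one_eq_lintegral_enorm] at h1
    rw [← h1] at hs
    exact ((ENNReal.ofReal_lt_ofReal_iff (by positivity)).mp hs).le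
  obtain ⟨N, hN⟩ := isCauchyL1_orbitAverage_of_memLp_two hR (g := s)
    (SimpleFunc.memLp_of_isFiniteMeasure s 2 m) (ε / 3) (by positivity)
  refine ⟨N, fun n hn k hk => ?_⟩
  have hgs : Integrable (fun x => g x - s x) m := hg.sub hsi
  have i1 := (integrable_orbitAverage hR hgs n).abs
  have i2 := (integrable_orbitAverage hR hgs k).abs
  have i3 : Integrable (fun x => |orbitAverage R s n x - orbitAverage R s k x|) m :=
    ((integrable_orbitAverage hR hsi n).sub (integrable_orbitAverage hR hsi k)).abs
  have h1 := (integral_abs_orbitAverage_le hR hgs n).trans hd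
  have h2 := (integral_abs_orbitAverage_le hR hgs k).trans hd
  have h3 := hN n hn k hk
  calc ∫ x, |orbitAverage R g n x - orbitAverage R g k x| ∂m
      ≤ ∫ x, (|orbitAverage R (fun x => g x - s x) n x| +
          |orbitAverage R (fun x => g x - s x) k x| +
          |orbitAverage R s n x - orbitAverage R s k x|) ∂m := by
        refine integral_mono_of_nonneg (Eventually.of_forall fun x => abs_nonneg _)
          ((i1.add i2).add i3) (Eventually.of_forall fun x => ?_)
        simp only [orbitAverage_sub]
        have e : orbitAverage R g n x - orbitAverage R g k x =
          (orbitAverage R g n x - orbitAverage R s n x) -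
          (orbitAverage R g k x - orbitAverage R s k x) +
          (orbitAverage R s n x - orbitAverage R s k x) := by ring
        rw [e]
        exact (abs_add_le _ _).trans (by gcongr; exact abs_sub _ _)
    _ = (∫ x, |orbitAverage R (fun x => g x - s x) n x| ∂m) +
          (∫ x, |orbitAverage R (fun x => g x - s x) k x| ∂m) +
          ∫ x, |orbitAverage R s n x - orbitAverage R s k x| ∂m := by
        have e1 := integral_add (i1.add i2) i3
        have e2 := integral_add i1 i2
        simp only [Pi.add_apply] at e1
        rw [e1, e2]
    _ ≤ ε := by linarith

omit [IsProbabilityMeasure m] in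
/-- A measurable function that is invariant under an ergodic action is constant. -/
lemma ErgodicSMul.ae_eq_const_of_forall_smul {Γ : Type*} [Group Γ] [MulAction Γ X]
    [ErgodicSMul Γ X m] {G : X → ℝ} (hG : AEMeasurable G m)
    (h : ∀ γ : Γ, ∀ᵐ x ∂m, G (γ • x) = G x) : ∃ a, ∀ᵐ x ∂m, G x = a := by
  refine Filter.exists_eventuallyEq_const_of_forall_separating MeasurableSet fun U hU => ?_
  have h1 := MeasureTheory.aeconst_of_forall_preimage_smul_ae_eq Γ (μ := m) (s := G ⁻¹' U)
    (hG.nullMeasurableSet_preimage hU) fun γ => by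
      filter_upwards [h γ] with x hx
      exact propext (by change G (γ • x) ∈ U ↔ G x ∈ U; rw [hx])
  rcases eventuallyConst_set.mp h1 with h1 | h1
  · exact Or.inl h1
  · exact Or.inr h1

end MeanErgodic

/-! ### Stable averages and the abelianization -/

section CocycleAverages

variable {Γ : Type*} [Group Γ] {F : Γ → ℝ}

lemma abelianizationInf_bddBelow (h0 : ∀ γ, 0 ≤ F γ) (a : Abelianization Γ) :
    BddBelow {r | ∃ γ : Γ, Abelianization.of γ = a ∧ F γ = r} :=
  ⟨0, by rintro _ ⟨γ, -, rfl⟩; exact h0 γ⟩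

lemma abelianizationInf_nonempty (F : Γ → ℝ) (a : Abelianization Γ) :
    {r | ∃ γ : Γ, Abelianization.of γ = a ∧ F γ = r}.Nonempty := by
  obtain ⟨γ, hγ⟩ : ∃ γ, Abelianization.of γ = a := QuotientGroup.mk_surjective a
  exact ⟨F γ, γ, hγ, rfl⟩

lemma abelianizationInf_nonneg (h0 : ∀ γ, 0 ≤ F γ) (a : Abelianization Γ) :
    0 ≤ abelianizationInf F a :=
  Real.sInf_nonneg (by rintro _ ⟨γ, -, rfl⟩; exact h0 γ)

lemma abelianizationInf_of_le (h0 : ∀ γ, 0 ≤ F γ) (γ : Γ) :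
    abelianizationInf F (Abelianization.of γ) ≤ F γ :=
  csInf_le (abelianizationInf_bddBelow h0 _) ⟨γ, rfl, rfl⟩

lemma le_abelianizationInf {r : ℝ} {a : Abelianization Γ}
    (h : ∀ γ, Abelianization.of γ = a → r ≤ F γ) : r ≤ abelianizationInf F a :=
  le_csInf (abelianizationInf_nonempty F a) (by rintro _ ⟨γ, hγ, rfl⟩; exact h γ hγ)

lemma abelianizationInf_mul_le (h0 : ∀ γ, 0 ≤ F γ) (hmul : ∀ γ γ', F (γ * γ') ≤ F γ + F γ')
    (a b : Abelianization Γ) :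
    abelianizationInf F (a * b) ≤ abelianizationInf F a + abelianizationInf F b := by
  rw [← sub_le_iff_le_add]
  refine le_abelianizationInf fun γ hγ => ?_
  rw [sub_le_comm]
  refine le_abelianizationInf fun γ' hγ' => ?_
  rw [sub_le_iff_le_add', ← hγ, ← hγ', ← map_mul]
  exact (abelianizationInf_of_le h0 _).trans (hmul _ _)

/-- The symmetrization of a subadditive function is a length. -/
lemma isLength_symmetrization (h0 : ∀ γ, 0 ≤ F γ) (hmul : ∀ γ γ', F (γ * γ') ≤ F γ + F γ') :
    IsLength fun γ => F γ + F γ⁻¹ where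
  nonneg γ := add_nonneg (h0 _) (h0 _)
  mul_le γ γ' := by rw [mul_inv_rev]; linarith [hmul γ γ', hmul γ'⁻¹ γ⁻¹]
  inv γ := by rw [inv_inv, add_comm]

lemma subadditive_pow (hmul : ∀ γ γ', F (γ * γ') ≤ F γ + F γ') (T : Γ) :
    Subadditive fun n => F (T ^ n) := fun p n => by
  dsimp only; rw [pow_add]; exact hmul _ _

lemma bddBelow_pow_div (h0 : ∀ γ, 0 ≤ F γ) (T : Γ) :
    BddBelow (Set.range fun n : ℕ => F (T ^ n) / n) :=
  ⟨0, by rintro _ ⟨n, rfl⟩; exact div_nonneg (h0 _) (Nat.cast_nonneg _)⟩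

variable [Group.FG Γ] [Group.IsNilpotent Γ]

/-- The stable length in a nilpotent group factors through the abelianization. -/
lemma lim_pow_div_le_of_abelianization_eq (h0 : ∀ γ, 0 ≤ F γ)
    (hmul : ∀ γ γ', F (γ * γ') ≤ F γ + F γ') {A B : Γ}
    (hAB : Abelianization.of A = Abelianization.of B) :
    (subadditive_pow hmul A).lim ≤ (subadditive_pow hmul B).lim := by
  have hA := (subadditive_pow hmul A).tendsto_lim (bddBelow_pow_div h0 A)
  have hB := (subadditive_pow hmul B).tendsto_lim (bddBelow_pow_div h0 B)
  have h1 := (tendsto_length_pow_mul_inv_pow_div (isLength_symmetrization h0 hmul) hAB).add hB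
  rw [zero_add] at h1
  refine le_of_tendsto_of_tendsto' hA h1 fun n => ?_
  rw [← add_div]
  gcongr
  have h2 := hmul (A ^ n * (B ^ n)⁻¹) (B ^ n)
  rw [inv_mul_cancel_right] at h2
  linarith [h0 (A ^ n * (B ^ n)⁻¹)⁻¹]

/-- The stable length of `T` is the value at `T` of the homogenization of the fiberwise
infimum. -/
theorem tendsto_pow_div_of_abelianizationInf (h0 : ∀ γ, 0 ≤ F γ)
    (hmul : ∀ γ γ', F (γ * γ') ≤ F γ + F γ') {T : Γ} {r : ℝ}
    (hr : Tendsto (fun n : ℕ => abelianizationInf F (Abelianization.of T ^ n) / n) atTop (𝓝 r)) :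
    Tendsto (fun n : ℕ => F (T ^ n) / n) atTop (𝓝 r) := by
  have hT := (subadditive_pow hmul T).tendsto_lim (bddBelow_pow_div h0 T)
  have hle : r ≤ (subadditive_pow hmul T).lim := by
    refine le_of_tendsto_of_tendsto' hr hT fun n => ?_
    gcongr
    rw [← map_pow]
    exact abelianizationInf_of_le h0 _
  -- If γ lies over the class of T ^ K, then γ and T ^ K have the same stable value, which is K
  -- times that of T and at most F γ. Take the infimum over γ, divide by K and let K grow.
  have hge : (subadditive_pow hmul T).lim ≤ r := by
    refine ge_of_tendsto hr ?_
    filter_upwards [eventually_gt_atTop 0] with K hK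
    have hK0 : (0 : ℝ) < K := by exact_mod_cast hK
    rw [le_div_iff₀ hK0]
    refine le_abelianizationInf fun γ hγ => ?_
    have h1 : (subadditive_pow hmul (T ^ K)).lim = (subadditive_pow hmul T).lim * K := by
      refine tendsto_nhds_unique
        ((subadditive_pow hmul (T ^ K)).tendsto_lim (bddBelow_pow_div h0 (T ^ K))) ?_
      have h2 : Tendsto (fun n : ℕ => K * n) atTop atTop :=
        tendsto_id.const_mul_atTop' hK
      refine ((hT.comp h2).mul_const (K : ℝ)).congr' ?_
      filter_upwards [eventually_gt_atTop 0] with n hn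
      simp only [Function.comp, pow_mul]
      push_cast
      field_simp
    rw [← h1]
    refine (lim_pow_div_le_of_abelianization_eq h0 hmul (B := γ) (by rw [map_pow, hγ])).trans ?_
    simpa using (subadditive_pow hmul γ).lim_le_div (bddBelow_pow_div h0 γ) one_ne_zero
  rwa [le_antisymm hge hle] at hT

end CocycleAverages

/-! ### Mean convergence along powers of one element -/

section CocycleL1

variable {Γ X : Type*} [Group Γ] [MeasurableSpace X] {m : Measure X} [IsProbabilityMeasure m]
  [MulAction Γ X] [MeasurableConstSMul Γ X] [ErgodicSMul Γ X m] {c : Γ → X → ℝ}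

omit [IsProbabilityMeasure m] in
lemma integrable_cocycle_smul (hL1 : ∀ γ, Integrable (c γ) m) (γ γ' : Γ) :
    Integrable (fun x => c γ (γ' • x)) m :=
  (measurePreserving_smul γ' m).integrable_comp_of_integrable (hL1 γ)

omit [IsProbabilityMeasure m] in
lemma integral_cocycle_smul (hL1 : ∀ γ, Integrable (c γ) m) (γ γ' : Γ) :
    ∫ x, c γ (γ' • x) ∂m = cocycleAverage m c γ :=
  (measurePreserving_smul γ' m).integral_comp_ae (hL1 γ).aestronglyMeasurable

omit [IsProbabilityMeasure m] [MeasurableConstSMul Γ X] [ErgodicSMul Γ X m] in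
lemma cocycleAverage_nonneg (hc : IsSubadditiveCocycle m c) (γ : Γ) : 0 ≤ cocycleAverage m c γ :=
  integral_nonneg (hc.nonneg γ)

omit [IsProbabilityMeasure m] in
lemma cocycleAverage_mul_le (hc : IsSubadditiveCocycle m c) (hL1 : ∀ γ, Integrable (c γ) m)
    (γ γ' : Γ) : cocycleAverage m c (γ * γ') ≤ cocycleAverage m c γ + cocycleAverage m c γ' := by
  have h := integral_mono_ae (hL1 (γ * γ'))
    ((integrable_cocycle_smul hL1 γ γ').add (hL1 γ')) (hc.subadditive γ γ')
  simp only [Pi.add_apply] at h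
  rwa [integral_add (integrable_cocycle_smul hL1 γ γ') (hL1 γ'), integral_cocycle_smul hL1] at h

omit [IsProbabilityMeasure m] [MeasurableConstSMul Γ X] [ErgodicSMul Γ X m] in
/-- Almost every point satisfies the cocycle inequality along an entire orbit of `T`. -/
lemma IsSubadditiveCocycle.pow_mul_add_le (hc : IsSubadditiveCocycle m c) (T : Γ) (K q r : ℕ) :
    ∀ᵐ x ∂m, c (T ^ (q * K + r)) x ≤ c 1 x + c (T ^ r) (T ^ (q * K) • x) +
      ∑ i ∈ Finset.range q, c (T ^ K) ((T ^ K • ·)^[i] x) := by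
  have hiter : ∀ (i : ℕ) (x : X), (T ^ K • ·)^[i] x = T ^ (i * K) • x := by
    intro i x
    induction i generalizing x with
    | zero => simp
    | succ i ih => rw [Function.iterate_succ_apply, ih, smul_smul, ← pow_add]; congr 2; ring
  have h1 : ∀ q : ℕ, ∀ᵐ x ∂m, c (T ^ (q * K)) x ≤
      c 1 x + ∑ i ∈ Finset.range q, c (T ^ K) ((T ^ K • ·)^[i] x) := by
    intro q
    induction q with
    | zero => simp
    | succ q ih =>
      filter_upwards [ih, hc.subadditive (T ^ K) (T ^ (q * K))] with x h1 h2
      rw [Finset.sum_range_succ, hiter q x]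
      rw [← pow_add, show K + q * K = (q + 1) * K by ring] at h2
      linarith
  filter_upwards [h1 q, hc.subadditive (T ^ r) (T ^ (q * K))] with x h1 h2
  rw [← pow_add, add_comm r] at h2
  linarith

omit [IsProbabilityMeasure m] in
/-- The normalized cocycle along `T ^ n` is close to the orbit averages of `c (T ^ K) / K`. -/
lemma integral_abs_sub_orbitAverage_le (hc : IsSubadditiveCocycle m c)
    (hL1 : ∀ γ, Integrable (c γ) m) (T : Γ) {K n : ℕ} (hK : 0 < K) (hn : K ≤ n) :
    ∫ x, |c (T ^ n) x / n -
        orbitAverage (T ^ K • ·) (fun x => c (T ^ K) x / K) (n / K) x| ∂m ≤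
      2 * ((cocycleAverage m c 1 + ∑ r ∈ Finset.range K, cocycleAverage m c (T ^ r)) / n) +
      (cocycleAverage m c (T ^ K) / K - cocycleAverage m c (T ^ n) / n) := by
  set q := n / K with hq
  set r := n % K with hr
  have hn0 : (0 : ℝ) < n := by exact_mod_cast hK.trans_le hn
  have hK0 : (0 : ℝ) < K := by exact_mod_cast hK
  have hq0 : 0 < q := Nat.div_pos hn hK
  have hq0' : (0 : ℝ) < q := by exact_mod_cast hq0
  have hqr : q * K + r = n := Nat.div_add_mod' n K
  have hRK : MeasurePreserving (T ^ K • · : X → X) m m := measurePreserving_smul (T ^ K) m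
  have ig : Integrable (fun x => c (T ^ K) x / K) m := (hL1 _).div_const _
  set A := orbitAverage (T ^ K • ·) (fun x => c (T ^ K) x / K) q with hA
  have iA : Integrable A m := integrable_orbitAverage hRK ig q
  have iu : Integrable (fun x => c (T ^ n) x / n) m := (hL1 _).div_const _
  set E : X → ℝ := fun x => (c 1 x + c (T ^ r) (T ^ (q * K) • x)) / n with hE
  have iE : Integrable E m := ((hL1 1).add (integrable_cocycle_smul hL1 _ _)).div_const _
  have hAint : ∫ x, A x ∂m = cocycleAverage m c (T ^ K) / K := by
    rw [hA, integral_orbitAverage hRK ig hq0.ne', integral_div]; rfl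
  have huint : ∫ x, c (T ^ n) x / n ∂m = cocycleAverage m c (T ^ n) / n := by
    rw [integral_div]; rfl
  have hEint : ∫ x, E x ∂m ≤
      (cocycleAverage m c 1 + ∑ r ∈ Finset.range K, cocycleAverage m c (T ^ r)) / n := by
    rw [hE, integral_div, integral_add (hL1 1) (integrable_cocycle_smul hL1 _ _),
      integral_cocycle_smul hL1]
    refine div_le_div_of_nonneg_right (add_le_add le_rfl (Finset.single_le_sum
      (f := fun r => cocycleAverage m c (T ^ r)) (fun i _ => cocycleAverage_nonneg hc _) ?_)) hn0.le
    exact Finset.mem_range.mpr (Nat.mod_lt n hK)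
  -- Subadditivity bounds the cocycle only from above by A + E. A one-sided bound suffices, because
  -- A - c(T ^ n)/n has small integral when both averages are near the limit.
  have hle : ∀ᵐ x ∂m, |c (T ^ n) x / n - A x| ≤ 2 * E x + (A x - c (T ^ n) x / n) := by
    filter_upwards [hc.pow_mul_add_le T K q r] with x hx
    rw [hqr] at hx
    have hEx : 0 ≤ E x := div_nonneg (add_nonneg (hc.nonneg _ _) (hc.nonneg _ _)) hn0.le
    have hS0 : 0 ≤ ∑ i ∈ Finset.range q, c (T ^ K) ((T ^ K • ·)^[i] x) :=
      Finset.sum_nonneg fun i _ => hc.nonneg _ _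
    have h1 : c (T ^ n) x / n ≤ E x + A x := by
      have h2 : (∑ i ∈ Finset.range q, c (T ^ K) ((T ^ K • ·)^[i] x)) / n ≤ A x := by
        rw [hA, orbitAverage, ← Finset.sum_div, div_div]
        gcongr
        rw [← hqr]; push_cast
        nlinarith [Nat.cast_nonneg (α := ℝ) r]
      calc c (T ^ n) x / n ≤ (c 1 x + c (T ^ r) (T ^ (q * K) • x) +
            ∑ i ∈ Finset.range q, c (T ^ K) ((T ^ K • ·)^[i] x)) / n := by gcongr
        _ = E x + (∑ i ∈ Finset.range q, c (T ^ K) ((T ^ K • ·)^[i] x)) / n := by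
          rw [add_div]
        _ ≤ _ := by gcongr
    rw [abs_le]
    constructor <;> linarith
  have h3 := integral_mono_ae (iu.sub iA).abs ((iE.const_mul 2).add (iA.sub iu)) hle
  have h4 := integral_add (iE.const_mul 2) (iA.sub iu)
  have h5 := integral_sub iA iu
  simp only [Pi.add_apply, Pi.sub_apply] at h3 h4
  rw [h4, integral_const_mul, h5, hAint, huint] at h3
  linarith

/-- Fix K with average close to r. For large n the normalized cocycle is L¹-close to an orbit
average of c (T ^ K) / K, and these averages form a Cauchy sequence. -/
lemma isCauchyL1_cocycle (hc : IsSubadditiveCocycle m c) (hL1 : ∀ γ, Integrable (c γ) m) {T : Γ}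
    {r : ℝ} (hr : Tendsto (fun n : ℕ => cocycleAverage m c (T ^ n) / n) atTop (𝓝 r)) :
    IsCauchyL1 m fun n x => c (T ^ n) x / n := by
  intro ε hε
  have h1 : ∀ᶠ n : ℕ in atTop, |cocycleAverage m c (T ^ n) / n - r| < ε / 16 := by
    have := (Metric.tendsto_nhds.mp hr) (ε / 16) (by positivity)
    simpa [Real.dist_eq] using this
  obtain ⟨K, hKr, hK⟩ := (h1.and (eventually_gt_atTop 0)).exists
  set C := cocycleAverage m c 1 + ∑ r ∈ Finset.range K, cocycleAverage m c (T ^ r) with hC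
  have h2 : ∀ᶠ n : ℕ in atTop, C / n < ε / 16 :=
    (tendsto_const_div_atTop_nhds_zero_nat C).eventually_lt_const (by positivity)
  have ig : Integrable (fun x => c (T ^ K) x / K) m := (hL1 _).div_const _
  have hRK : MeasurePreserving (T ^ K • · : X → X) m m := measurePreserving_smul (T ^ K) m
  obtain ⟨M, hM⟩ := isCauchyL1_orbitAverage hRK ig (ε / 2) (by positivity)
  obtain ⟨N, hN⟩ := eventually_atTop.mp (h1.and (h2.and ((eventually_ge_atTop K).and
    (eventually_ge_atTop (M * K)))))
  have near : ∀ n ≥ N, ∫ x, |c (T ^ n) x / n -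
        orbitAverage (T ^ K • ·) (fun x => c (T ^ K) x / K) (n / K) x| ∂m ≤ ε / 4 := by
    intro n hn
    obtain ⟨a1, a2, a3, -⟩ := hN n hn
    have := integral_abs_sub_orbitAverage_le hc hL1 T hK a3
    rw [abs_lt] at a1 hKr
    linarith
  refine ⟨N, fun n hn k hk => ?_⟩
  have b1 := near n hn
  have b2 := near k hk
  have b3 := hM (n / K) ((Nat.le_div_iff_mul_le hK).mpr (hN n hn).2.2.2) (k / K)
    ((Nat.le_div_iff_mul_le hK).mpr (hN k hk).2.2.2)
  have iu : ∀ n : ℕ, Integrable (fun x => c (T ^ n) x / n) m := fun n => (hL1 _).div_const _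
  have iA := fun n => integrable_orbitAverage hRK ig n
  have i1 := ((iu n).sub (iA (n / K))).abs
  have i2 := ((iu k).sub (iA (k / K))).abs
  have i3 := ((iA (n / K)).sub (iA (k / K))).abs
  have e1 := integral_add (i1.add i2) i3
  have e2 := integral_add i1 i2
  have e3 := integral_mono ((iu n).sub (iu k)).abs ((i1.add i2).add i3) (fun x => by
    simp only [Pi.add_apply, Pi.sub_apply]
    set A := orbitAverage (T ^ K • ·) (fun x => c (T ^ K) x / K)
    have e : c (T ^ n) x / n - c (T ^ k) x / k =
        (c (T ^ n) x / n - A (n / K) x) - (c (T ^ k) x / k - A (k / K) x) +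
        (A (n / K) x - A (k / K) x) := by ring
    rw [e]
    exact (abs_add_le _ _).trans (by gcongr; exact abs_sub _ _))
  simp only [Pi.add_apply, Pi.sub_apply] at e1 e2 e3
  linarith

-- Write T γ = (T γ T⁻¹) T to compare the two base points in both directions. For T ^ n in place of
-- T, the integrals on the right are averages at γ^{±1} and at its conjugates by T ^ n, hence o(n).
omit [IsProbabilityMeasure m] in
lemma IsSubadditiveCocycle.abs_sub_smul_le (hc : IsSubadditiveCocycle m c) (T γ : Γ) :
    ∀ᵐ x ∂m, |c T (γ • x) - c T x| ≤
      c (T * γ * T⁻¹) (T • x) + c γ⁻¹ (γ • x) +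
      (c (T * γ⁻¹ * T⁻¹) ((T * γ) • x) + c γ x) := by
  have h1 := hc.subadditive (T * γ * T⁻¹) T
  have h2 := (measurePreserving_smul γ m).quasiMeasurePreserving.ae (hc.subadditive (T * γ) γ⁻¹)
  have h3 := (measurePreserving_smul γ m).quasiMeasurePreserving.ae
    (hc.subadditive (T * γ⁻¹ * T⁻¹) T)
  have h4 := hc.subadditive (T * γ⁻¹) γ
  filter_upwards [h1, h2, h3, h4] with x h1 h2 h3 h4
  rw [mul_inv_cancel_right, inv_smul_smul] at h2
  rw [inv_mul_cancel_right] at h1 h3 h4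
  rw [smul_smul] at h3
  have p1 := hc.nonneg (T * γ * T⁻¹) (T • x)
  have p2 := hc.nonneg γ⁻¹ (γ • x)
  have p3 := hc.nonneg (T * γ⁻¹ * T⁻¹) ((T * γ) • x)
  have p4 := hc.nonneg γ x
  rw [abs_le]
  constructor <;> linarith

variable [Group.FG Γ] [Group.IsNilpotent Γ]

/-- The normalized cocycle along the powers of `T` converges in `L¹` to its stable average. -/
theorem tendsto_integral_abs_cocycle_sub (hc : IsSubadditiveCocycle m c)
    (hL1 : ∀ γ, Integrable (c γ) m) {T : Γ} {r : ℝ}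
    (hr : Tendsto (fun n : ℕ => cocycleAverage m c (T ^ n) / n) atTop (𝓝 r)) :
    Tendsto (fun n : ℕ => ∫ x, |c (T ^ n) x / n - r| ∂m) atTop (𝓝 0) := by
  have iu : ∀ n : ℕ, Integrable (fun x => c (T ^ n) x / n) m := fun n => (hL1 _).div_const _
  obtain ⟨G, iG, hG⟩ := (isCauchyL1_cocycle hc hL1 hr).exists_limit iu
  have hlen := isLength_symmetrization (cocycleAverage_nonneg hc) (cocycleAverage_mul_le hc hL1)
  -- Invariance under all of Γ, not only under T: this is where nilpotency enters, and it lets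
  -- ergodicity of the whole action be used.
  have hinv : ∀ γ : Γ, ∀ᵐ x ∂m, G (γ • x) = G x := by
    intro γ
    have hγ := measurePreserving_smul γ m
    have iGγ : Integrable (fun x => G (γ • x)) m := hγ.integrable_comp_of_integrable iG
    have iuγ : ∀ n : ℕ, Integrable (fun x => c (T ^ n) (γ • x) / n) m := fun n =>
      hγ.integrable_comp_of_integrable (iu n)
    have h1 : ∀ n : ℕ, ∫ x, |c (T ^ n) (γ • x) / n - G (γ • x)| ∂m =
        ∫ x, |c (T ^ n) x / n - G x| ∂m := fun n =>
      hγ.integral_comp_ae (g := fun x => |c (T ^ n) x / n - G x|)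
        ((iu n).sub iG).abs.aestronglyMeasurable
    have h2 : ∀ n : ℕ, ∫ x, |c (T ^ n) (γ • x) / n - c (T ^ n) x / n| ∂m ≤
        (cocycleAverage m c (T ^ n * γ * (T ^ n)⁻¹) +
          cocycleAverage m c (T ^ n * γ * (T ^ n)⁻¹)⁻¹) / n +
        (cocycleAverage m c γ + cocycleAverage m c γ⁻¹) / n := by
      intro n
      have j1 := integrable_cocycle_smul (m := m) hL1 (T ^ n * γ * (T ^ n)⁻¹) (T ^ n)
      have j2 := integrable_cocycle_smul (m := m) hL1 γ⁻¹ γ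
      have j3 := integrable_cocycle_smul (m := m) hL1 (T ^ n * γ⁻¹ * (T ^ n)⁻¹) (T ^ n * γ)
      have j := ((j1.add j2).add (j3.add (hL1 γ))).div_const (n : ℝ)
      have e1 := integral_mono_ae ((iuγ n).sub (iu n)).abs j (by
        filter_upwards [hc.abs_sub_smul_le (T ^ n) γ] with x hx
        simp only [Pi.add_apply, Pi.sub_apply]
        rw [← sub_div, abs_div, Nat.abs_cast]
        gcongr)
      simp only [Pi.add_apply, Pi.sub_apply] at e1
      have e2 := integral_add (j1.add j2) (j3.add (hL1 γ))
      simp only [Pi.add_apply] at e2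
      rw [integral_div, e2, integral_add j1 j2, integral_add j3 (hL1 γ),
        integral_cocycle_smul hL1, integral_cocycle_smul hL1, integral_cocycle_smul hL1] at e1
      refine e1.trans (le_of_eq ?_)
      have e3 : (T ^ n * γ * (T ^ n)⁻¹)⁻¹ = T ^ n * γ⁻¹ * (T ^ n)⁻¹ := by group
      rw [e3, ← add_div]
      simp only [cocycleAverage]
      ring
    have h3 : ∀ n : ℕ, ∫ x, |G (γ • x) - G x| ∂m ≤
        (∫ x, |c (T ^ n) x / n - G x| ∂m) +
        ((cocycleAverage m c (T ^ n * γ * (T ^ n)⁻¹) +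
          cocycleAverage m c (T ^ n * γ * (T ^ n)⁻¹)⁻¹) / n +
        (cocycleAverage m c γ + cocycleAverage m c γ⁻¹) / n) +
        ∫ x, |c (T ^ n) x / n - G x| ∂m := by
      intro n
      have j1 := ((iuγ n).sub iGγ).abs
      have j2 := ((iuγ n).sub (iu n)).abs
      have j3 := ((iu n).sub iG).abs
      have e1 := integral_mono (iGγ.sub iG).abs ((j1.add j2).add j3) (fun x => by
        simp only [Pi.add_apply, Pi.sub_apply]
        have e : G (γ • x) - G x = -(c (T ^ n) (γ • x) / n - G (γ • x)) +
          (c (T ^ n) (γ • x) / n - c (T ^ n) x / n) + (c (T ^ n) x / n - G x) := by ring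
        rw [e]
        refine (abs_add_le _ _).trans (add_le_add ((abs_add_le _ _).trans ?_) le_rfl)
        rw [abs_neg])
      have e2 := integral_add (j1.add j2) j3
      have e3 := integral_add j1 j2
      simp only [Pi.add_apply, Pi.sub_apply] at e1 e2 e3
      linarith [h1 n, h2 n]
    have h4 : Tendsto (fun n : ℕ => (∫ x, |c (T ^ n) x / n - G x| ∂m) +
        ((cocycleAverage m c (T ^ n * γ * (T ^ n)⁻¹) +
          cocycleAverage m c (T ^ n * γ * (T ^ n)⁻¹)⁻¹) / n +
        (cocycleAverage m c γ + cocycleAverage m c γ⁻¹) / n) +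
        ∫ x, |c (T ^ n) x / n - G x| ∂m) atTop (𝓝 0) := by
      simpa using (hG.add ((tendsto_length_conj_pow_div hlen T γ).add
        (tendsto_const_div_atTop_nhds_zero_nat
          (cocycleAverage m c γ + cocycleAverage m c γ⁻¹)))).add hG
    have h5 : ∫ x, |G (γ • x) - G x| ∂m = 0 :=
      le_antisymm (ge_of_tendsto' h4 h3) (integral_nonneg fun x => abs_nonneg _)
    have h6 := (integral_eq_zero_iff_of_nonneg (fun x => abs_nonneg _) (iGγ.sub iG).abs).mp h5
    filter_upwards [h6] with x hx
    simpa [sub_eq_zero] using hx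
  obtain ⟨a, ha⟩ := ErgodicSMul.ae_eq_const_of_forall_smul iG.aemeasurable hinv
  have hGa : ∀ n : ℕ, ∫ x, |c (T ^ n) x / n - G x| ∂m = ∫ x, |c (T ^ n) x / n - a| ∂m := by
    intro n
    refine integral_congr_ae ?_
    filter_upwards [ha] with x hx
    rw [hx]
  simp only [hGa] at hG
  have har : Tendsto (fun n : ℕ => cocycleAverage m c (T ^ n) / n) atTop (𝓝 a) := by
    rw [tendsto_iff_norm_sub_tendsto_zero]
    refine squeeze_zero (fun n => norm_nonneg _) (fun n => ?_) hG
    have e1 : cocycleAverage m c (T ^ n) / n - a = ∫ x, (c (T ^ n) x / n - a) ∂m := by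
      rw [integral_sub (iu n) (integrable_const a), integral_div]
      simp [cocycleAverage]
    rw [e1]
    exact norm_integral_le_integral_norm _
  rwa [tendsto_nhds_unique har hr] at hG

end CocycleL1

/-! ### Covering arguments and the maximal inequality -/

section Covering

/-- A subadditive array that is locally dominated by the sums of `b` along short intervals is
globally dominated, up to a constant. -/
lemma subadditive_le_sum_of_covering {a : ℕ → ℕ → ℝ} {b : ℕ → ℝ} {M : ℕ} {D : ℝ}
    (hsub : ∀ i n k, a i (n + k) ≤ a i n + a (i + n) k)
    (hb : ∀ i, ∃ n, 1 ≤ n ∧ n ≤ M ∧ a i n ≤ ∑ l ∈ Finset.Ico i (i + n), b l)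
    (hD : ∀ i n, n ≤ M → a i n ≤ ∑ l ∈ Finset.Ico i (i + n), b l + D) (N i : ℕ) :
    a i N ≤ ∑ l ∈ Finset.Ico i (i + N), b l + D := by
  induction N using Nat.strong_induction_on generalizing i with
  | _ N ih =>
    by_cases hN : N ≤ M
    · exact hD i N hN
    -- Greedy covering: split off one dominated interval and continue after it. Only the final
    -- piece, of length at most M, is charged to D.
    · obtain ⟨n, hn1, hnM, hn⟩ := hb i
      have h1 := hsub i n (N - n)
      have h2 := ih (N - n) (by omega) (i + n)
      have h3 := Finset.sum_Ico_consecutive b (Nat.le_add_right i n)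
        (show i + n ≤ i + N by omega)
      rw [show i + n + (N - n) = i + N by omega] at h2
      rw [show n + (N - n) = N by omega] at h1
      linarith

variable {X : Type*} [MeasurableSpace X] {m : Measure X} [IsProbabilityMeasure m] {R : X → X}

omit [IsProbabilityMeasure m] in
lemma MeasureTheory.MeasurePreserving.ae_forall_iterate (hR : MeasurePreserving R m m)
    {p : X → Prop} (hp : ∀ᵐ x ∂m, p x) : ∀ᵐ x ∂m, ∀ i : ℕ, p (R^[i] x) :=
  ae_all_iff.mpr fun i => (hR.iterate i).quasiMeasurePreserving.ae hp

lemma integral_sum_indicator_iterate (hR : MeasurePreserving R m m) {B : Set X}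
    (hB : MeasurableSet B) (N : ℕ) :
    Integrable (fun x => ∑ i ∈ Finset.range N, B.indicator (1 : X → ℝ) (R^[i] x)) m ∧
    ∫ x, ∑ i ∈ Finset.range N, B.indicator (1 : X → ℝ) (R^[i] x) ∂m = N * m.real B := by
  have hi : Integrable (B.indicator (1 : X → ℝ)) m := (integrable_const 1).indicator hB
  refine ⟨integrable_finsetSum _ fun i _ => hR.integrable_comp_iterate hi i, ?_⟩
  rw [integral_finsetSum _ fun i _ => hR.integrable_comp_iterate hi i]
  simp_rw [(hR.iterate _).integral_comp_ae hi.aestronglyMeasurable]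
  rw [integral_indicator_one hB]
  simp

/-- If a bounded subadditive cocycle over `R` is at most `β n` at some time `n ≥ 1` at almost
every point, then its integrals grow at rate at most `β`. -/
theorem integral_le_of_ae_exists_le (hR : MeasurePreserving R m m) {a : ℕ → X → ℝ}
    (ha : ∀ n, Measurable (a n)) {C β : ℝ}
    (hsub : ∀ᵐ x ∂m, ∀ n k, a (n + k) x ≤ a n x + a k (R^[n] x))
    (hbd : ∀ᵐ x ∂m, ∀ n : ℕ, |a n x| ≤ C * (n + 1))
    (hβ : ∀ᵐ x ∂m, ∃ n : ℕ, 1 ≤ n ∧ a n x ≤ β * n) {ε : ℝ} (hε : 0 < ε) :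
    ∃ D, ∀ N : ℕ, ∫ x, a N x ∂m ≤ (β + ε) * N + D := by
  have hC : 0 ≤ C := by
    obtain ⟨x, hx⟩ := hbd.exists
    have := (abs_nonneg _).trans (hx 0)
    simpa using this
  -- At points of B M there is no good time up to M, and a single step is taken instead. Its value
  -- is at most 2 C ≤ β + K. The measure of B M tends to 0, so these steps contribute at most ε per
  -- unit of time.
  set K := 2 * C + |β| with hK
  have hK0 : 0 ≤ K := by positivity
  set B : ℕ → Set X := fun M => {x | ∀ n : ℕ, 1 ≤ n → n ≤ M → β * n < a n x} with hB
  have hBm : ∀ M, MeasurableSet (B M) := by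
    intro M
    have : B M = ⋂ n : ℕ, ⋂ (_ : 1 ≤ n), ⋂ (_ : n ≤ M), {x | β * n < a n x} := by
      ext x; simp [hB]
    rw [this]
    exact MeasurableSet.iInter fun n => MeasurableSet.iInter fun _ => MeasurableSet.iInter fun _ =>
      measurableSet_lt measurable_const (ha n)
  have hBanti : Antitone B := fun M M' h x hx n h1 h2 => hx n h1 (h2.trans h)
  have hBnull : m (⋂ M, B M) = 0 := by
    refine measure_mono_null (fun x hx => ?_) hβ
    rintro ⟨n, hn1, hn⟩
    exact absurd (Set.mem_iInter.mp hx n n hn1 le_rfl) (not_lt.mpr hn)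
  have hBlim : Tendsto (fun M => K * m.real (B M)) atTop (𝓝 0) := by
    have h1 := tendsto_measure_iInter_atTop (fun M => (hBm M).nullMeasurableSet) hBanti
      ⟨0, measure_ne_top m _⟩
    rw [hBnull] at h1
    have h2 := (ENNReal.tendsto_toReal ENNReal.zero_ne_top).comp h1
    simpa [Measure.real] using h2.const_mul K
  obtain ⟨M, hM, hM1⟩ := ((hBlim.eventually_lt_const hε).and (eventually_ge_atTop 1)).exists
  refine ⟨C * (M + 1) + |β| * M, fun N => ?_⟩
  have hpt : ∀ᵐ x ∂m, a N x ≤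
      (β * N + (C * (M + 1) + |β| * M)) +
        K * ∑ i ∈ Finset.range N, (B M).indicator (1 : X → ℝ) (R^[i] x) := by
    filter_upwards [hR.ae_forall_iterate hsub, hR.ae_forall_iterate hbd] with x h1 h2
    have hind : ∀ y, 0 ≤ (B M).indicator (1 : X → ℝ) y := fun y =>
      Set.indicator_nonneg (fun _ _ => zero_le_one) y
    have key := subadditive_le_sum_of_covering (a := fun i n => a n (R^[i] x))
      (b := fun l => β + K * (B M).indicator (1 : X → ℝ) (R^[l] x)) (M := M)
      (D := C * (M + 1) + |β| * M)
      (fun i n k => by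
        have := h1 i n k
        rwa [← Function.iterate_add_apply, add_comm n i] at this)
      (fun i => by
        by_cases hi : R^[i] x ∈ B M
        · refine ⟨1, le_rfl, hM1, ?_⟩
          have h3 := (le_abs_self _).trans (h2 i 1)
          have h4 := neg_abs_le β
          simp [hi]
          push_cast at h3
          linarith
        · simp only [hB, Set.mem_ofPred_eq, not_forall, not_lt] at hi
          obtain ⟨n, hn1, hnM, hn⟩ := hi
          refine ⟨n, hn1, hnM, hn.trans ?_⟩
          calc β * n = ∑ l ∈ Finset.Ico i (i + n), β := by simp [mul_comm]
            _ ≤ _ := Finset.sum_le_sum fun l _ => by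
              have := mul_nonneg hK0 (hind (R^[l] x))
              linarith)
      (fun i n hn => by
        have h3 := (le_abs_self _).trans (h2 i n)
        have hn' : (n : ℝ) ≤ M := by exact_mod_cast hn
        have h4 : -(|β| * M) ≤ ∑ l ∈ Finset.Ico i (i + n),
            (β + K * (B M).indicator (1 : X → ℝ) (R^[l] x)) := by
          calc -(|β| * M) ≤ -(|β| * n) := by
                have := mul_le_mul_of_nonneg_left hn' (abs_nonneg β); linarith
            _ = ∑ l ∈ Finset.Ico i (i + n), -|β| := by simp [mul_comm]
            _ ≤ _ := Finset.sum_le_sum fun l _ => by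
              have := mul_nonneg hK0 (hind (R^[l] x))
              linarith [neg_abs_le β]
        have h5 : C * ((n : ℝ) + 1) ≤ C * (M + 1) := by gcongr
        linarith)
      N 0
    rw [zero_add, ← Finset.range_eq_Ico, Finset.sum_add_distrib, ← Finset.mul_sum] at key
    simp only [Function.iterate_zero, id, Finset.sum_const, Finset.card_range, nsmul_eq_mul]
      at key
    linarith
  have iaN : Integrable (a N) m := by
    refine Integrable.of_bound (ha N).aestronglyMeasurable (C * (N + 1)) ?_
    filter_upwards [hbd] with x hx
    exact hx N
  obtain ⟨iS, hS⟩ := integral_sum_indicator_iterate hR (hBm M) N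
  have h6 := integral_mono_ae iaN ((integrable_const _).add (iS.const_mul K)) hpt
  simp only [Pi.add_apply] at h6
  rw [integral_add (integrable_const _) (iS.const_mul K), integral_const_mul, hS] at h6
  simp only [integral_const, probReal_univ, one_smul] at h6
  have h7 : (N : ℝ) * (K * m.real (B M)) ≤ N * ε := by gcongr
  linarith

/-- The points whose orbit visits `F` with frequency at least `η` up to some time. -/
def frequentlyVisiting (R : X → X) (η : ℝ) (F : Set X) : Set X :=
  {x | ∃ n : ℕ, 1 ≤ n ∧ η * n ≤ ∑ i ∈ Finset.range n, F.indicator (1 : X → ℝ) (R^[i] x)}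

omit [IsProbabilityMeasure m] in
lemma measurable_sum_indicator_iterate (hR : MeasurePreserving R m m) {F : Set X}
    (hF : MeasurableSet F) (n : ℕ) :
    Measurable fun x => ∑ i ∈ Finset.range n, F.indicator (1 : X → ℝ) (R^[i] x) :=
  Finset.measurable_sum _ fun i _ =>
    ((measurable_const (a := (1 : ℝ))).indicator hF).comp (hR.iterate i).measurable

omit [IsProbabilityMeasure m] in
lemma measurableSet_frequentlyVisiting (hR : MeasurePreserving R m m) {F : Set X}
    (hF : MeasurableSet F) (η : ℝ) : MeasurableSet (frequentlyVisiting R η F) := by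
  have : frequentlyVisiting R η F = ⋃ n : ℕ, ⋃ (_ : 1 ≤ n),
      {x | η * n ≤ ∑ i ∈ Finset.range n, F.indicator (1 : X → ℝ) (R^[i] x)} := by
    ext x; simp [frequentlyVisiting]
  rw [this]
  exact MeasurableSet.iUnion fun n => MeasurableSet.iUnion fun _ =>
    measurableSet_le measurable_const (measurable_sum_indicator_iterate hR hF n)

/-- The weak type maximal inequality for the visits to a set. -/
theorem measureReal_frequentlyVisiting_le (hR : MeasurePreserving R m m) {F : Set X}
    (hF : MeasurableSet F) {η : ℝ} (hη : 0 < η) :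
    m.real (frequentlyVisiting R η F) ≤ m.real F / η := by
  set V : ℕ → Set X := fun M => {x | ∃ n : ℕ, 1 ≤ n ∧ n ≤ M ∧
    η * n ≤ ∑ i ∈ Finset.range n, F.indicator (1 : X → ℝ) (R^[i] x)} with hV
  have hVm : ∀ M, MeasurableSet (V M) := by
    intro M
    have : V M = ⋃ n : ℕ, ⋃ (_ : 1 ≤ n), ⋃ (_ : n ≤ M),
        {x | η * n ≤ ∑ i ∈ Finset.range n, F.indicator (1 : X → ℝ) (R^[i] x)} := by
      ext x; simp [hV]; tauto
    rw [this]
    exact MeasurableSet.iUnion fun n => MeasurableSet.iUnion fun _ => MeasurableSet.iUnion fun _ =>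
      measurableSet_le measurable_const (measurable_sum_indicator_iterate hR hF n)
  have hVmono : Monotone V := fun M M' h x ⟨n, h1, h2, h3⟩ => ⟨n, h1, h2.trans h, h3⟩
  have hVU : frequentlyVisiting R η F = ⋃ M, V M := by
    ext x
    simp only [frequentlyVisiting, hV, Set.mem_ofPred_eq, Set.mem_iUnion]
    exact ⟨fun ⟨n, h1, h2⟩ => ⟨n, n, h1, le_rfl, h2⟩, fun ⟨M, n, h1, _, h2⟩ => ⟨n, h1, h2⟩⟩
  have hind : ∀ (A : Set X) y, 0 ≤ A.indicator (1 : X → ℝ) y := fun A y =>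
      Set.indicator_nonneg (fun _ _ => zero_le_one) y
  have hind1 : ∀ (A : Set X) y, A.indicator (1 : X → ℝ) y ≤ 1 := fun A y => by
    by_cases h : y ∈ A <;> simp [h]
  have hVle : ∀ M, m.real (V M) ≤ m.real F / η := by
    intro M
    rw [le_div_iff₀' hη]
    have hpt : ∀ N : ℕ, ∀ x, η * ∑ i ∈ Finset.range N, (V M).indicator (1 : X → ℝ) (R^[i] x) ≤
        (∑ i ∈ Finset.range N, F.indicator (1 : X → ℝ) (R^[i] x)) + η * (M + 1) := by
      intro N x
      -- With negated counts, the interval chosen at a point of V M contains at least η n visits to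
      -- F and at most n visits to V M. Using M + 1 as the length bound allows the unit steps
      -- outside V M even when M = 0.
      have key := subadditive_le_sum_of_covering
        (a := fun i n => -∑ l ∈ Finset.Ico i (i + n), F.indicator (1 : X → ℝ) (R^[l] x))
        (b := fun l => -(η * (V M).indicator (1 : X → ℝ) (R^[l] x))) (M := M + 1)
        (D := η * (M + 1))
        (fun i n k => by
          have := Finset.sum_Ico_consecutive (fun l => F.indicator (1 : X → ℝ) (R^[l] x))
            (Nat.le_add_right i n) (Nat.le_add_right (i + n) k)
          rw [← add_assoc]
          linarith)
        (fun i => by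
          by_cases hi : R^[i] x ∈ V M
          · obtain ⟨n, hn1, hnM, hn⟩ := hi
            refine ⟨n, hn1, by omega, ?_⟩
            have e1 : ∑ l ∈ Finset.Ico i (i + n), F.indicator (1 : X → ℝ) (R^[l] x) =
                ∑ l ∈ Finset.range n, F.indicator (1 : X → ℝ) (R^[l] (R^[i] x)) := by
              rw [Finset.sum_Ico_eq_sum_range, Nat.add_sub_cancel_left]
              refine Finset.sum_congr rfl fun l _ => ?_
              rw [← Function.iterate_add_apply, add_comm]
            have e2 : ∑ l ∈ Finset.Ico i (i + n), (V M).indicator (1 : X → ℝ) (R^[l] x) ≤ n := by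
              calc _ ≤ ∑ l ∈ Finset.Ico i (i + n), (1 : ℝ) :=
                    Finset.sum_le_sum fun l _ => hind1 _ _
                _ = n := by simp
            rw [Finset.sum_neg_distrib, ← Finset.mul_sum, neg_le_neg_iff, e1]
            exact le_trans (by gcongr) hn
          · refine ⟨1, le_rfl, by omega, ?_⟩
            simp [hi]
            exact hind F _)
        (fun i n hn => by
          have hn' : (n : ℝ) ≤ M + 1 := by exact_mod_cast hn
          have e1 : 0 ≤ ∑ l ∈ Finset.Ico i (i + n), F.indicator (1 : X → ℝ) (R^[l] x) :=
            Finset.sum_nonneg fun l _ => hind _ _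
          have e2 : ∑ l ∈ Finset.Ico i (i + n), (V M).indicator (1 : X → ℝ) (R^[l] x) ≤ n := by
            calc _ ≤ ∑ l ∈ Finset.Ico i (i + n), (1 : ℝ) :=
                  Finset.sum_le_sum fun l _ => hind1 _ _
              _ = n := by simp
          rw [Finset.sum_neg_distrib, ← Finset.mul_sum]
          have := mul_le_mul_of_nonneg_left (e2.trans hn') hη.le
          linarith)
        N 0
      rw [zero_add, ← Finset.range_eq_Ico, Finset.sum_neg_distrib, ← Finset.mul_sum] at key
      linarith
    have hint : ∀ N : ℕ, η * (N * m.real (V M)) ≤ N * m.real F + η * (M + 1) := by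
      intro N
      obtain ⟨i1, h1⟩ := integral_sum_indicator_iterate hR (hVm M) N
      obtain ⟨i2, h2⟩ := integral_sum_indicator_iterate hR hF N
      have h3 := integral_mono (i1.const_mul η) (i2.add (integrable_const (η * ((M : ℝ) + 1))))
        (hpt N)
      simp only [Pi.add_apply] at h3
      rw [integral_const_mul, h1, integral_add i2 (integrable_const _), h2] at h3
      simpa using h3
    have hlim : Tendsto (fun N : ℕ => m.real F + η * (M + 1) / N) atTop (𝓝 (m.real F + 0)) :=
      tendsto_const_nhds.add (tendsto_const_div_atTop_nhds_zero_nat _)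
    rw [add_zero] at hlim
    refine ge_of_tendsto hlim ?_
    filter_upwards [eventually_gt_atTop 0] with N hN
    have hN0 : (0 : ℝ) < N := by exact_mod_cast hN
    have := hint N
    calc η * m.real (V M) = η * (N * m.real (V M)) / N := by field_simp
      _ ≤ (N * m.real F + η * (M + 1)) / N := by gcongr
      _ = _ := by field_simp
  have h1 := tendsto_measure_iUnion_atTop (μ := m) hVmono
  rw [← hVU] at h1
  have h2 := (ENNReal.tendsto_toReal (measure_ne_top m _)).comp h1
  exact le_of_tendsto' h2 hVle

end Covering

/-! ### Almost everywhere convergence for bounded cocycles -/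

section Pointwise

lemma Group.FG.countable_of_fg (G : Type*) [Group G] [Group.FG G] : Countable G := by
  obtain ⟨S, hfin, hS, hgen⟩ := exists_finite_symmetric_generators G
  have := hfin.to_subtype
  have : Function.Surjective fun l : List S => (l.map Subtype.val).prod := by
    intro g
    obtain ⟨l, hl, rfl⟩ := exists_list_of_closure_eq_top hgen g
    have hl' : ∀ s ∈ l, s ∈ S := fun s hs => (hl s hs).elim id fun h => by simpa using hS _ h
    lift l to List S using hl'
    exact ⟨l, rfl⟩
  exact this.countable

variable {Γ X : Type*} [Group Γ] [MeasurableSpace X] {m : Measure X}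
  [MulAction Γ X] {c : Γ → X → ℝ} {ℓ : Γ → ℝ}

/-- On the orbit of `x` the cocycle is subadditive and bounded by `ℓ`. -/
structure IsGoodPoint (c : Γ → X → ℝ) (ℓ : Γ → ℝ) (x : X) : Prop where
  subadditive : ∀ γ g h : Γ, c (g * h) (γ • x) ≤ c g (h • γ • x) + c h (γ • x)
  bounded : ∀ γ g : Γ, c g (γ • x) ≤ ℓ g

omit [MeasurableSpace X] in
lemma IsGoodPoint.smul {x : X} (hx : IsGoodPoint c ℓ x) (γ : Γ) : IsGoodPoint c ℓ (γ • x) where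
  subadditive γ' g h := by simpa only [smul_smul] using hx.subadditive (γ' * γ) g h
  bounded γ' g := by simpa only [smul_smul] using hx.bounded (γ' * γ) g

omit [MeasurableSpace X] in
lemma IsGoodPoint.subadditive' {x : X} (hx : IsGoodPoint c ℓ x) (g h : Γ) :
    c (g * h) x ≤ c g (h • x) + c h x := by simpa using hx.subadditive 1 g h

omit [MeasurableSpace X] in
lemma IsGoodPoint.bounded' {x : X} (hx : IsGoodPoint c ℓ x) (g : Γ) : c g x ≤ ℓ g := by
  simpa using hx.bounded 1 g

omit [MeasurableSpace X] in
lemma IsGoodPoint.le_add {x : X} (hx : IsGoodPoint c ℓ x) (hℓ : IsLength ℓ) (g h : Γ) :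
    c g (h • x) ≤ c g x + (ℓ (g * h * g⁻¹) + ℓ h) := by
  have h1 := hx.subadditive' (g * h * g⁻¹) g
  have h2 := (hx.smul h).subadditive' (g * h) h⁻¹
  rw [mul_inv_cancel_right, inv_smul_smul] at h2
  rw [inv_mul_cancel_right] at h1
  have h3 := (hx.smul g).bounded' (g * h * g⁻¹)
  have h4 := (hx.smul h).bounded' h⁻¹
  rw [hℓ.inv] at h4
  linarith

-- The pointwise form of the comparison of base points. It serves both for a fixed h, where the
-- bound is o(n) along g = T ^ n, and for the small perturbations of polygonal products.
omit [MeasurableSpace X] in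
lemma IsGoodPoint.abs_sub_le {x : X} (hx : IsGoodPoint c ℓ x) (hℓ : IsLength ℓ) (g h : Γ) :
    |c g (h • x) - c g x| ≤ ℓ (g * h * g⁻¹) + ℓ h := by
  have h1 := hx.le_add hℓ g h
  have h2 := (hx.smul h).le_add hℓ g h⁻¹
  rw [inv_smul_smul, hℓ.inv, show g * h⁻¹ * g⁻¹ = (g * h * g⁻¹)⁻¹ by group, hℓ.inv] at h2
  rw [abs_le]
  constructor <;> linarith

/-- The length given by the essential suprema of a bounded cocycle. -/
noncomputable def cocycleSup (m : Measure X) (c : Γ → X → ℝ) (γ : Γ) : ℝ :=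
  (eLpNorm (c γ) ∞ m).toReal

omit [Group Γ] [MulAction Γ X] in
lemma ae_le_cocycleSup (hb : ∀ γ, MemLp (c γ) ∞ m) (γ : Γ) : ∀ᵐ x ∂m, c γ x ≤ cocycleSup m c γ := by
  filter_upwards [enorm_ae_le_eLpNormEssSup (c γ) m] with x hx
  rw [← eLpNorm_exponent_top] at hx
  have h1 := ENNReal.toReal_mono (hb γ).eLpNorm_ne_top hx
  rw [toReal_enorm] at h1
  exact (le_abs_self _).trans h1

variable [IsProbabilityMeasure m] [MeasurableConstSMul Γ X] [ErgodicSMul Γ X m]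

lemma cocycleSup_mul_le (hc : IsSubadditiveCocycle m c) (hb : ∀ γ, MemLp (c γ) ∞ m) (γ γ' : Γ) :
    cocycleSup m c (γ * γ') ≤ cocycleSup m c γ + cocycleSup m c γ' := by
  have h0 : 0 ≤ cocycleSup m c γ + cocycleSup m c γ' :=
    add_nonneg ENNReal.toReal_nonneg ENNReal.toReal_nonneg
  have h1 : ∀ᵐ x ∂m, ‖c (γ * γ') x‖ ≤ cocycleSup m c γ + cocycleSup m c γ' := by
    filter_upwards [hc.subadditive γ γ', ae_le_cocycleSup hb γ',
      (measurePreserving_smul γ' m).quasiMeasurePreserving.ae (ae_le_cocycleSup hb γ)]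
      with x h1 h2 h3
    rw [Real.norm_eq_abs, abs_of_nonneg (hc.nonneg _ _)]
    linarith
  have h2 := eLpNorm_le_of_ae_bound (p := ∞) h1
  rw [measure_univ, ENNReal.one_rpow, one_mul] at h2
  exact ENNReal.toReal_le_of_le_ofReal h0 h2

omit [IsProbabilityMeasure m] in
lemma ae_isGoodPoint [Countable Γ] (hc : IsSubadditiveCocycle m c)
    (hℓ : ∀ γ, ∀ᵐ x ∂m, c γ x ≤ ℓ γ) : ∀ᵐ x ∂m, IsGoodPoint c ℓ x := by
  have h1 : ∀ᵐ x ∂m, ∀ γ g h : Γ, c (g * h) (γ • x) ≤ c g (h • γ • x) + c h (γ • x) :=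
    ae_all_iff.mpr fun γ => ae_all_iff.mpr fun g => ae_all_iff.mpr fun h =>
      (measurePreserving_smul γ m).quasiMeasurePreserving.ae (hc.subadditive g h)
  have h2 : ∀ᵐ x ∂m, ∀ γ g : Γ, c g (γ • x) ≤ ℓ g :=
    ae_all_iff.mpr fun γ => ae_all_iff.mpr fun g =>
      (measurePreserving_smul γ m).quasiMeasurePreserving.ae (hℓ g)
  filter_upwards [h1, h2] with x h1 h2
  exact ⟨h1, h2⟩

variable [Group.FG Γ] [Group.IsNilpotent Γ]

omit [IsProbabilityMeasure m] [MeasurableConstSMul Γ X] in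
/-- A zero-one law for the upper and lower growth rates along the powers of `T`. -/
lemma ae_frequently_or_ae_eventually (hc : IsSubadditiveCocycle m c) (hℓ : IsLength ℓ)
    (hgood : ∀ᵐ x ∂m, IsGoodPoint c ℓ x) (T : Γ) {s : ℝ} (hs : |s| = 1) (α : ℝ) :
    (∀ᵐ x ∂m, ∀ k : ℕ, ∃ᶠ n : ℕ in atTop, s * c (T ^ n) x ≤ (α + 1 / (k + 1)) * n) ∨
    ∀ᵐ x ∂m, ∃ k : ℕ, ∀ᶠ n : ℕ in atTop, (α + 1 / (k + 1)) * n < s * c (T ^ n) x := by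
  set H : Set X := {x | ∀ k : ℕ, ∃ᶠ n : ℕ in atTop, s * c (T ^ n) x ≤ (α + 1 / (k + 1)) * n}
    with hH
  have hHm : MeasurableSet H := by
    have : H = ⋂ k : ℕ, ⋂ N : ℕ, ⋃ n : ℕ, ⋃ (_ : N ≤ n),
        {x | s * c (T ^ n) x ≤ (α + 1 / (k + 1)) * n} := by
      ext x; simp [hH, frequently_atTop]
    rw [this]
    exact MeasurableSet.iInter fun k => MeasurableSet.iInter fun N => MeasurableSet.iUnion fun n =>
      MeasurableSet.iUnion fun _ =>
        measurableSet_le ((hc.measurable _).const_mul s) measurable_const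
  -- Requiring the inequality for every slack 1 / (k + 1) makes H invariant: the o(n) error of the
  -- translation is absorbed by using level 2 k + 1, whose slack is half as large.
  have hstep : ∀ x, IsGoodPoint c ℓ x → ∀ γ : Γ, x ∈ H → γ • x ∈ H := by
    intro x hx γ hxH k
    have h1 : Tendsto (fun n : ℕ => ℓ (T ^ n * γ * (T ^ n)⁻¹) / n + ℓ γ / n) atTop (𝓝 0) := by
      simpa using (tendsto_length_conj_pow_div hℓ T γ).add
        (tendsto_const_div_atTop_nhds_zero_nat (ℓ γ))
    have h2 := h1.eventually_le_const (show (0 : ℝ) < 1 / (2 * (k + 1)) by positivity)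
    refine ((hxH (2 * k + 1)).and_eventually (h2.and (eventually_gt_atTop 0))).mono ?_
    rintro n ⟨h3, h4, hn⟩
    have hn0 : (0 : ℝ) < n := by exact_mod_cast hn
    rw [← add_div, div_le_iff₀ hn0] at h4
    have h5 := hx.abs_sub_le hℓ (T ^ n) γ
    have h6 : s * c (T ^ n) (γ • x) - s * c (T ^ n) x ≤ |c (T ^ n) (γ • x) - c (T ^ n) x| := by
      rw [← mul_sub]
      refine (le_abs_self _).trans ?_
      rw [abs_mul, hs, one_mul]
    have h7 : (1 : ℝ) / ((2 * k + 1 : ℕ) + 1) + 1 / (2 * (k + 1)) = 1 / (k + 1) := by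
      push_cast; field_simp; ring
    calc s * c (T ^ n) (γ • x) ≤ (α + 1 / ((2 * k + 1 : ℕ) + 1)) * n + 1 / (2 * (k + 1)) * n := by
          linarith
      _ = (α + (1 / ((2 * k + 1 : ℕ) + 1) + 1 / (2 * (k + 1)))) * n := by ring
      _ = _ := by rw [h7]
  have hconst := aeconst_of_forall_preimage_smul_ae_eq Γ (μ := m) hHm.nullMeasurableSet fun γ => by
    filter_upwards [hgood] with x hx
    refine propext ⟨fun h => ?_, fun h => hstep x hx γ h⟩
    have := hstep _ (hx.smul γ) γ⁻¹ h
    rwa [inv_smul_smul] at this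
  rcases eventuallyConst_set.mp hconst with h | h
  · exact Or.inl h
  · refine Or.inr ?_
    filter_upwards [h] with x hx
    simpa [hH] using hx

omit [MeasurableSpace X] [MeasurableConstSMul Γ X] [Group.FG Γ] [Group.IsNilpotent Γ] in
lemma IsGoodPoint.orbit_subadditive {x : X} (hx : IsGoodPoint c ℓ x) (T : Γ) (n k : ℕ) :
    c (T ^ (n + k)) x ≤ c (T ^ n) x + c (T ^ k) ((T • ·)^[n] x) := by
  rw [smul_iterate, add_comm n k, pow_add]
  linarith [hx.subadditive' (T ^ k) (T ^ n)]

/-- Otherwise, by the zero-one law, almost every orbit would have a time with value barely above α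
n, and the covering argument would push the growth rate of the averages below r. -/
lemma ae_lower_bound (hc : IsSubadditiveCocycle m c) (hℓ : IsLength ℓ)
    (hgood : ∀ᵐ x ∂m, IsGoodPoint c ℓ x) {T : Γ} {r : ℝ}
    (hr : Tendsto (fun n : ℕ => cocycleAverage m c (T ^ n) / n) atTop (𝓝 r)) {α : ℝ}
    (hα : α < r) : ∀ᵐ x ∂m, ∀ᶠ n : ℕ in atTop, α * n ≤ c (T ^ n) x := by
  rcases ae_frequently_or_ae_eventually hc hℓ hgood T (s := 1) (by simp) α with h | h
  · exfalso
    obtain ⟨k, hk⟩ := exists_nat_one_div_lt (show 0 < (r - α) / 2 by linarith)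
    have hR : MeasurePreserving (T • · : X → X) m m := measurePreserving_smul T m
    obtain ⟨D, hD⟩ := integral_le_of_ae_exists_le hR (a := fun n => c (T ^ n))
      (fun n => hc.measurable _) (C := ℓ 1 + ℓ T) (β := α + 1 / (k + 1))
      (by filter_upwards [hgood] with x hx using hx.orbit_subadditive T)
      (by
        filter_upwards [hgood] with x hx n
        rw [abs_of_nonneg (hc.nonneg _ _)]
        have h1 := hx.bounded' (T ^ n)
        have h2 := hℓ.pow_le T n
        have := hℓ.nonneg 1
        have := hℓ.nonneg T
        nlinarith [Nat.cast_nonneg (α := ℝ) n])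
      (by
        filter_upwards [h] with x hx
        obtain ⟨n, hn, hn1⟩ := ((hx k).and_eventually (eventually_ge_atTop 1)).exists
        exact ⟨n, hn1, by simpa using hn⟩)
      (ε := (r - α) / 4) (by linarith)
    have hlim : Tendsto (fun N : ℕ => (α + 1 / (k + 1) + (r - α) / 4) + D / N) atTop
        (𝓝 ((α + 1 / (k + 1) + (r - α) / 4) + 0)) :=
      tendsto_const_nhds.add (tendsto_const_div_atTop_nhds_zero_nat D)
    have hle : r ≤ (α + 1 / (k + 1) + (r - α) / 4) + 0 := by
      refine le_of_tendsto_of_tendsto hr hlim ?_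
      filter_upwards [eventually_gt_atTop 0] with N hN
      have hN0 : (0 : ℝ) < N := by exact_mod_cast hN
      rw [div_le_iff₀ hN0]
      calc cocycleAverage m c (T ^ N) ≤ _ := hD N
        _ = _ := by field_simp
    linarith
  · filter_upwards [h] with x ⟨k, hk⟩
    filter_upwards [hk] with n hn
    have : (0 : ℝ) ≤ 1 / (k + 1) * n := by positivity
    linarith

/-- The negated cocycle is superadditive, so the covering argument is applied to the negated sums of
c (T ^ K) along T ^ K-orbits. These sums are additive and, up to sign and bounded terms, dominate
the cocycle. Frequent large values would force the average at T ^ K to be too large. -/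
lemma ae_upper_bound (hc : IsSubadditiveCocycle m c) (hL1 : ∀ γ, Integrable (c γ) m)
    (hℓ : IsLength ℓ)
    (hgood : ∀ᵐ x ∂m, IsGoodPoint c ℓ x) {T : Γ} {r : ℝ}
    (hr : Tendsto (fun n : ℕ => cocycleAverage m c (T ^ n) / n) atTop (𝓝 r)) {α : ℝ}
    (hα : r < α) : ∀ᵐ x ∂m, ∀ᶠ n : ℕ in atTop, c (T ^ n) x ≤ α * n := by
  rcases ae_frequently_or_ae_eventually hc hℓ hgood T (s := -1) (by simp) (-α) with h | h
  · exfalso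
    set d := α - r with hd
    have hd0 : 0 < d := by linarith
    obtain ⟨k, hk⟩ := exists_nat_one_div_lt (show 0 < d / 8 by linarith)
    set β := α - 1 / (k + 1) with hβ
    obtain ⟨K, hKr, hK⟩ := ((hr.eventually_lt_const (show r < r + d / 8 by linarith)).and
      (eventually_gt_atTop 0)).exists
    have hK0 : (0 : ℝ) < K := by exact_mod_cast hK
    have hR : MeasurePreserving (T ^ K • · : X → X) m m := measurePreserving_smul (T ^ K) m
    set S : ℕ → X → ℝ := fun q x => ∑ i ∈ Finset.range q, c (T ^ K) ((T ^ K • ·)^[i] x) with hS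
    have hTK := hℓ.nonneg (T ^ K)
    -- Bounds everything lost in passing from n to (n / K) K: the value at 1, the incomplete last
    -- block, and β (n % K). It is absorbed by the slack d / 8 once the number of blocks is large.
    set C' := ℓ 1 + (ℓ 1 + K * ℓ T) + |β| * K with hC'
    have hpow : ∀ᵐ x ∂m, ∀ q s : ℕ, c (T ^ (q * K + s)) x ≤
        c 1 x + c (T ^ s) (T ^ (q * K) • x) + S q x :=
      ae_all_iff.mpr fun q => ae_all_iff.mpr fun s => hc.pow_mul_add_le T K q s
    have hβ' : ∀ᵐ x ∂m, ∃ q : ℕ, 1 ≤ q ∧ -S q x ≤ -((β - d / 8) * K) * q := by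
      filter_upwards [h, hpow, hgood] with x h1 h2 hx
      obtain ⟨q₀, hq₀⟩ := exists_nat_gt (C' / (d / 8 * K))
      obtain ⟨n, hn, hn1⟩ := ((h1 k).and_eventually
        (eventually_ge_atTop ((q₀ + 1) * K))).exists
      have hdm : n / K * K + n % K = n := Nat.div_add_mod' n K
      have hqge : q₀ + 1 ≤ n / K := (Nat.le_div_iff_mul_le hK).mpr hn1
      refine ⟨n / K, by omega, ?_⟩
      have h3 := h2 (n / K) (n % K)
      rw [hdm] at h3
      have h4 := hx.bounded' 1
      have h5 := (hx.smul (T ^ (n / K * K))).bounded' (T ^ (n % K))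
      have h6 := hℓ.pow_le T (n % K)
      have hmod : ((n % K : ℕ) : ℝ) ≤ K := by exact_mod_cast (Nat.mod_lt n hK).le
      have h7 : ((n % K : ℕ) : ℝ) * ℓ T ≤ K * ℓ T :=
        mul_le_mul_of_nonneg_right hmod (hℓ.nonneg T)
      have hnq : (n : ℝ) = ((n / K : ℕ) : ℝ) * K + ((n % K : ℕ) : ℝ) := by exact_mod_cast hdm.symm
      have h8 : -(|β| * K) ≤ β * ((n % K : ℕ) : ℝ) := by
        have := neg_abs_le (β * ((n % K : ℕ) : ℝ))
        rw [abs_mul, Nat.abs_cast] at this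
        have := mul_le_mul_of_nonneg_left hmod (abs_nonneg β)
        linarith
      have h9 : C' ≤ d / 8 * K * ((n / K : ℕ) : ℝ) := by
        rw [div_lt_iff₀' (by positivity)] at hq₀
        have : (q₀ : ℝ) ≤ ((n / K : ℕ) : ℝ) := by exact_mod_cast (by omega : q₀ ≤ n / K)
        exact hq₀.le.trans (by gcongr)
      have h10 : β * n ≤ c (T ^ n) x := by
        have : -1 * c (T ^ n) x ≤ (-α + 1 / (k + 1)) * n := hn
        rw [hβ]
        linarith
      rw [hnq] at h10
      linarith
    obtain ⟨D, hD⟩ := integral_le_of_ae_exists_le hR (a := fun q x => -S q x)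
      (fun q => (Finset.measurable_sum _ fun i _ =>
        (hc.measurable (T ^ K)).comp (hR.iterate i).measurable).neg)
      (C := ℓ (T ^ K)) (β := -((β - d / 8) * K))
      (Eventually.of_forall fun x n k => by
        simp only [hS, Finset.sum_range_add, ← Function.iterate_add_apply]
        simp only [add_comm n]
        linarith)
      (by
        filter_upwards [hgood] with x hx n
        rw [abs_neg, abs_of_nonneg (Finset.sum_nonneg fun i _ => hc.nonneg _ _)]
        calc S n x ≤ ∑ i ∈ Finset.range n, ℓ (T ^ K) := Finset.sum_le_sum fun i _ => by
              rw [smul_iterate]; exact (hx.smul _).bounded' _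
          _ = ℓ (T ^ K) * n := by simp [mul_comm]
          _ ≤ _ := by gcongr; linarith)
      hβ' (ε := d / 8 * K) (by positivity)
    have hint : ∀ N : ℕ, ∫ x, -S N x ∂m = -(N * cocycleAverage m c (T ^ K)) := by
      intro N
      rw [integral_neg, hS,
        integral_finsetSum _ fun i _ => hR.integrable_comp_iterate (hL1 (T ^ K)) i]
      simp_rw [(hR.iterate _).integral_comp_ae (hL1 (T ^ K)).aestronglyMeasurable]
      simp [cocycleAverage]
    have hle : (β - d / 4) * K ≤ cocycleAverage m c (T ^ K) := by
      have hlim : Tendsto (fun N : ℕ => cocycleAverage m c (T ^ K) + D / N) atTop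
          (𝓝 (cocycleAverage m c (T ^ K) + 0)) :=
        tendsto_const_nhds.add (tendsto_const_div_atTop_nhds_zero_nat D)
      rw [add_zero] at hlim
      refine ge_of_tendsto hlim ?_
      filter_upwards [eventually_gt_atTop 0] with N hN
      have hN0 : (0 : ℝ) < N := by exact_mod_cast hN
      have h1 := hD N
      rw [hint] at h1
      have h2 : (β - d / 4) * K * N ≤ (cocycleAverage m c (T ^ K) + D / N) * N := by
        rw [add_mul, div_mul_cancel₀ _ hN0.ne']
        linarith
      exact le_of_mul_le_mul_right h2 hN0
    rw [div_lt_iff₀ hK0] at hKr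
    have : (β - d / 4) < r + d / 8 := lt_of_mul_lt_mul_right (hle.trans_lt hKr) hK0.le
    linarith
  · filter_upwards [h] with x ⟨k, hk⟩
    filter_upwards [hk] with n hn
    have : (0 : ℝ) ≤ 1 / (k + 1) * n := by positivity
    linarith

/-- Pointwise convergence of a bounded cocycle along the powers of `T`. -/
theorem ae_eventually_abs_sub_le (hc : IsSubadditiveCocycle m c) (hL1 : ∀ γ, Integrable (c γ) m)
    (hℓ : IsLength ℓ) (hgood : ∀ᵐ x ∂m, IsGoodPoint c ℓ x) {T : Γ} {r : ℝ}
    (hr : Tendsto (fun n : ℕ => cocycleAverage m c (T ^ n) / n) atTop (𝓝 r)) {ε : ℝ}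
    (hε : 0 < ε) : ∀ᵐ x ∂m, ∀ᶠ n : ℕ in atTop, |c (T ^ n) x - r * n| ≤ ε * n := by
  filter_upwards [ae_lower_bound hc hℓ hgood hr (sub_lt_self r hε),
    ae_upper_bound hc hL1 hℓ hgood hr (lt_add_of_pos_right r hε)] with x h1 h2
  filter_upwards [h1, h2] with n h1 h2
  rw [abs_le]
  constructor <;> linarith

/-- The points for which products of powers of the elements of the list may fail to have
nearby products that lead to a point outside of `F`. -/
def badSet (η : ℝ) (F : Set X) : List Γ → Set X
  | [] => F
  | T :: l => frequentlyVisiting (T • ·) η (badSet η F l)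

omit [IsProbabilityMeasure m] [Group.FG Γ] [Group.IsNilpotent Γ] in
include m in
lemma measurableSet_badSet {F : Set X} (hF : MeasurableSet F) (η : ℝ) (l : List Γ) :
    MeasurableSet (badSet η F l) := by
  induction l with
  | nil => exact hF
  | cons T l ih => exact measurableSet_frequentlyVisiting (measurePreserving_smul T m) ih η

-- Each side of the polygon costs one application of the maximal inequality, hence one factor 1 / η.
omit [Group.FG Γ] [Group.IsNilpotent Γ] in
lemma measureReal_badSet_le {F : Set X} (hF : MeasurableSet F) {η : ℝ} (hη : 0 < η) (l : List Γ) :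
    m.real (badSet η F l) ≤ m.real F / η ^ l.length := by
  induction l with
  | nil => simp [badSet]
  | cons T l ih =>
    refine (measureReal_frequentlyVisiting_le (measurePreserving_smul T m)
      (measurableSet_badSet (m := m) hF η l) hη).trans ?_
    rw [List.length_cons, pow_succ, ← div_div]
    gcongr

-- If no exponent b in [n, n + κ n] were admissible, the T-orbit of x would be bad at ⌊κ n⌋ + 1 ≥ κ
-- n of its first n + ⌊κ n⌋ + 1 ≤ (2 + κ) n times. This is a frequency of at least κ / (2 + κ),
-- which x not in the bad set excludes.
omit [MeasurableSpace X] [MeasurableConstSMul Γ X] [Group.FG Γ] [Group.IsNilpotent Γ] in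
lemma exists_near_smul_notMem {F : Set X} {κ : ℝ} (hκ : 0 < κ) {n : ℕ} (hn : 1 ≤ n) (l : List Γ)
    {x : X} (hx : x ∉ badSet (κ / (2 + κ)) F l) :
    ∃ z, IsNearPowProd (κ * n) n l z ∧ z • x ∉ F := by
  induction l generalizing x with
  | nil => exact ⟨1, rfl, by simpa [badSet] using hx⟩
  | cons T l ih =>
    set B := badSet (κ / (2 + κ)) F l with hB
    have hn1 : (1 : ℝ) ≤ n := by exact_mod_cast hn
    obtain ⟨b, hb1, hb2, hb⟩ : ∃ b : ℕ, n ≤ b ∧ b ≤ n + ⌊κ * n⌋₊ ∧ T ^ b • x ∉ B := by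
      by_contra hcon
      push Not at hcon
      refine hx ⟨n + (⌊κ * n⌋₊ + 1), by omega, ?_⟩
      have h0 : ∀ y, 0 ≤ B.indicator (1 : X → ℝ) y := fun y =>
        Set.indicator_nonneg (fun _ _ => zero_le_one) y
      rw [Finset.sum_range_add]
      have h1 : ∑ i ∈ Finset.range (⌊κ * n⌋₊ + 1),
          B.indicator (1 : X → ℝ) ((T • ·)^[n + i] x) = (⌊κ * n⌋₊ + 1 : ℕ) := by
        rw [Finset.sum_congr rfl (g := fun _ => (1 : ℝ))]
        · simp
        · intro i hi
          rw [Finset.mem_range] at hi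
          rw [smul_iterate]
          have : T ^ (n + i) • x ∈ B := hcon (n + i) (by omega) (by omega)
          simp [this]
      rw [h1]
      have h2 : 0 ≤ ∑ i ∈ Finset.range n, B.indicator (1 : X → ℝ) ((T • ·)^[i] x) :=
        Finset.sum_nonneg fun i _ => h0 _
      have h3 := (Nat.lt_floor_add_one (κ * n)).le
      have h4 := Nat.floor_le (show 0 ≤ κ * n by positivity)
      have h5 : κ / (2 + κ) * ((n + (⌊κ * n⌋₊ + 1) : ℕ) : ℝ) ≤ κ * n := by
        calc κ / (2 + κ) * ((n + (⌊κ * n⌋₊ + 1) : ℕ) : ℝ) ≤ κ / (2 + κ) * ((2 + κ) * n) := by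
              gcongr
              push_cast
              linarith
          _ = κ * n := by field_simp
      push_cast at h5 ⊢
      linarith
    obtain ⟨z, hz, hzF⟩ := ih hb
    refine ⟨z * T ^ b, ⟨b, hb1, ?_, z, hz, rfl⟩, by rwa [mul_smul]⟩
    have h4 := Nat.floor_le (show 0 ≤ κ * n by positivity)
    have h6 : (b : ℝ) ≤ n + (⌊κ * n⌋₊ : ℕ) := by exact_mod_cast hb2
    linarith

/-- Pointwise convergence of a bounded cocycle along the sides of a polygonal path. -/
theorem ae_tendsto_cocycle_reversePowProd (hc : IsSubadditiveCocycle m c)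
    (hb : ∀ γ, MemLp (c γ) ∞ m) (T : Γ) (l : List Γ) {r : ℝ}
    (hr : Tendsto (fun n : ℕ => cocycleAverage m c (T ^ n) / n) atTop (𝓝 r)) :
    ∀ᵐ x ∂m, Tendsto (fun n : ℕ => c (T ^ n) (reversePowProd n l • x) / n) atTop (𝓝 r) := by
  have := Group.FG.countable_of_fg Γ
  have hL1 : ∀ γ, Integrable (c γ) m := fun γ => (hb γ).integrable le_top
  set ℓ : Γ → ℝ := fun γ => cocycleSup m c γ + cocycleSup m c γ⁻¹ with hℓdef
  have hℓ : IsLength ℓ := isLength_symmetrization (fun γ => ENNReal.toReal_nonneg)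
    (cocycleSup_mul_le hc hb)
  have hgood : ∀ᵐ x ∂m, IsGoodPoint c ℓ x := ae_isGoodPoint hc fun γ => by
    filter_upwards [ae_le_cocycleSup hb γ] with x hx
    exact hx.trans (le_add_of_nonneg_right ENNReal.toReal_nonneg)
  have main : ∀ ε > 0, ∀ᵐ x ∂m, ∀ᶠ n : ℕ in atTop,
      |c (T ^ n) (reversePowProd n l • x) - r * n| ≤ ε * n := by
    intro ε hε
    obtain ⟨κ, hκ, hnear⟩ := exists_length_near_le hℓ l T (δ := ε / 4) (by positivity)
    set η := κ / (2 + κ) with hη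
    have hη0 : 0 < η := by positivity
    -- The points where convergence from a fixed base point fails at some time after N. Their
    -- measure tends to 0 while κ, and hence η, stays fixed, so almost every x avoids the bad set of
    -- some F N.
    set F : ℕ → Set X := fun N => {x | ∃ n : ℕ, N ≤ n ∧ ε / 2 * n < |c (T ^ n) x - r * n|} with hF
    have hFm : ∀ N, MeasurableSet (F N) := by
      intro N
      have : F N = ⋃ n : ℕ, ⋃ (_ : N ≤ n), {x | ε / 2 * n < |c (T ^ n) x - r * n|} := by
        ext x; simp [hF]
      rw [this]
      refine MeasurableSet.iUnion fun n => MeasurableSet.iUnion fun _ => ?_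
      exact measurableSet_lt measurable_const
        (measurable_norm.comp ((hc.measurable _).sub_const (r * n)))
    have hFanti : Antitone F := fun N N' h x ⟨n, h1, h2⟩ => ⟨n, h.trans h1, h2⟩
    have hFnull : m (⋂ N, F N) = 0 := by
      refine measure_mono_null (fun x hx => ?_)
        (ae_eventually_abs_sub_le hc hL1 hℓ hgood hr (half_pos hε))
      intro hev
      obtain ⟨N, hN⟩ := eventually_atTop.mp hev
      obtain ⟨n, hn, h⟩ := Set.mem_iInter.mp hx N
      exact absurd (hN n hn) (not_le.mpr h)
    have hFlim : Tendsto (fun N => m.real (F N) / η ^ l.length) atTop (𝓝 0) := by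
      have h1 := tendsto_measure_iInter_atTop (fun N => (hFm N).nullMeasurableSet) hFanti
        ⟨0, measure_ne_top m _⟩
      rw [hFnull] at h1
      have h2 := (ENNReal.tendsto_toReal ENNReal.zero_ne_top).comp h1
      simpa [Measure.real] using h2.div_const (η ^ l.length)
    have hnull : m (⋂ N, badSet η (F N) l) = 0 := by
      have h1 : m.real (⋂ N, badSet η (F N) l) ≤ 0 := ge_of_tendsto' hFlim fun N =>
        (measureReal_mono (Set.iInter_subset _ N)).trans (measureReal_badSet_le (hFm N) hη0 l)
      have h2 := le_antisymm h1 measureReal_nonneg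
      rwa [measureReal_eq_zero_iff] at h2
    filter_upwards [measure_eq_zero_iff_ae_notMem.mp hnull, hgood] with x hx hxg
    obtain ⟨N, hN⟩ : ∃ N, x ∉ badSet η (F N) l := by simpa using hx
    filter_upwards [hnear, eventually_ge_atTop N, eventually_ge_atTop 1] with n h1 h2 h3
    obtain ⟨z, hz, hzF⟩ := exists_near_smul_notMem hκ h3 l hN
    obtain ⟨h4, h5⟩ := h1 z hz
    -- Passing from g_n x to z x costs ε n / 4 for the displacement and ε n / 4 for its conjugate by
    -- T ^ n. The remaining ε n / 2 is the error at z x, which lies outside F N.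
    have h6 := (hxg.smul (reversePowProd n l)).abs_sub_le hℓ (T ^ n) (z * (reversePowProd n l)⁻¹)
    rw [smul_smul, inv_mul_cancel_right] at h6
    have h7 : |c (T ^ n) (z • x) - r * n| ≤ ε / 2 * n := by
      by_contra hcon
      exact hzF ⟨n, h2, not_le.mp hcon⟩
    rw [abs_le] at h6 h7
    rw [abs_le]
    constructor <;> linarith
  have main' : ∀ᵐ x ∂m, ∀ k : ℕ, ∀ᶠ n : ℕ in atTop,
      |c (T ^ n) (reversePowProd n l • x) - r * n| ≤ 1 / ((k : ℝ) + 1) * n :=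
    ae_all_iff.mpr fun k => main _ (by positivity)
  filter_upwards [main'] with x hx
  rw [Metric.tendsto_nhds]
  intro ε hε
  obtain ⟨k, hk⟩ := exists_nat_one_div_lt hε
  filter_upwards [hx k, eventually_gt_atTop 0] with n h1 hn
  have hn0 : (0 : ℝ) < n := by exact_mod_cast hn
  rw [Real.dist_eq, show c (T ^ n) (reversePowProd n l • x) / n - r =
    (c (T ^ n) (reversePowProd n l • x) - r * n) / n by field_simp, abs_div, Nat.abs_cast,
    div_lt_iff₀ hn0]
  exact h1.trans_lt (by gcongr)

end Pointwise

/-! ### Polygonal paths and the main theorem -/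

section Main

lemma polygonalProd_eq_reversePowProd {Γ : Type*} [Group Γ] {k : ℕ} (T : Fin k → Γ) (n j : ℕ) :
    polygonalProd T n j = reversePowProd n ((List.ofFn T).take j) :=
  (reversePowProd_eq n _).symm

variable {X : Type*} [MeasurableSpace X] {m : Measure X}

lemma TendstoL1.sum {ι : Type*} {s : Finset ι} {h : ι → ℕ → X → ℝ} {a : ι → ℝ}
    [IsFiniteMeasure m] (hh : ∀ i ∈ s, TendstoL1 m (h i) (a i)) :
    TendstoL1 m (fun n x => ∑ i ∈ s, h i n x) (∑ i ∈ s, a i) := by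
  refine ⟨fun n => memLp_finsetSum s fun i hi => (hh i hi).1 n, ?_⟩
  have hlim : Tendsto (fun n => ∑ i ∈ s, eLpNorm (fun x => h i n x - a i) 1 m) atTop (𝓝 0) := by
    simpa using tendsto_finsetSum s fun i hi => (hh i hi).2
  refine tendsto_of_tendsto_of_tendsto_of_le_of_le tendsto_const_nhds hlim
    (fun _ => zero_le) fun n => ?_
  have hsum : (fun x => ∑ i ∈ s, h i n x - ∑ i ∈ s, a i) =
      ∑ i ∈ s, fun x => h i n x - a i := by
    ext x
    simp
  rw [hsum]
  exact eLpNorm_sum_le (fun i hi => ((hh i hi).1 n).aestronglyMeasurable.sub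
    aestronglyMeasurable_const) le_rfl

variable {Γ : Type*} [Group Γ] [Group.FG Γ] [Group.IsNilpotent Γ] [IsProbabilityMeasure m]
  [MulAction Γ X] [MeasurableConstSMul Γ X] [ErgodicSMul Γ X m] {c : Γ → X → ℝ}

/-- Convergence in mean of a cocycle along translated powers of `T`. -/
theorem tendstoL1_cocycle_pow_smul (hc : IsSubadditiveCocycle m c)
    (hL1 : ∀ γ, Integrable (c γ) m) {T : Γ} {r : ℝ}
    (hr : Tendsto (fun n : ℕ => cocycleAverage m c (T ^ n) / n) atTop (𝓝 r)) (g : ℕ → Γ) :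
    TendstoL1 m (fun n x => 1 / (n : ℝ) * c (T ^ n) (g n • x)) r := by
  refine ⟨fun n => memLp_one_iff_integrable.mpr
    ((integrable_cocycle_smul hL1 (T ^ n) (g n)).const_mul _), ?_⟩
  have hlim := ENNReal.tendsto_ofReal (tendsto_integral_abs_cocycle_sub hc hL1 hr)
  rw [ENNReal.ofReal_zero] at hlim
  refine hlim.congr fun n => ?_
  have hint : Integrable (fun x => c (T ^ n) x / n - r) m :=
    ((hL1 (T ^ n)).div_const _).sub (integrable_const r)
  -- The limit is constant, so the translation by g n, which preserves m, leaves the L¹ distance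
  -- unchanged, whatever the sequence g is.
  have h1 : (fun x => 1 / (n : ℝ) * c (T ^ n) (g n • x) - r) =
      (fun x => c (T ^ n) x / n - r) ∘ (g n • ·) := by
    ext x
    simp [div_eq_inv_mul]
  rw [h1, eLpNorm_comp_measurePreserving hint.aestronglyMeasurable (measurePreserving_smul (g n) m),
    eLpNorm_one_eq_lintegral_enorm, ← ofReal_integral_norm_eq_lintegral_enorm hint]
  rfl

end Main

theorem mainTheorem4 {Γ X : Type*} [Group Γ] [Group.FG Γ] [Group.IsNilpotent Γ]
    (hΓ : ∀ γ : Γ, IsOfFinOrder γ → γ = 1)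
    (hab : ∀ a : Abelianization Γ, IsOfFinOrder a → a = 1)
    [MeasurableSpace X] (m : Measure X) [IsProbabilityMeasure m]
    [MulAction Γ X] [MeasurableConstSMul Γ X] [ErgodicSMul Γ X m]
    (c : Γ → X → ℝ) (hc : IsSubadditiveCocycle m c) (hL1 : ∀ γ, MemLp (c γ) 1 m) :
    ∃ φ : RealAbelianization Γ → ℝ,
      -- `φ` is the unique homogeneous representative of `f`
      IsHomogeneousRepresentative (abelianizationInf (cocycleAverage m c)) φ ∧
      (∀ ψ : RealAbelianization Γ → ℝ,
        IsHomogeneousRepresentative (abelianizationInf (cocycleAverage m c)) ψ → ψ = φ) ∧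
      -- convergence in `L¹`
      (∀ (k : ℕ) (T : Fin k → Γ),
        (∀ j : Fin k,
          TendstoL1 m (fun n x => 1 / (n : ℝ) * c (T j ^ n) (polygonalProd T n j • x))
            (φ (toRealAbelianization (Abelianization.of (T j))))) ∧
        TendstoL1 m
          (fun n x => 1 / (n : ℝ) * ∑ j : Fin k, c (T j ^ n) (polygonalProd T n j • x))
          (∑ j : Fin k, φ (toRealAbelianization (Abelianization.of (T j))))) ∧
      -- almost everywhere convergence for bounded cocycles
      ((∀ γ, MemLp (c γ) ∞ m) →
        ∀ (k : ℕ) (T : Fin k → Γ),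
          (∀ j : Fin k, ∀ᵐ x ∂m,
            Tendsto (fun n : ℕ => 1 / (n : ℝ) * c (T j ^ n) (polygonalProd T n j • x)) atTop
              (𝓝 (φ (toRealAbelianization (Abelianization.of (T j)))))) ∧
          ∀ᵐ x ∂m,
            Tendsto
              (fun n : ℕ => 1 / (n : ℝ) * ∑ j : Fin k, c (T j ^ n) (polygonalProd T n j • x))
              atTop
              (𝓝 (∑ j : Fin k, φ (toRealAbelianization (Abelianization.of (T j)))))) := by
  have hL1' : ∀ γ, Integrable (c γ) m := fun γ => memLp_one_iff_integrable.mp (hL1 γ)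
  have h0 := cocycleAverage_nonneg hc
  have hmul := cocycleAverage_mul_le hc hL1'
  obtain ⟨φ, hφ, huniq, hlim⟩ := exists_unique_homogeneousRepresentative hab
    (abelianizationInf_nonneg h0) (abelianizationInf_mul_le h0 hmul)
  have hr : ∀ T : Γ, Tendsto (fun n : ℕ => cocycleAverage m c (T ^ n) / n) atTop
      (𝓝 (φ (toRealAbelianization (Abelianization.of T)))) := fun T =>
    tendsto_pow_div_of_abelianizationInf h0 hmul (hlim (Abelianization.of T))
  refine ⟨φ, hφ, huniq, fun k T => ?_, fun hb k T => ?_⟩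
  · have hside := fun j : Fin k =>
      tendstoL1_cocycle_pow_smul hc hL1' (hr (T j)) fun n => polygonalProd T n j
    refine ⟨hside, ?_⟩
    simp_rw [Finset.mul_sum]
    exact TendstoL1.sum fun j _ => hside j
  · have hside : ∀ j : Fin k, ∀ᵐ x ∂m,
        Tendsto (fun n : ℕ => 1 / (n : ℝ) * c (T j ^ n) (polygonalProd T n j • x)) atTop
          (𝓝 (φ (toRealAbelianization (Abelianization.of (T j))))) := by
      intro j
      filter_upwards [ae_tendsto_cocycle_reversePowProd hc hb (T j) ((List.ofFn T).take j)
        (hr (T j))] with x hx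
      simpa only [polygonalProd_eq_reversePowProd, one_div_mul_eq_div] using hx
    refine ⟨hside, ?_⟩
    filter_upwards [ae_all_iff.mpr hside] with x hx
    simp_rw [Finset.mul_sum]
    exact tendsto_finsetSum _ fun j _ => hx j
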